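/- Let $3\le d<\omega$. Consider algebras $\mathcal C=(C,0,1,+,-,\mathsf c_i,\mathsf s^i_j,\mathsf p_{ij},\mathsf d_{ij})_{i,j<d}$, where $x\cdot y=-(-x+-y)$ and $x\le y$ means $x+y=y$. Such an algebra is a polyadic equality algebra ($\mathcal C\in\mathsf{PEA}_d$) if it satisfies the equations of Boolean algebras for $0,1,+,-$ and, for all $i,j,k<d$: (1) $\mathsf s^i_ix=\mathsf p_{ii}x=x$, $\mathsf p_{ij}x=\mathsf p_{ji}x$; (2) $x\le \mathsf c_ix$; (3) $\mathsf c_i(x+y)=\mathsf c_ix+\mathsf c_iy$; (4) $\mathsf s^i_j\mathsf c_ix=\mathsf c_ix$; (5) $\mathsf c_i\mathsf s^i_jx=\mathsf s^i_jx$ if $i\ne j$; (6) $\mathsf s^i_j\mathsf c_kx=\mathsf c_k\mathsf s^i_jx$ if $k\notin\{i,j\}$; (7) $\mathsf s^i_j,\mathsf p_{ij}$ preserve $+$ and $-$; (8) $\mathsf p_{ij}\mathsf p_{ij}x=x$; (9) $\mathsf p_{ij}\mathsf p_{ik}x=\mathsf p_{jk}\mathsf p_{ij}x$ if $|\{i,j,k\}|=3$;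 (10) $\mathsf p_{ij}\mathsf s^j_ix=\mathsf s^i_jx$; (11) $\mathsf s^i_j\mathsf d_{ij}=1$; (12) $x\cdot\mathsf d_{ij}\le\mathsf s^i_jx$. The full set algebra with base $U$ is $\wp({}^dU)$ with the Boolean set operations, $\mathsf C_iX=\{s:\exists t\in X\ \forall k\neq i\ s_k=t_k\}$, $\mathsf S^i_jX=\{s: s(i/s_j)\in X\}$ (where $s(i/u)$ is $s$ with its $i$-th entry replaced by $u$), $\mathsf P_{ij}X=\{s\circ[i,j]:s\in X\}$ (where $[i,j]$ is the transposition), $\mathsf D_{ij}=\{s:s_i=s_j\}$. $\mathcal C$ is representable ($\mathcal C\in\mathsf{RPEA}_d$) if it is isomorphic to a subdirect product of subalgebras of full set algebras. *Networks and games.* A prenetwork $N$ over $\mathcal C$ is a finite set of nodes with a label $N(\bar x)\in C$ for each $d$-tuple $\bar x$ of nodes. Write $\bar x\equiv_i\bar y$ if $x_k=y_k$ for all $k\ne i$, and $\delta(\bar y)=\prod_{j,k<d,\,y_j=y_k}\mathsf d_{jk}$. $N$ is a network if for all tuples $\bar x,\bar y,\bar z$ of nodes and all $i,j,k<d$: (i)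 $x_i=x_j$ implies $N(\bar x)\le\mathsf d_{ij}$; (ii) $\bar x\equiv_i\bar y$ implies $N(\bar x)\cdot\mathsf c_iN(\bar y)\ne0$; (iii) $\bar x=\bar y\circ[i,j]$ implies $N(\bar x)\cdot\mathsf p_{ij}N(\bar y)\neq0$; (iv) $\bar x\equiv_i\bar y$, $x_i=z_j$, $y_i=z_k$ and $N(\bar z)\le\mathsf d_{jk}$ imply $N(\bar x)\cdot N(\bar y)\ne0$. In the game $G_n(N,\mathcal C)$, a play is a sequence $N=N_0,\dots,N_n$ of prenetworks; in round $t<n$ player $\forall$ picks a tuple $\bar x$ of nodes of $N_t$, an element $a\in C$ and one of the following moves, which $\exists$ accepts or rejects, giving $N_{t+1}$ (labels not mentioned are those of $N_t$): - $i<d$. Reject: $N_{t+1}(\bar x)=N_t(\bar x)\cdot-\mathsf c_ia$. Accept: add a new node $z$; $N_{t+1}(\bar x)=N_t(\bar x)\cdot\mathsf c_ia$; $N_{t+1}(\bar z)=a\cdot\delta(\bar z)$ where $\bar z\equiv_i\bar x$, $z_i=z$; and $N_{t+1}(\bar y)=\delta(\bar y)$ for every other $\bar y$ involving $z$. - $i=d$.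 Reject: $N_{t+1}(\bar x)=N_t(\bar x)\cdot-a$. Accept: $N_{t+1}(\bar x)=N_t(\bar x)\cdot a$. - $i,j<d$ (polyadic move). Reject: $N_{t+1}(\bar x)=N_t(\bar x)\cdot-\mathsf p_{ij}a$. Accept: the label of $\bar x$ is multiplied by $\mathsf p_{ij}a$, and then the label of $\bar x\circ[i,j]$ is multiplied by $a$. $\exists$ wins the play if $N_0,\dots,N_n$ are all networks. For $a\ne0$, $I_a$ has nodes $0,\dots,d-1$, $I_a(0,\dots,d-1)=a$, and $I_a(\bar x)=\delta(\bar x)$ for other $\bar x$. *Sentences and equations.* For a term network $N$ (a prenetwork labelled by terms), let $\mathrm{CNet}^d(N)$ be the conjunction of the formulas expressing (i)–(iv). For a move $m$ without its element, let $\mathrm{In}(N,m,\tau)$ and $\mathrm{Out}(N,m,\tau)$ be the term networks resulting from accepting, respectively rejecting, $m$ with the term $\tau$. Put $\psi^d_0(N)=\mathrm{CNet}^d(N)$, and $$\psi^d_{n+1}(N)=\forall y\bigwedge_m\bigl(\psi_n^d(\mathrm{In}(N,m,y))\lor\psi_n^d(\mathrm{Out}(N,m,y))\bigr)$$ with $y$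 a new variable and the bound variables of the two disjuncts of each disjunction distinct, and let $\varphi^d_n$ be $\forall x\,(x\ne0\to\psi^d_n(J_x))$, where $J_x$ is $I_a$ with the variable $x$ for $a$. Let $\mathsf c(\tau)=\mathsf c_0\mathsf c_1\cdots\mathsf c_{d-1}\tau$. The equation $\varepsilon^d_n$ is $T(\varphi^d_n)=1$, where $T$ deletes universal quantifiers, $T(\sigma=\tau)=-\mathsf c(\sigma\cdot-\tau+-\sigma\cdot\tau)$, and $T(\neg\varphi)=-T(\varphi)$, $T(\varphi\land\psi)=T(\varphi)\cdot T(\psi)$, $T(\varphi\lor\psi)=T(\varphi)+T(\psi)$, $T(\varphi\to\psi)=-T(\varphi)+T(\psi)$. **Theorem.** Let $3\le d<\omega$. 1. An algebra $\mathcal C$ of the above similarity type belongs to $\mathsf{RPEA}_d$ if and only if it satisfies the equations of $\mathsf{PEA}_d$ and all the equations $\varepsilon^d_n$, $n<\omega$. 2. The sequence $(\varepsilon^d_n)_{n<\omega}$ is computable, and the set $\{\varepsilon^d_n:n<\omega\}$ and its union with the set of the equations of $\mathsf{PEA}_d$ are recursive. 3. For $\mathcal C\in\mathsf{PEA}_d$: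 $\mathcal C$ is representable if and only if $\exists$ has a winning strategy in $G_n(I_a,\mathcal C)$ for every $n<\omega$ and every non-zero $a\in C$. 4. For $\mathcal C\in\mathsf{PEA}_d$ and $n<\omega$: $\mathcal C\models\varphi^d_n$ if and only if $\exists$ has a winning strategy in $G_n(I_a,\mathcal C)$ for every non-zero $a\in C$. 5. If $\mathcal C\in\mathsf{PEA}_d$ is simple, then $\mathsf c(x)=1$ for every $x\ne0$ in $C$, and for every $n<\omega$: $\mathcal C\models\varepsilon^d_n$ if and only if $\mathcal C\models\varphi^d_n$. -/

import Mathlib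

universe u v

namespace Polyadic

/-! ### Algebras of the polyadic equality type and their equational logic -/

/-- An arbitrary algebra with universe `A` of the similarity type of `d`-dimensional polyadic
equality algebras (no laws are imposed here). `cyl i` is the cylindrification `c_i`, `subst i j` is
the replacement `s^i_j` (upper index `i`, lower index `j`), `perm i j` is the transposition
`p_{ij}` and `diag i j` is the diagonal constant `d_{ij}`. -/
structure PAlg (d : ℕ) (A : Type u) where
  zero : A
  one : A
  add : A → A → A
  neg : A → A
  cyl : Fin d → A → A
  subst : Fin d → Fin d → A → A
  perm : Fin d → Fin d → A → A
  diag : Fin d → Fin d → A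

namespace PAlg

variable {d : ℕ} {A : Type u}

/-- Boolean meet, as the usual abbreviation `x · y = -(-x + -y)`. -/
def mul (C : PAlg d A) (x y : A) : A := C.neg (C.add (C.neg x) (C.neg y))

/-- `x ≤ y` abbreviates `x + y = y`. -/
def le (C : PAlg d A) (x y : A) : Prop := C.add x y = y

/-- The product of a finite list of elements. -/
def listProd (C : PAlg d A) (l : List A) : A := l.foldr C.mul C.one

/-- `c_0 c_1 … c_{d-1} x`. -/
def cylAll (C : PAlg d A) (x : A) : A := (List.finRange d).foldr C.cyl x

end PAlg

/-- Terms of the similarity type, with variables `var 0, var 1, …`. -/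
inductive Term (d : ℕ) : Type
  | var : ℕ → Term d
  | zero : Term d
  | one : Term d
  | add : Term d → Term d → Term d
  | neg : Term d → Term d
  | cyl : Fin d → Term d → Term d
  | subst : Fin d → Fin d → Term d → Term d
  | perm : Fin d → Fin d → Term d → Term d
  | diag : Fin d → Fin d → Term d

namespace Term

variable {d : ℕ} {A : Type u}

/-- The absolutely free algebra of terms. -/
def alg (d : ℕ) : PAlg d (Term d) where
  zero := zero
  one := one
  add := add
  neg := neg
  cyl := cyl
  subst := subst
  perm := perm
  diag := diag

instance : Zero (Term d) := ⟨zero⟩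
instance : One (Term d) := ⟨one⟩
instance : Add (Term d) := ⟨add⟩
instance : Neg (Term d) := ⟨neg⟩
instance : Mul (Term d) := ⟨(alg d).mul⟩

/-- The value of a term in `C` under the assignment `v`. -/
def eval (C : PAlg d A) (v : ℕ → A) : Term d → A
  | var n => v n
  | zero => C.zero
  | one => C.one
  | add s t => C.add (s.eval C v) (t.eval C v)
  | neg t => C.neg (t.eval C v)
  | cyl i t => C.cyl i (t.eval C v)
  | subst i j t => C.subst i j (t.eval C v)
  | perm i j t => C.perm i j (t.eval C v)
  | diag i j => C.diag i j

/-- A Gödel numbering of terms. -/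
def code : Term d → ℕ
  | var n => Nat.pair 1 n
  | zero => Nat.pair 2 0
  | one => Nat.pair 3 0
  | add s t => Nat.pair 4 (Nat.pair s.code t.code)
  | neg t => Nat.pair 5 t.code
  | cyl i t => Nat.pair 6 (Nat.pair i t.code)
  | subst i j t => Nat.pair 7 (Nat.pair i (Nat.pair j t.code))
  | perm i j t => Nat.pair 8 (Nat.pair i (Nat.pair j t.code))
  | diag i j => Nat.pair 9 (Nat.pair i j)

theorem code_injective : Function.Injective (code : Term d → ℕ) := by
  intro s
  induction s with
  | var n => intro t h; cases t <;> simp_all [code, Nat.pair_eq_pair]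
  | zero => intro t h; cases t <;> simp_all [code, Nat.pair_eq_pair]
  | one => intro t h; cases t <;> simp_all [code, Nat.pair_eq_pair]
  | add s t hs ht =>
    intro r h
    cases r <;> simp only [code, Nat.pair_eq_pair] at h <;> try omega
    rw [hs h.2.1, ht h.2.2]
  | neg s hs =>
    intro r h
    cases r <;> simp only [code, Nat.pair_eq_pair] at h <;> try omega
    rw [hs h.2]
  | cyl i s hs =>
    intro r h
    cases r <;> simp only [code, Nat.pair_eq_pair] at h <;> try omega
    rw [hs h.2.2, Fin.ext h.2.1]
  | subst i j s hs =>
    intro r h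
    cases r <;> simp only [code, Nat.pair_eq_pair] at h <;> try omega
    rw [hs h.2.2.2, Fin.ext h.2.1, Fin.ext h.2.2.1]
  | perm i j s hs =>
    intro r h
    cases r <;> simp only [code, Nat.pair_eq_pair] at h <;> try omega
    rw [hs h.2.2.2, Fin.ext h.2.1, Fin.ext h.2.2.1]
  | diag i j =>
    intro r h
    cases r <;> simp only [code, Nat.pair_eq_pair] at h <;> try omega
    rw [Fin.ext h.2.1, Fin.ext h.2.2]

end Term

/-- An equation `lhs = rhs`. -/
structure Equation (d : ℕ) where
  lhs : Term d
  rhs : Term d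

/-- The Gödel number of an equation. -/
def Equation.code {d : ℕ} (e : Equation d) : ℕ := Nat.pair e.lhs.code e.rhs.code

theorem Equation.code_injective {d : ℕ} : Function.Injective (Equation.code : Equation d → ℕ) := by
  rintro ⟨a, b⟩ ⟨a', b'⟩ h
  simp only [Equation.code, Nat.pair_eq_pair] at h
  rw [Term.code_injective h.1, Term.code_injective h.2]

/-- `C ⊨ e`: the equation `e` is an identity of `C`. -/
def PAlg.Sat {d : ℕ} {A : Type u} (C : PAlg d A) (e : Equation d) : Prop :=
  ∀ v : ℕ → A, e.lhs.eval C v = e.rhs.eval C v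

/-- A set of equations is recursive if the set of its Gödel numbers is. -/
def IsRecursive {d : ℕ} (S : Set (Equation d)) : Prop :=
  ComputablePred fun m : ℕ => ∃ e ∈ S, e.code = m

open Term in
/-- The equations defining `PEA_d`: the equations of Boolean algebras, and the postulates of
quasipolyadic equality algebras of dimension `d`. An inequality `s ≤ t` is the equation
`s + t = t`. -/
inductive IsPEAEquation (d : ℕ) : Equation d → Prop
  | add_comm : IsPEAEquation d ⟨var 0 + var 1, var 1 + var 0⟩
  | add_assoc : IsPEAEquation d ⟨var 0 + var 1 + var 2, var 0 + (var 1 + var 2)⟩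
  | neg_neg : IsPEAEquation d ⟨- -var 0, var 0⟩
  | absorb : IsPEAEquation d ⟨var 0 + var 0 * var 1, var 0⟩
  | distrib : IsPEAEquation d ⟨var 0 * (var 1 + var 2), var 0 * var 1 + var 0 * var 2⟩
  | add_compl : IsPEAEquation d ⟨var 0 + -var 0, 1⟩
  | mul_compl : IsPEAEquation d ⟨var 0 * -var 0, 0⟩
  | subst_self (i : Fin d) : IsPEAEquation d ⟨subst i i (var 0), var 0⟩
  | perm_self (i : Fin d) : IsPEAEquation d ⟨perm i i (var 0), var 0⟩
  | perm_comm (i j : Fin d) : IsPEAEquation d ⟨perm i j (var 0), perm j i (var 0)⟩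
  | le_cyl (i : Fin d) : IsPEAEquation d ⟨var 0 + cyl i (var 0), cyl i (var 0)⟩
  | cyl_add (i : Fin d) :
      IsPEAEquation d ⟨cyl i (var 0 + var 1), cyl i (var 0) + cyl i (var 1)⟩
  | subst_cyl (i j : Fin d) : IsPEAEquation d ⟨subst i j (cyl i (var 0)), cyl i (var 0)⟩
  | cyl_subst (i j : Fin d) (h : i ≠ j) :
      IsPEAEquation d ⟨cyl i (subst i j (var 0)), subst i j (var 0)⟩
  | subst_cyl_comm (i j k : Fin d) (hi : k ≠ i) (hj : k ≠ j) :
      IsPEAEquation d ⟨subst i j (cyl k (var 0)), cyl k (subst i j (var 0))⟩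
  | subst_add (i j : Fin d) :
      IsPEAEquation d ⟨subst i j (var 0 + var 1), subst i j (var 0) + subst i j (var 1)⟩
  | subst_neg (i j : Fin d) : IsPEAEquation d ⟨subst i j (-var 0), -subst i j (var 0)⟩
  | perm_add (i j : Fin d) :
      IsPEAEquation d ⟨perm i j (var 0 + var 1), perm i j (var 0) + perm i j (var 1)⟩
  | perm_neg (i j : Fin d) : IsPEAEquation d ⟨perm i j (-var 0), -perm i j (var 0)⟩
  | perm_perm (i j : Fin d) : IsPEAEquation d ⟨perm i j (perm i j (var 0)), var 0⟩
  | perm_perm_comm (i j k : Fin d) (hij : i ≠ j) (hik : i ≠ k) (hjk : j ≠ k) :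
      IsPEAEquation d ⟨perm i j (perm i k (var 0)), perm j k (perm i j (var 0))⟩
  | perm_subst (i j : Fin d) : IsPEAEquation d ⟨perm i j (subst j i (var 0)), subst i j (var 0)⟩
  | subst_diag (i j : Fin d) : IsPEAEquation d ⟨subst i j (diag i j), 1⟩
  | diag_le (i j : Fin d) :
      IsPEAEquation d ⟨var 0 * diag i j + subst i j (var 0), subst i j (var 0)⟩

/-- The set of equations defining `PEA_d`. -/
def peaEquations (d : ℕ) : Set (Equation d) := {e | IsPEAEquation d e}

/-- `C` is a polyadic equality algebra of dimension `d`. -/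
def PAlg.IsPEA {d : ℕ} {A : Type u} (C : PAlg d A) : Prop := ∀ e ∈ peaEquations d, C.Sat e

/-! ### Set algebras, representability, simplicity -/

/-- `f` is a homomorphism from `C` to `D`. -/
structure IsHom {d : ℕ} {A : Type u} {B : Type v} (C : PAlg d A) (D : PAlg d B) (f : A → B) :
    Prop where
  map_zero : f C.zero = D.zero
  map_one : f C.one = D.one
  map_add : ∀ x y, f (C.add x y) = D.add (f x) (f y)
  map_neg : ∀ x, f (C.neg x) = D.neg (f x)
  map_cyl : ∀ i x, f (C.cyl i x) = D.cyl i (f x)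
  map_subst : ∀ i j x, f (C.subst i j x) = D.subst i j (f x)
  map_perm : ∀ i j x, f (C.perm i j x) = D.perm i j (f x)
  map_diag : ∀ i j, f (C.diag i j) = D.diag i j

/-- The full polyadic equality set algebra of dimension `d` with base `U`. -/
def fullSetAlg (d : ℕ) (U : Type u) : PAlg d (Set (Fin d → U)) where
  zero := ∅
  one := Set.univ
  add := fun X Y => X ∪ Y
  neg := fun X => Xᶜ
  cyl := fun i X => {s | ∃ t ∈ X, ∀ k, k ≠ i → s k = t k}
  subst := fun i j X => {s | Function.update s i (s j) ∈ X}
  perm := fun i j X => (fun s => s ∘ Equiv.swap i j) '' X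
  diag := fun i j => {s | s i = s j}

/-- The direct product of a family of algebras. -/
def piAlg {d : ℕ} {ι : Type u} {B : ι → Type v} (D : ∀ a, PAlg d (B a)) : PAlg d (∀ a, B a) where
  zero := fun a => (D a).zero
  one := fun a => (D a).one
  add := fun x y a => (D a).add (x a) (y a)
  neg := fun x a => (D a).neg (x a)
  cyl := fun i x a => (D a).cyl i (x a)
  subst := fun i j x a => (D a).subst i j (x a)
  perm := fun i j x a => (D a).perm i j (x a)
  diag := fun i j a => (D a).diag i j

/-- `C` is representable: it is isomorphic to a subdirect product of set algebras (subalgebras of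
full set algebras), i.e. it embeds into a direct product of full set algebras; the set algebras in
question are the images of the coordinate maps. -/
def PAlg.Representable {d : ℕ} {A : Type u} (C : PAlg d A) : Prop :=
  ∃ (ι : Type u) (U : ι → Type u) (h : A → ∀ a : ι, Set (Fin d → U a)),
    Function.Injective h ∧ IsHom C (piAlg fun a => fullSetAlg d (U a)) h

/-- The equivalence relation `r` is a congruence of `C`. -/
structure PAlg.IsCongruence {d : ℕ} {A : Type u} (C : PAlg d A) (r : Setoid A) : Prop where
  add : ∀ x x' y y', r x x' → r y y' → r (C.add x y) (C.add x' y')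
  neg : ∀ x x', r x x' → r (C.neg x) (C.neg x')
  cyl : ∀ i x x', r x x' → r (C.cyl i x) (C.cyl i x')
  subst : ∀ i j x x', r x x' → r (C.subst i j x) (C.subst i j x')
  perm : ∀ i j x x', r x x' → r (C.perm i j x) (C.perm i j x')

/-- `C` is simple: it has exactly two congruences. -/
def PAlg.IsSimple {d : ℕ} {A : Type u} (C : PAlg d A) : Prop :=
  Nontrivial A ∧ ∀ r : Setoid A, C.IsCongruence r → r = ⊥ ∨ r = ⊤

/-! ### Networks and the games -/

/-- A prenetwork: a finite set of nodes `0, …, size - 1` and a label for every `d`-tuple of nodes.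
A prenetwork over the term algebra is a term network. -/
structure PreNet (d : ℕ) (A : Type u) where
  size : ℕ
  label : (Fin d → Fin size) → A

/-- `x ≡_i y`: the tuples `x` and `y` agree off `i`. -/
abbrev AgreeOff {d k : ℕ} (i : Fin d) (x y : Fin d → Fin k) : Prop := ∀ l, l ≠ i → x l = y l

/-- `x ≡_{ij} y`: `x = y ∘ [i, j]`. -/
abbrev AgreeSwap {d k : ℕ} (i j : Fin d) (x y : Fin d → Fin k) : Prop := x = y ∘ Equiv.swap i j

/-- `∀`'s move at a prenetwork with `k` nodes, apart from the algebra element that he picks: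
a cylindrifier move with `i < d`, a cylindrifier move with `i = d` (called `choice`), or a
polyadic move. -/
inductive Shape (d k : ℕ) : Type
  | cyl (i : Fin d) (x : Fin d → Fin k) : Shape d k
  | choice (x : Fin d → Fin k) : Shape d k
  | poly (i j : Fin d) (x : Fin d → Fin k) : Shape d k

namespace PAlg

variable {d : ℕ} {A : Type u}

/-- The product of all `d_{jl}` with `j, l < d` and `y_j = y_l`. -/
def diagProd (C : PAlg d A) {k : ℕ} (y : Fin d → Fin k) : A :=
  C.listProd (((List.finRange d ×ˢ List.finRange d).filter fun p => y p.1 = y p.2).map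
    fun p => C.diag p.1 p.2)

/-- The prenetwork `N` is a network over `C`. -/
structure IsNetwork (C : PAlg d A) (N : PreNet d A) : Prop where
  diag : ∀ (i j : Fin d) (x : Fin d → Fin N.size), x i = x j → C.le (N.label x) (C.diag i j)
  cyl : ∀ (i : Fin d) (x y : Fin d → Fin N.size), AgreeOff i x y →
    C.mul (N.label x) (C.cyl i (N.label y)) ≠ C.zero
  perm : ∀ (i j : Fin d) (x y : Fin d → Fin N.size), AgreeSwap i j x y →
    C.mul (N.label x) (C.perm i j (N.label y)) ≠ C.zero
  cong : ∀ (i j k : Fin d) (x y z : Fin d → Fin N.size), AgreeOff i x y → x i = z j → y i = z k →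
    C.le (N.label z) (C.diag j k) → C.mul (N.label x) (N.label y) ≠ C.zero

/-- The result of `∃` accepting the move `m` with algebra element `a`. For a cylindrifier move with
`i < d` the new node is the last node of the new network. -/
def accept (C : PAlg d A) (N : PreNet d A) (m : Shape d N.size) (a : A) : PreNet d A :=
  match m with
  | .cyl i x =>
    let z : Fin d → Fin (N.size + 1) :=
      Function.update (fun l => (x l).castSucc) i (Fin.last N.size)
    ⟨N.size + 1, fun y =>
      if y = z then C.mul a (C.diagProd z)
      else if h : ∀ l, y l ≠ Fin.last N.size then
        let y' : Fin d → Fin N.size := fun l => (y l).castPred (h l)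
        if y' = x then C.mul (N.label x) (C.cyl i a) else N.label y'
      else C.diagProd y⟩
  | .choice x => ⟨N.size, Function.update N.label x (C.mul (N.label x) a)⟩
  | .poly i j x =>
    let x' : Fin d → Fin N.size := x ∘ Equiv.swap i j
    let L := Function.update N.label x (C.mul (N.label x) (C.perm i j a))
    ⟨N.size, Function.update L x' (C.mul (L x') a)⟩

/-- The result of `∃` rejecting the move `m` with algebra element `a`. -/
def reject (C : PAlg d A) (N : PreNet d A) (m : Shape d N.size) (a : A) : PreNet d A :=
  match m with
  | .cyl i x => ⟨N.size, Function.update N.label x (C.mul (N.label x) (C.neg (C.cyl i a)))⟩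
  | .choice x => ⟨N.size, Function.update N.label x (C.mul (N.label x) (C.neg a))⟩
  | .poly i j x => ⟨N.size, Function.update N.label x (C.mul (N.label x) (C.neg (C.perm i j a)))⟩

/-- The initial prenetwork `I_a`, with nodes `0, …, d - 1`. -/
def init (C : PAlg d A) (a : A) : PreNet d A :=
  ⟨d, fun x => if x = id then a else C.diagProd x⟩

/-- A play of the game of length `n` on `C` from `N₀`: in round `t`, `∀` makes the move
`(shape t, elt t)` at the current prenetwork `net t`, and `∃` accepts it (`answer t = true`) or
rejects it. -/
structure Play (C : PAlg d A) (n : ℕ) (N₀ : PreNet d A) where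
  net : Fin (n + 1) → PreNet d A
  shape : (t : Fin n) → Shape d (net t.castSucc).size
  elt : Fin n → A
  answer : Fin n → Bool
  start : net 0 = N₀
  step : ∀ t : Fin n, net t.succ =
    if answer t = true then C.accept (net t.castSucc) (shape t) (elt t)
    else C.reject (net t.castSucc) (shape t) (elt t)

/-- A position together with a move of `∀` at that position. -/
abbrev Situation (d : ℕ) (A : Type u) : Type u := (N : PreNet d A) × Shape d N.size × A

/-- A strategy for `∃`: her answer, given all the positions and moves of `∀` up to and including
the present ones. -/
abbrev Strategy (d : ℕ) (A : Type u) : Type u := List (Situation d A) → Bool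

/-- In the play `P`, `∃` uses the strategy `σ`. -/
def Play.Follows {C : PAlg d A} {n : ℕ} {N₀ : PreNet d A} (P : C.Play n N₀) (σ : Strategy d A) :
    Prop :=
  ∀ t : Fin n, P.answer t = σ
    ((List.ofFn fun s : Fin n => (⟨P.net s.castSucc, P.shape s, P.elt s⟩ : Situation d A)).take
      (t + 1))

/-- `∃` has a winning strategy in the game of length `n` on `C` from `N₀`: in every play in which
she uses it, all the prenetworks played are networks. -/
def ExistsWins (C : PAlg d A) (n : ℕ) (N₀ : PreNet d A) : Prop :=
  ∃ σ : Strategy d A, ∀ P : C.Play n N₀, P.Follows σ → ∀ t, C.IsNetwork (P.net t)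

end PAlg

/-! ### The universal sentences and the equations -/

/-- First-order formulas of the similarity type, with named variables. -/
inductive Fml (d : ℕ) : Type
  | eq : Term d → Term d → Fml d
  | not : Fml d → Fml d
  | and : Fml d → Fml d → Fml d
  | or : Fml d → Fml d → Fml d
  | imp : Fml d → Fml d → Fml d
  | all : ℕ → Fml d → Fml d

namespace Fml

variable {d : ℕ} {A : Type u}

/-- Truth of a formula in `C` under the assignment `v`. -/
def Realize (C : PAlg d A) : Fml d → (ℕ → A) → Prop
  | eq s t, v => s.eval C v = t.eval C v
  | not φ, v => ¬ φ.Realize C v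
  | and φ ψ, v => φ.Realize C v ∧ ψ.Realize C v
  | or φ ψ, v => φ.Realize C v ∨ ψ.Realize C v
  | imp φ ψ, v => φ.Realize C v → ψ.Realize C v
  | all n φ, v => ∀ a : A, φ.Realize C (Function.update v n a)

/-- A true formula. -/
def tru : Fml d := eq 1 1

/-- `s ≤ t`. -/
def le (s t : Term d) : Fml d := eq (s + t) t

/-- `t ≠ 0`. -/
def ne0 (t : Term d) : Fml d := not (eq t 0)

/-- The conjunction of the formulas `f a`, for `a` in the list `l`. -/
def conj {α : Type} (l : List α) (f : α → Fml d) : Fml d := (l.map f).foldr and tru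

/-- The conversion of a universal formula into a term by means of the discriminator term
`c_0 … c_{d-1} x`. It deletes the universal quantifiers, and replaces `s = t` by
`-c_0 … c_{d-1}(s · -t + -s · t)` and the connectives by the Boolean operations. It is meant for
formulas with all quantifiers in positive position and bound variables renamed apart. -/
def toTerm : Fml d → Term d
  | eq s t => -(Term.alg d).cylAll (s * -t + -s * t)
  | not φ => -φ.toTerm
  | and φ ψ => φ.toTerm * ψ.toTerm
  | or φ ψ => φ.toTerm + ψ.toTerm
  | imp φ ψ => -φ.toTerm + ψ.toTerm
  | all _ φ => φ.toTerm

end Fml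

/-- All `d`-tuples of nodes of a network with `k` nodes, in a fixed order. -/
def tuples (d k : ℕ) : List (Fin d → Fin k) :=
  (List.finRange (k ^ d)).map finFunctionFinEquiv.symm

/-- All shapes of moves at a network with `k` nodes, in a fixed order. -/
def shapes (d k : ℕ) : List (Shape d k) :=
  (tuples d k).flatMap fun x =>
    (List.finRange d).map (fun i => Shape.cyl i x) ++ [Shape.choice x] ++
      (List.finRange d).flatMap fun i => (List.finRange d).map fun j => Shape.poly i j x

open Fml in
/-- The formula `CNet^d(N)` saying that the term network `N` denotes a network. -/
def cnet {d : ℕ} (N : PreNet d (Term d)) : Fml d :=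
  let T := tuples d N.size
  let D := List.finRange d
  .and (conj T fun x => conj D fun i => conj D fun j =>
      if x i = x j then le (N.label x) (.diag i j) else tru) <|
  .and (conj T fun x => conj T fun y => conj D fun i =>
      if AgreeOff i x y then ne0 (N.label x * .cyl i (N.label y)) else tru) <|
  .and (conj T fun x => conj T fun y => conj D fun i => conj D fun j =>
      if AgreeSwap i j x y then ne0 (N.label x * .perm i j (N.label y)) else tru) <|
  conj T fun x => conj T fun y => conj T fun z => conj D fun i => conj D fun j => conj D fun k =>
      if AgreeOff i x y ∧ x i = z j ∧ y i = z k then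
        .imp (le (N.label z) (.diag j k)) (ne0 (N.label x * N.label y)) else tru

/-- The formula `ψ_n^d(N)`. Its bound variables are `var k, …, var (k + 2 ^ n - 2)`, so that the
two disjuncts below have no bound variable in common. -/
def psi {d : ℕ} : ℕ → ℕ → PreNet d (Term d) → Fml d
  | 0, _, N => cnet N
  | n + 1, k, N => .all k <| Fml.conj (shapes d N.size) fun m =>
      .or (psi n (k + 1) ((Term.alg d).accept N m (.var k)))
        (psi n (k + 2 ^ n) ((Term.alg d).reject N m (.var k)))

/-- The universal sentence `φ_n^d`, i.e. `∀ x (x ≠ 0 → ψ_n^d(J_x))`. -/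
def phi (d n : ℕ) : Fml d :=
  .all 0 (.imp (Fml.ne0 (.var 0)) (psi n 1 ((Term.alg d).init (.var 0))))

/-- `C ⊨ φ` for a sentence `φ`. -/
def PAlg.Models {d : ℕ} {A : Type u} (C : PAlg d A) (φ : Fml d) : Prop :=
  ∀ v : ℕ → A, φ.Realize C v

/-- The equation `ε_n^d`, obtained from `φ_n^d` by means of the discriminator term. -/
def eps (d n : ℕ) : Equation d := ⟨(phi d n).toTerm, 1⟩

end Polyadic

/-!
The theorem rests on a Henkin construction. In a set algebra with base `U`, a map of the nodes of a
network into `U` which agrees with the labels tells `∃` how to answer: she accepts a move exactly if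
the image of the tuple lies in the set in question (`IsHom.wins`). So `∃` wins all games on a
representable algebra, as every non-zero element is a non-empty set in some coordinate.

For the converse, suppose that `∃` wins all games of finite length from `I_a`. Take a universe that
is freely generated from `d` base points by witnesses for all cylindrifications. If `∀` asks about
finitely many tuples and elements, then the network at the end of the play decides all of them, and
a limit along an ultrafilter labels every tuple of the universe by an ultrafilter of the algebra
(`exists_isUltraNetwork`). The conditions on networks survive in the limit, the diagonals define an
equivalence relation on the universe, and sending `b` to the set of tuples whose label contains
`b` is a homomorphism into the full set algebra of the quotient that does not annihilate `a`.
Compactness is applied to finite sets of questions only, so no assumption on the cardinality of the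
algebra is needed.

The sentence `φ_n^d` expresses that `∃` wins the games of length `n` (`realize_psi`). Intermediate
positions need not be inspected: labels only shrink in the course of a play, so a prenetwork in
which the diagonal condition holds is a network if a later one is (`isNetwork_of_refinement`).
As the two disjuncts of each disjunction have no bound variable in common, the quantifiers of
`φ_n^d` can be moved to the front (`matrix_phi_iff`). Where `c_0 ⋯ c_{d-1}` maps every non-zero
element to `1`, the equation `ε_n^d` therefore says the same as `φ_n^d` (`sat_eps_iff`). This is
so in simple algebras and in full set algebras, and every polyadic equality algebra has enough
quotients of this kind, namely those by the closed elements of ultrafilters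
(`PAlg.Laws.exists_discriminator_quotient`). Since equations pass to quotients, subalgebras and
products, the equations `ε_n^d` axiomatize representability.

As to computability, a homomorphism from the terms turns `psi` into a recursion over the operations
of an arbitrary algebra (`IsHom.map_toTerm_psi`). For the algebra of Gödel numbers, the positions
of the game form a tree of finite depth whose branching is primitive recursive, so that this
recursion is primitive recursive (`primrec_psiCode`). The Gödel number of `ε_n^d` is at least `n`,
and the equations of polyadic equality algebras are finite in number, whence the sets of equations
are recursive.
-/

namespace Polyadic

/-! ### Boolean reasoning in polyadic equality algebras -/

namespace PAlg

variable {d : ℕ} {A : Type u}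

/-- The laws of polyadic equality algebras that representability rests on, for an algebra whose
Boolean operations are those of a Boolean algebra in the sense of Mathlib. -/
structure Laws [BooleanAlgebra A] (C : PAlg d A) : Prop where
  zero_eq : C.zero = ⊥
  one_eq : C.one = ⊤
  add_eq : ∀ x y, C.add x y = x ⊔ y
  neg_eq : ∀ x, C.neg x = xᶜ
  subst_self : ∀ i x, C.subst i i x = x
  le_cyl : ∀ i x, x ≤ C.cyl i x
  cyl_sup : ∀ i x y, C.cyl i (x ⊔ y) = C.cyl i x ⊔ C.cyl i y
  subst_cyl : ∀ i j x, C.subst i j (C.cyl i x) = C.cyl i x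
  cyl_subst : ∀ i j, i ≠ j → ∀ x, C.cyl i (C.subst i j x) = C.subst i j x
  subst_cyl_comm : ∀ i j k, k ≠ i → k ≠ j → ∀ x,
    C.subst i j (C.cyl k x) = C.cyl k (C.subst i j x)
  subst_sup : ∀ i j x y, C.subst i j (x ⊔ y) = C.subst i j x ⊔ C.subst i j y
  subst_compl : ∀ i j x, C.subst i j xᶜ = (C.subst i j x)ᶜ
  perm_sup : ∀ i j x y, C.perm i j (x ⊔ y) = C.perm i j x ⊔ C.perm i j y
  perm_compl : ∀ i j x, C.perm i j xᶜ = (C.perm i j x)ᶜ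
  perm_subst : ∀ i j x, C.perm i j (C.subst j i x) = C.subst i j x
  subst_diag : ∀ i j, C.subst i j (C.diag i j) = ⊤
  inf_diag_le : ∀ i j x, x ⊓ C.diag i j ≤ C.subst i j x

/-- The Boolean equations turn the universe of a polyadic equality algebra into a Boolean
algebra. -/
theorem IsPEA.exists_laws {C : PAlg d A} (h : C.IsPEA) : ∃ _ : BooleanAlgebra A, C.Laws := by
  have add_comm : ∀ x y, C.add x y = C.add y x := fun x y =>
    h _ .add_comm (fun n => match n with | 0 => x | _ => y)
  have add_assoc : ∀ x y z, C.add (C.add x y) z = C.add x (C.add y z) := fun x y z =>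
    h _ .add_assoc (fun n => match n with | 0 => x | 1 => y | _ => z)
  have neg_neg : ∀ x, C.neg (C.neg x) = x := fun x => h _ .neg_neg (fun _ => x)
  have absorb : ∀ x y, C.add x (C.mul x y) = x := fun x y =>
    h _ .absorb (fun n => match n with | 0 => x | _ => y)
  have distrib : ∀ x y z, C.mul x (C.add y z) = C.add (C.mul x y) (C.mul x z) := fun x y z =>
    h _ .distrib (fun n => match n with | 0 => x | 1 => y | _ => z)
  have add_compl : ∀ x, C.add x (C.neg x) = C.one := fun x => h _ .add_compl (fun _ => x)
  have mul_compl : ∀ x, C.mul x (C.neg x) = C.zero := fun x => h _ .mul_compl (fun _ => x)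
  have mul_comm : ∀ x y, C.mul x y = C.mul y x := fun x y => by
    simp only [mul, add_comm]
  have mul_assoc : ∀ x y z, C.mul (C.mul x y) z = C.mul x (C.mul y z) := fun x y z => by
    simp only [mul, neg_neg, add_assoc]
  have absorb' : ∀ x y, C.mul x (C.add x y) = x := fun x y => by
    have := congrArg C.neg (absorb (C.neg x) (C.neg y))
    simpa only [mul, neg_neg] using this
  let L : Lattice A :=
    @Lattice.mk' A ⟨C.add⟩ ⟨C.mul⟩ add_comm add_assoc mul_comm mul_assoc absorb absorb'
  let D : DistribLattice A := DistribLattice.ofInfSupLe fun x y z => (distrib x y z).le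
  let B : BooleanAlgebra A :=
    { D with
      compl := C.neg
      top := C.one
      bot := C.zero
      inf_compl_le_bot := fun x => (mul_compl x).le
      top_le_sup_compl := fun x => (add_compl x).ge
      le_top := fun x => by
        show C.add x C.one = C.one
        rw [← add_compl x, ← add_assoc]
        congr 1
        exact @sup_idem A L.toSemilatticeSup x
      bot_le := fun x => by
        show C.add C.zero x = x
        rw [← mul_compl x, add_comm, absorb] }
  refine ⟨B, rfl, rfl, fun _ _ => rfl, fun _ => rfl, ?_, ?_, ?_, ?_, ?_, ?_, ?_, ?_, ?_, ?_, ?_,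
    ?_, ?_⟩
  · exact fun i x => h _ (.subst_self i) (fun _ => x)
  · exact fun i x => h _ (.le_cyl i) (fun _ => x)
  · exact fun i x y => h _ (.cyl_add i) (fun n => match n with | 0 => x | _ => y)
  · exact fun i j x => h _ (.subst_cyl i j) (fun _ => x)
  · exact fun i j hij x => h _ (.cyl_subst i j hij) (fun _ => x)
  · exact fun i j k hi hj x => h _ (.subst_cyl_comm i j k hi hj) (fun _ => x)
  · exact fun i j x y => h _ (.subst_add i j) (fun n => match n with | 0 => x | _ => y)
  · exact fun i j x => h _ (.subst_neg i j) (fun _ => x)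
  · exact fun i j x y => h _ (.perm_add i j) (fun n => match n with | 0 => x | _ => y)
  · exact fun i j x => h _ (.perm_neg i j) (fun _ => x)
  · exact fun i j x => h _ (.perm_subst i j) (fun _ => x)
  · exact fun i j => h _ (.subst_diag i j) (fun _ => C.zero)
  · exact fun i j x => h _ (.diag_le i j) (fun _ => x)

namespace Laws

variable [BooleanAlgebra A] {C : PAlg d A}

theorem mul_eq (h : C.Laws) (x y : A) : C.mul x y = x ⊓ y := by
  simp [mul, h.neg_eq, h.add_eq]

theorem le_iff (h : C.Laws) {x y : A} : C.le x y ↔ x ≤ y := by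
  simp [le, h.add_eq]

theorem subst_inf (h : C.Laws) (i j : Fin d) (x y : A) :
    C.subst i j (x ⊓ y) = C.subst i j x ⊓ C.subst i j y := by
  have := h.subst_compl i j (xᶜ ⊔ yᶜ)
  simpa [h.subst_sup, h.subst_compl] using this

theorem perm_inf (h : C.Laws) (i j : Fin d) (x y : A) :
    C.perm i j (x ⊓ y) = C.perm i j x ⊓ C.perm i j y := by
  have := h.perm_compl i j (xᶜ ⊔ yᶜ)
  simpa [h.perm_sup, h.perm_compl] using this

theorem subst_bot (h : C.Laws) (i j : Fin d) : C.subst i j ⊥ = ⊥ := by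
  have := h.subst_inf i j ⊥ ⊥ᶜ
  rwa [h.subst_compl, inf_compl_self, inf_compl_self] at this

theorem perm_mono (h : C.Laws) (i j : Fin d) {x y : A} (hxy : x ≤ y) :
    C.perm i j x ≤ C.perm i j y := by
  rw [← sup_eq_right, ← h.perm_sup, sup_eq_right.2 hxy]

theorem cyl_mono (h : C.Laws) (i : Fin d) {x y : A} (hxy : x ≤ y) : C.cyl i x ≤ C.cyl i y := by
  rw [← sup_eq_right, ← h.cyl_sup, sup_eq_right.2 hxy]

theorem diag_self (h : C.Laws) (i : Fin d) : C.diag i i = ⊤ := by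
  rw [← h.subst_self i (C.diag i i), h.subst_diag]

/-- The elements below both `a` and the diagonal `d_{ij}` are below `s^i_j a`, even after
cylindrification. -/
theorem cyl_le_subst (h : C.Laws) {i j : Fin d} (hij : i ≠ j) {x a : A} (hd : x ≤ C.diag i j)
    (ha : x ≤ a) : C.cyl i x ≤ C.subst i j a := by
  rw [← h.cyl_subst i j hij]
  exact h.cyl_mono i ((le_inf ha hd).trans (h.inf_diag_le i j a))

theorem cyl_eq_iff (h : C.Laws) {i j : Fin d} (hij : i ≠ j) (x : A) :
    C.cyl i x = x ↔ C.subst i j x = x := by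
  constructor
  · intro hx
    rw [← hx, h.subst_cyl]
  · intro hx
    rw [← hx, h.cyl_subst i j hij]

variable (hd : 3 ≤ d)
include hd

omit [BooleanAlgebra A] in
theorem _root_.Polyadic.exists_ne_ne (i j : Fin d) : ∃ k : Fin d, k ≠ i ∧ k ≠ j := by
  have : ({i, j} : Finset (Fin d)) ≠ Finset.univ := fun hu => by
    have h1 := Finset.card_le_two (a := i) (b := j)
    rw [hu, Finset.card_univ, Fintype.card_fin] at h1
    omega
  obtain ⟨k, hk⟩ := not_forall.1 (fun hh => this (Finset.eq_univ_iff_forall.2 hh))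
  exact ⟨k, by simpa using hk⟩

theorem cyl_compl_of_cyl_eq (h : C.Laws) {i : Fin d} {x : A} (hx : C.cyl i x = x) :
    C.cyl i xᶜ = xᶜ := by
  obtain ⟨j, hj, -⟩ := exists_ne_ne hd i i
  rw [h.cyl_eq_iff hj.symm] at hx ⊢
  rw [h.subst_compl, hx]

theorem cyl_cyl (h : C.Laws) (i : Fin d) (x : A) : C.cyl i (C.cyl i x) = C.cyl i x := by
  obtain ⟨j, hj, -⟩ := exists_ne_ne hd i i
  rw [h.cyl_eq_iff hj.symm, h.subst_cyl]

theorem cyl_bot (h : C.Laws) (i : Fin d) : C.cyl i ⊥ = ⊥ := by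
  obtain ⟨j, hj, -⟩ := exists_ne_ne hd i i
  rw [h.cyl_eq_iff hj.symm, h.subst_bot]

theorem cyl_inf_of_cyl_eq (h : C.Laws) {i : Fin d} (x : A) {b : A} (hb : C.cyl i b = b) :
    C.cyl i (x ⊓ b) = C.cyl i x ⊓ b := by
  apply le_antisymm
  · exact le_inf (h.cyl_mono i inf_le_left) ((h.cyl_mono i inf_le_right).trans hb.le)
  · rw [← le_himp_iff, himp_eq, ← h.cyl_compl_of_cyl_eq hd hb, ← h.cyl_sup]
    apply h.cyl_mono
    rw [sup_inf_right]
    simp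

theorem cyl_comm (h : C.Laws) (i j : Fin d) (x : A) :
    C.cyl i (C.cyl j x) = C.cyl j (C.cyl i x) := by
  have key : ∀ i j : Fin d, C.cyl i (C.cyl j x) ≤ C.cyl j (C.cyl i x) := by
    intro i j
    rcases eq_or_ne i j with rfl | hij
    · exact le_rfl
    obtain ⟨k, hki, hkj⟩ := exists_ne_ne hd i j
    -- `c_j c_i x` is a fixed point of `c_i`, as `s^i_k` commutes with `c_j`
    have h1 : C.cyl i (C.cyl j (C.cyl i x)) = C.cyl j (C.cyl i x) := by
      rw [h.cyl_eq_iff hki.symm, h.subst_cyl_comm i k j hij.symm hkj.symm, h.subst_cyl]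
    rw [← h1]
    exact h.cyl_mono i (h.cyl_mono j (h.le_cyl i x))
  exact le_antisymm (key i j) (key j i)

omit hd

/-- An element is closed (zero-dimensional) if every cylindrification fixes it. -/
def _root_.Polyadic.PAlg.Closed (C : PAlg d A) (b : A) : Prop := ∀ i, C.cyl i b = b

omit [BooleanAlgebra A] in
theorem cylAll_of_closed {b : A} (hb : C.Closed b) : C.cylAll b = b := by
  unfold cylAll
  induction List.finRange d with
  | nil => rfl
  | cons i l ih => rw [List.foldr_cons, ih, hb]

theorem le_cylAll (h : C.Laws) (x : A) : x ≤ C.cylAll x := by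
  unfold cylAll
  induction List.finRange d with
  | nil => exact le_rfl
  | cons i l ih => exact ih.trans (h.le_cyl i _)

/-- Substitutions and transpositions fix closed elements. -/
theorem subst_of_closed (h : C.Laws) {b : A} (hb : C.Closed b) (i j : Fin d) :
    C.subst i j b = b := by
  rw [← hb i, h.subst_cyl]

theorem perm_of_closed (h : C.Laws) {b : A} (hb : C.Closed b) (i j : Fin d) :
    C.perm i j b = b := by
  conv_lhs => rw [← h.subst_of_closed hb j i]
  rw [h.perm_subst, h.subst_of_closed hb]

include hd

theorem closed_cylAll (h : C.Laws) (x : A) : C.Closed (C.cylAll x) := by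
  intro i
  have key : ∀ l : List (Fin d), i ∈ l → C.cyl i (l.foldr C.cyl x) = l.foldr C.cyl x := by
    intro l hi
    induction l with
    | nil => simp at hi
    | cons j l ih =>
      rw [List.foldr_cons]
      rcases List.mem_cons.1 hi with rfl | hi
      · exact h.cyl_cyl hd i _
      · rw [h.cyl_comm hd, ih hi]
  exact key _ (List.mem_finRange i)

theorem closed_compl (h : C.Laws) {b : A} (hb : C.Closed b) : C.Closed bᶜ :=
  fun i => h.cyl_compl_of_cyl_eq hd (hb i)

theorem closed_bot (h : C.Laws) : C.Closed ⊥ := h.cyl_bot hd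

theorem closed_inf (h : C.Laws) {a b : A} (ha : C.Closed a) (hb : C.Closed b) :
    C.Closed (a ⊓ b) := fun i => by
  rw [h.cyl_inf_of_cyl_eq hd _ (hb i), ha]

end Laws

end PAlg

/-! ### The games and the universal sentences -/

/-- Every label of `N` is below the diagonals that the repetitions in its tuple require. -/
def PreNet.Diagonal {d : ℕ} {A : Type u} (C : PAlg d A) (N : PreNet d A) : Prop :=
  ∀ (i j : Fin d) (x : Fin d → Fin N.size), x i = x j → C.le (N.label x) (C.diag i j)

/-- The image of a prenetwork under a map of the labels. -/
abbrev PreNet.map {d : ℕ} {A : Type u} {B : Type v} (f : A → B) (N : PreNet d A) : PreNet d B :=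
  ⟨N.size, fun x => f (N.label x)⟩

section Hom

variable {d : ℕ} {A : Type u} {B : Type v} {C : PAlg d A} {D : PAlg d B} {f : A → B}

theorem IsHom.map_mul (hf : IsHom C D f) (x y : A) : f (C.mul x y) = D.mul (f x) (f y) := by
  simp only [PAlg.mul, hf.map_neg, hf.map_add]

theorem IsHom.map_cylAll (hf : IsHom C D f) (x : A) : f (C.cylAll x) = D.cylAll (f x) := by
  unfold PAlg.cylAll
  induction List.finRange d with
  | nil => rfl
  | cons i l ih => rw [List.foldr_cons, List.foldr_cons, hf.map_cyl, ih]

theorem IsHom.map_diagProd (hf : IsHom C D f) {k : ℕ} (y : Fin d → Fin k) :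
    f (C.diagProd y) = D.diagProd y := by
  unfold PAlg.diagProd
  induction (List.finRange d ×ˢ List.finRange d).filter fun p => y p.1 = y p.2 with
  | nil => exact hf.map_one
  | cons p l ih =>
    refine (hf.map_mul _ _).trans ?_
    rw [hf.map_diag]
    exact congrArg (D.mul _) ih

/-- Homomorphisms commute with the moves of the game. -/
theorem IsHom.map_accept (hf : IsHom C D f) (N : PreNet d A) (m : Shape d N.size) (a : A) :
    (C.accept N m a).map f = D.accept (N.map f) m (f a) := by
  obtain ⟨s, L⟩ := N
  cases m with
  | cyl i x =>
    refine congrArg (PreNet.mk (s + 1)) (funext fun (y : Fin d → Fin (s + 1)) => ?_)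
    simp only [PAlg.accept]
    by_cases h1 : y = Function.update (fun l => (x l).castSucc) i (Fin.last s)
    · rw [if_pos h1, if_pos h1, hf.map_mul, hf.map_diagProd]
    rw [if_neg h1, if_neg h1]
    by_cases h2 : ∀ l, y l ≠ Fin.last s
    · rw [dif_pos h2, dif_pos h2]
      by_cases h3 : (fun l => (y l).castPred (h2 l)) = x
      · rw [if_pos h3, if_pos h3, hf.map_mul, hf.map_cyl]
      · rw [if_neg h3, if_neg h3]
    · rw [dif_neg h2, dif_neg h2, hf.map_diagProd]
  | choice x =>
    refine congrArg (PreNet.mk s) (funext fun (y : Fin d → Fin s) => ?_)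
    refine (Function.apply_update (fun _ => f) L x _ y).trans ?_
    rw [hf.map_mul]
  | poly i j x =>
    refine congrArg (PreNet.mk s) (funext fun (y : Fin d → Fin s) => ?_)
    simp only [PAlg.accept]
    have h1 : ∀ y, f (Function.update L x (C.mul (L x) (C.perm i j a)) y) =
        Function.update (fun x => f (L x)) x (D.mul (f (L x)) (D.perm i j (f a))) y := by
      intro y
      refine (Function.apply_update (fun _ => f) L x _ y).trans ?_
      rw [hf.map_mul, hf.map_perm]
    refine (Function.apply_update (fun _ => f) _ _ _ y).trans ?_
    have h2 := h1 (x ∘ Equiv.swap i j)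
    rw [hf.map_mul, funext h1]
    exact congrFun (congrArg (Function.update (Function.update (fun x => f (L x)) x
      (D.mul (f (L x)) (D.perm i j (f a)))) (x ∘ Equiv.swap i j))
      (congrArg (fun b => D.mul b (f a)) h2)) y

theorem IsHom.map_reject (hf : IsHom C D f) (N : PreNet d A) (m : Shape d N.size) (a : A) :
    (C.reject N m a).map f = D.reject (N.map f) m (f a) := by
  obtain ⟨s, L⟩ := N
  cases m <;>
  · refine congrArg (PreNet.mk s) (funext fun (y : Fin d → Fin s) => ?_)
    refine (Function.apply_update (fun _ => f) L _ _ y).trans ?_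
    simp only [hf.map_mul, hf.map_neg, hf.map_cyl, hf.map_perm]

theorem IsHom.map_init (hf : IsHom C D f) (a : A) : (C.init a).map f = D.init (f a) := by
  refine congrArg (PreNet.mk d) (funext fun (y : Fin d → Fin d) => ?_)
  simp only [PAlg.init]
  split_ifs
  · rfl
  · exact hf.map_diagProd y

end Hom

namespace PAlg

variable {d : ℕ} {A : Type u}

/-- `∃` can answer `n` more moves so that the last prenetwork is a network. This is what the
formula `ψ_n^d` says; the earlier prenetworks are not inspected. -/
def Wins (C : PAlg d A) : ℕ → PreNet d A → Prop
  | 0, N => C.IsNetwork N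
  | n + 1, N => ∀ (m : Shape d N.size) (a : A),
      C.Wins n (C.accept N m a) ∨ C.Wins n (C.reject N m a)

theorem accept_cyl_label (C : PAlg d A) (N : PreNet d A) (i : Fin d) (x : Fin d → Fin N.size)
    (a : A) (y : Fin d → Fin N.size) :
    (C.accept N (.cyl i x) a).label (fun l => (y l).castSucc) =
      if y = x then C.mul (N.label x) (C.cyl i a) else N.label y := by
  have h1 : ¬ (fun l => (y l).castSucc) =
      Function.update (fun l => (x l).castSucc) i (Fin.last N.size) := by
    intro h
    have := congrFun h i
    simp only [Function.update_self] at this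
    exact (y i).castSucc_ne_last this
  have h2 : ∀ l, (y l).castSucc ≠ Fin.last N.size := fun l => (y l).castSucc_ne_last
  simp only [accept]
  rw [if_neg h1, dif_pos h2]
  rfl

theorem accept_cyl_label_new (C : PAlg d A) (N : PreNet d A) (i : Fin d)
    (x : Fin d → Fin N.size) (a : A) :
    (C.accept N (.cyl i x) a).label
      (Function.update (fun l => (x l).castSucc) i (Fin.last N.size)) =
      C.mul a (C.diagProd (Function.update (fun l => (x l).castSucc) i (Fin.last N.size))) := by
  simp only [accept, if_true]

/-- The inclusion of the nodes of a prenetwork into those of the prenetwork resulting from an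
accepted move. -/
def acceptEmb {A : Type u} (C : PAlg d A) (N : PreNet d A) (m : Shape d N.size) (a : A) :
    Fin N.size → Fin (C.accept N m a).size :=
  match m with
  | .cyl _ _ => Fin.castSucc
  | .choice _ => id
  | .poly _ _ _ => id

/-- The nodes do not change when a move is rejected. -/
def rejectEmb {A : Type u} (C : PAlg d A) (N : PreNet d A) (m : Shape d N.size) (a : A) :
    Fin N.size → Fin (C.reject N m a).size :=
  match m with
  | .cyl _ _ => id
  | .choice _ => id
  | .poly _ _ _ => id

namespace Laws

variable [BooleanAlgebra A] {C : PAlg d A}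

theorem le_diagProd_iff (h : C.Laws) {k : ℕ} {y : Fin d → Fin k} {b : A} :
    b ≤ C.diagProd y ↔ ∀ i j, y i = y j → b ≤ C.diag i j := by
  have key : ∀ l : List (Fin d × Fin d), b ≤ C.listProd (
      (l.filter fun p => y p.1 = y p.2).map fun p => C.diag p.1 p.2) ↔
      ∀ p ∈ l, y p.1 = y p.2 → b ≤ C.diag p.1 p.2 := by
    intro l
    induction l with
    | nil => simp [listProd, h.one_eq]
    | cons p l ih =>
      by_cases hp : y p.1 = y p.2
      · rw [List.filter_cons_of_pos (by simpa using hp), List.map_cons, listProd,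
          List.foldr_cons, h.mul_eq, le_inf_iff, ← listProd, ih]
        simp [hp]
      · rw [List.filter_cons_of_neg (by simpa using hp), ih]
        simp [hp]
  exact (key _).trans ⟨fun hb i j => hb (i, j) (by simp), fun hb p _ => hb p.1 p.2⟩

theorem diagProd_le (h : C.Laws) {k : ℕ} {y : Fin d → Fin k} {i j : Fin d} (hy : y i = y j) :
    C.diagProd y ≤ C.diag i j := h.le_diagProd_iff.1 le_rfl i j hy

theorem accept_label_le (h : C.Laws) (N : PreNet d A) (m : Shape d N.size) (a : A)
    (y : Fin d → Fin N.size) :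
    (C.accept N m a).label (C.acceptEmb N m a ∘ y) ≤ N.label y := by
  cases m with
  | cyl i x =>
    have h1 := C.accept_cyl_label N i x a y
    refine h1.trans_le (?_ : ite _ _ _ ≤ N.label y)
    split_ifs with hy
    · rw [hy, h.mul_eq]
      exact inf_le_left
    · exact le_rfl
  | choice x =>
    show Function.update N.label x _ y ≤ N.label y
    rcases eq_or_ne y x with rfl | hy
    · simp [h.mul_eq]
    · simp [hy]
  | poly i j x =>
    have h1 : ∀ z, Function.update N.label x (C.mul (N.label x) (C.perm i j a)) z ≤ N.label z := by
      intro z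
      rcases eq_or_ne z x with rfl | hz
      · simp [h.mul_eq]
      · simp [hz]
    show Function.update (Function.update N.label x _) (x ∘ Equiv.swap i j) _ y ≤ N.label y
    rcases eq_or_ne y (x ∘ Equiv.swap i j) with rfl | hy
    · rw [Function.update_self, h.mul_eq]
      exact inf_le_left.trans (h1 _)
    · rw [Function.update_of_ne hy]
      exact h1 y

theorem reject_label_le (h : C.Laws) (N : PreNet d A) (m : Shape d N.size) (a : A)
    (y : Fin d → Fin N.size) :
    (C.reject N m a).label (C.rejectEmb N m a ∘ y) ≤ N.label y := by
  have h1 : ∀ (x : Fin d → Fin N.size) (b : A) (z : Fin d → Fin N.size),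
      Function.update N.label x (C.mul (N.label x) b) z ≤ N.label z := by
    intro x b z
    rcases eq_or_ne z x with rfl | hz
    · simp [h.mul_eq]
    · simp [hz]
  cases m with
  | cyl i x => exact h1 _ _ y
  | choice x => exact h1 _ _ y
  | poly i j x => exact h1 _ _ y

theorem diagonal_reject (h : C.Laws) {N : PreNet d A} (hN : N.Diagonal C) (m : Shape d N.size)
    (a : A) : (C.reject N m a).Diagonal C := by
  cases m <;>
  · intro i j y hy
    exact h.le_iff.2 ((h.reject_label_le N _ a y).trans (h.le_iff.1 (hN i j y hy)))

theorem diagonal_accept (h : C.Laws) {N : PreNet d A} (hN : N.Diagonal C) (m : Shape d N.size)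
    (a : A) : (C.accept N m a).Diagonal C := by
  cases m with
  | cyl i x =>
    intro k l y hy
    rw [h.le_iff]
    simp only [accept]
    split_ifs with h1 h2 h3
    · rw [h.mul_eq]
      exact inf_le_right.trans (h.diagProd_le (by rw [← h1]; exact hy))
    · rw [h.mul_eq, ← h3]
      refine inf_le_left.trans (h.le_iff.1 (hN k l _ ?_))
      simp [hy]
    · refine h.le_iff.1 (hN k l _ ?_)
      simp [hy]
    · exact h.diagProd_le hy
  | choice x =>
    intro i j y hy
    exact h.le_iff.2 ((h.accept_label_le N _ a y).trans (h.le_iff.1 (hN i j y hy)))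
  | poly k l x =>
    intro i j y hy
    exact h.le_iff.2 ((h.accept_label_le N _ a y).trans (h.le_iff.1 (hN i j y hy)))

theorem diagonal_init (h : C.Laws) (a : A) : (C.init a).Diagonal C := by
  intro i j x hx
  rw [h.le_iff]
  simp only [init]
  split_ifs with h1
  · have hij : i = j := by rwa [h1] at hx
    rw [hij, h.diag_self]
    exact le_top
  · exact h.diagProd_le hx

/-- Except for the requirements on diagonals, all the conditions on networks survive an enlargement
of the labels, so a prenetwork with a refinement that is a network is itself a network. -/
theorem isNetwork_of_refinement (h : C.Laws) {N N' : PreNet d A} (hN : N.Diagonal C)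
    (f : Fin N.size → Fin N'.size) (hf : ∀ x, N'.label (f ∘ x) ≤ N.label x)
    (h' : C.IsNetwork N') : C.IsNetwork N where
  diag := hN
  cyl i x y hxy h0 := by
    refine h'.cyl i (f ∘ x) (f ∘ y) (fun l hl => congrArg f (hxy l hl)) ?_
    rw [h.mul_eq, h.zero_eq, ← le_bot_iff] at h0 ⊢
    exact (inf_le_inf (hf x) (h.cyl_mono i (hf y))).trans h0
  perm i j x y hxy h0 := by
    refine h'.perm i j (f ∘ x) (f ∘ y) (congrArg (f ∘ ·) hxy) ?_
    rw [h.mul_eq, h.zero_eq, ← le_bot_iff] at h0 ⊢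
    exact (inf_le_inf (hf x) (h.perm_mono i j (hf y))).trans h0
  cong i j k x y z hxy hxz hyz hz h0 := by
    refine h'.cong i j k (f ∘ x) (f ∘ y) (f ∘ z) (fun l hl => congrArg f (hxy l hl))
      (congrArg f hxz) (congrArg f hyz) ?_ ?_
    · rw [h.le_iff] at hz ⊢
      exact (hf z).trans hz
    · rw [h.mul_eq, h.zero_eq, ← le_bot_iff] at h0 ⊢
      exact (inf_le_inf (hf x) (hf y)).trans h0

theorem isNetwork_of_wins (h : C.Laws) : ∀ {n : ℕ} {N : PreNet d A}, 0 < N.size →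
    N.Diagonal C → C.Wins n N → C.IsNetwork N
  | 0, _, _, _, hw => hw
  | n + 1, N, hs, hN, hw => by
    rcases hw (.choice fun _ => ⟨0, hs⟩) C.zero with hw | hw
    · exact h.isNetwork_of_refinement hN _ (h.accept_label_le N _ _)
        (h.isNetwork_of_wins (by exact hs) (h.diagonal_accept hN _ _) hw)
    · exact h.isNetwork_of_refinement hN _ (h.reject_label_le N _ _)
        (h.isNetwork_of_wins (by exact hs) (h.diagonal_reject hN _ _) hw)

end Laws

theorem size_accept_pos (C : PAlg d A) {N : PreNet d A} (hs : 0 < N.size) (m : Shape d N.size)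
    (a : A) : 0 < (C.accept N m a).size := by
  cases m
  · exact Nat.succ_pos _
  · exact hs
  · exact hs

theorem size_reject_pos (C : PAlg d A) {N : PreNet d A} (hs : 0 < N.size) (m : Shape d N.size)
    (a : A) : 0 < (C.reject N m a).size := by
  cases m <;> exact hs

/-- The play that starts with the move `(m, a)` at `N`, answered by `b`, and goes on with `P`. -/
def Play.cons {C : PAlg d A} {n : ℕ} (N : PreNet d A) (m : Shape d N.size) (a : A) (b : Bool)
    (P : C.Play n (if b = true then C.accept N m a else C.reject N m a)) : C.Play (n + 1) N where
  net := Fin.cons N P.net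
  shape := Fin.cons (α := fun t : Fin (n + 1) =>
    Shape d ((Fin.cons N P.net : Fin (n + 2) → PreNet d A) t.castSucc).size) m P.shape
  elt := Fin.cons a P.elt
  answer := Fin.cons b P.answer
  start := rfl
  step := Fin.cases P.start P.step

theorem wins_of_existsWins {C : PAlg d A} : ∀ {n : ℕ} {N : PreNet d A},
    C.ExistsWins n N → C.Wins n N
  | 0, N, ⟨σ, hσ⟩ =>
    hσ ⟨fun _ => N, Fin.elim0, Fin.elim0, Fin.elim0, rfl, fun t => t.elim0⟩ (fun t => t.elim0) 0
  | n + 1, N, ⟨σ, hσ⟩ => by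
    intro m a
    have key : C.Wins n (if σ [⟨N, m, a⟩] = true then C.accept N m a else C.reject N m a) := by
      apply wins_of_existsWins
      refine ⟨fun l => σ (⟨N, m, a⟩ :: l), fun P hP t => ?_⟩
      refine hσ (P.cons N m a (σ [⟨N, m, a⟩])) ?_ t.succ
      refine Fin.cases ?_ fun s => ?_
      · rw [List.ofFn_succ]
        rfl
      · rw [List.ofFn_succ]
        exact hP s
    split_ifs at key
    · exact Or.inl key
    · exact Or.inr key

open Classical in
/-- A strategy that depends only on the present position is enough: accept if and only if the
resulting position is still winning. -/
theorem Laws.existsWins_of_wins [BooleanAlgebra A] {C : PAlg d A} (h : C.Laws) {n : ℕ}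
    {N : PreNet d A} (hs : 0 < N.size) (hN : N.Diagonal C) (hw : C.Wins n N) :
    C.ExistsWins n N := by
  refine ⟨fun l => match l.getLast? with
    | none => false
    | some S => decide (C.Wins (n - l.length) (C.accept S.1 S.2.1 S.2.2)), fun P hP => ?_⟩
  have key : ∀ t : Fin (n + 1), 0 < (P.net t).size ∧ (P.net t).Diagonal C ∧
      C.Wins (n - t) (P.net t) := by
    intro t
    induction t using Fin.induction with
    | zero => rw [P.start]; exact ⟨hs, hN, hw⟩
    | succ t ih =>
      obtain ⟨ihs, ihN, ihw⟩ := ih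
      have hlen : n - ((t.castSucc : Fin (n + 1)) : ℕ) = n - (t.succ : Fin (n + 1)) + 1 := by
        simp only [Fin.val_castSucc, Fin.val_succ]
        omega
      rw [hlen] at ihw
      have ht := hP t
      have hl : ((List.ofFn fun s : Fin n =>
          (⟨P.net s.castSucc, P.shape s, P.elt s⟩ : Situation d A)).take (t + 1)).length =
          (t.succ : Fin (n + 1)) := by
        simp
      have hg : ((List.ofFn fun s : Fin n =>
          (⟨P.net s.castSucc, P.shape s, P.elt s⟩ : Situation d A)).take (t + 1)).getLast? =
          some ⟨P.net t.castSucc, P.shape t, P.elt t⟩ := by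
        rw [List.getLast?_eq_getElem?, hl]
        simp
      simp only [hg, hl] at ht
      rw [P.step t, ht]
      by_cases hacc : C.Wins (n - (t.succ : Fin (n + 1)))
          (C.accept (P.net t.castSucc) (P.shape t) (P.elt t))
      · rw [if_pos (by simpa using hacc)]
        exact ⟨C.size_accept_pos ihs _ _, h.diagonal_accept ihN _ _, hacc⟩
      · rw [if_neg (by simpa using hacc)]
        exact ⟨C.size_reject_pos ihs _ _, h.diagonal_reject ihN _ _,
          (ihw (P.shape t) (P.elt t)).resolve_left hacc⟩
  exact fun t => h.isNetwork_of_wins (key t).1 (key t).2.1 (key t).2.2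

theorem Laws.existsWins_init_iff [BooleanAlgebra A] {C : PAlg d A} (h : C.Laws) (hd : 0 < d)
    (n : ℕ) (a : A) : C.ExistsWins n (C.init a) ↔ C.Wins n (C.init a) :=
  ⟨wins_of_existsWins, h.existsWins_of_wins hd (h.diagonal_init a)⟩

end PAlg

theorem mem_tuples {d k : ℕ} (x : Fin d → Fin k) : x ∈ tuples d k :=
  List.mem_map.2 ⟨finFunctionFinEquiv x, List.mem_finRange _, by simp⟩

theorem mem_shapes {d k : ℕ} (m : Shape d k) : m ∈ shapes d k := by
  unfold shapes
  rw [List.mem_flatMap]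
  cases m with
  | cyl i x => exact ⟨x, mem_tuples x, by simp⟩
  | choice x => exact ⟨x, mem_tuples x, by simp⟩
  | poly i j x => exact ⟨x, mem_tuples x, by simp⟩

namespace Fml

variable {d : ℕ} {A : Type u}

/-- Truth of a formula after the deletion of its quantifiers. -/
def Matrix (C : PAlg d A) : Fml d → (ℕ → A) → Prop
  | eq s t, v => s.eval C v = t.eval C v
  | not φ, v => ¬ φ.Matrix C v
  | and φ ψ, v => φ.Matrix C v ∧ ψ.Matrix C v
  | or φ ψ, v => φ.Matrix C v ∨ ψ.Matrix C v
  | imp φ ψ, v => φ.Matrix C v → ψ.Matrix C v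
  | all _ φ, v => φ.Matrix C v

theorem realize_conj {α : Type} (C : PAlg d A) (l : List α) (f : α → Fml d) (v : ℕ → A) :
    (conj l f).Realize C v ↔ ∀ x ∈ l, (f x).Realize C v := by
  induction l with
  | nil => simp [conj, tru, Realize]
  | cons x l ih =>
    show _ ∧ (conj l f).Realize C v ↔ _
    rw [ih, List.forall_mem_cons]

theorem matrix_conj {α : Type} (C : PAlg d A) (l : List α) (f : α → Fml d) (v : ℕ → A) :
    (conj l f).Matrix C v ↔ ∀ x ∈ l, (f x).Matrix C v := by
  induction l with
  | nil => simp [conj, tru, Matrix]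
  | cons x l ih =>
    show _ ∧ (conj l f).Matrix C v ↔ _
    rw [ih, List.forall_mem_cons]

theorem realize_ite_tru {p : Prop} [Decidable p] (C : PAlg d A) (φ : Fml d) (v : ℕ → A) :
    (if p then φ else tru).Realize C v ↔ (p → φ.Realize C v) := by
  split_ifs with hp <;> simp [hp, tru, Realize]

theorem matrix_ite_tru {p : Prop} [Decidable p] (C : PAlg d A) (φ : Fml d) (v : ℕ → A) :
    (if p then φ else tru).Matrix C v ↔ (p → φ.Matrix C v) := by
  split_ifs with hp <;> simp [hp, tru, Matrix]

end Fml

section Semantics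

variable {d : ℕ} {A : Type u} (C : PAlg d A)

theorem realize_cnet (N : PreNet d (Term d)) (v : ℕ → A) :
    (cnet N).Realize C v ↔ C.IsNetwork (N.map (Term.eval C v)) := by
  simp only [cnet, Fml.Realize, Fml.realize_conj, Fml.realize_ite_tru, mem_tuples,
    List.mem_finRange, true_imp_iff]
  constructor
  · rintro ⟨h1, h2, h3, h4⟩
    exact ⟨fun i j x => h1 x i j, fun i x y => h2 x y i, fun i j x y => h3 x y i j,
      fun i j k x y z ha hb hc => h4 x y z i j k ⟨ha, hb, hc⟩⟩
  · rintro ⟨h1, h2, h3, h4⟩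
    exact ⟨fun x i j => h1 i j x, fun x y i => h2 i x y, fun x y i j => h3 i j x y,
      fun x y z i j k ⟨ha, hb, hc⟩ => h4 i j k x y z ha hb hc⟩

theorem matrix_cnet (N : PreNet d (Term d)) (v : ℕ → A) :
    (cnet N).Matrix C v ↔ C.IsNetwork (N.map (Term.eval C v)) := by
  rw [← realize_cnet]
  simp only [cnet, Fml.Realize, Fml.Matrix, Fml.realize_conj, Fml.realize_ite_tru, Fml.matrix_conj,
    Fml.matrix_ite_tru, Fml.le, Fml.ne0]

theorem isHom_eval (v : ℕ → A) : IsHom (Term.alg d) C (Term.eval C v) := by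
  constructor <;> intros <;> rfl

theorem map_accept (N : PreNet d (Term d)) (m : Shape d N.size) (t : Term d) (v : ℕ → A) :
    ((Term.alg d).accept N m t).map (Term.eval C v) =
      C.accept (N.map (Term.eval C v)) m (t.eval C v) :=
  (isHom_eval C v).map_accept N m t

theorem map_reject (N : PreNet d (Term d)) (m : Shape d N.size) (t : Term d) (v : ℕ → A) :
    ((Term.alg d).reject N m t).map (Term.eval C v) =
      C.reject (N.map (Term.eval C v)) m (t.eval C v) :=
  (isHom_eval C v).map_reject N m t

theorem map_init (t : Term d) (v : ℕ → A) :
    ((Term.alg d).init t).map (Term.eval C v) = C.init (t.eval C v) :=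
  (isHom_eval C v).map_init t

/-- The values in `C` of the labels of the term network `N` depend only on the variables in `S`. -/
def PreNet.DependsOn (N : PreNet d (Term d)) (S : Set ℕ) : Prop :=
  ∀ v w : ℕ → A, Set.EqOn v w S → N.map (Term.eval C v) = N.map (Term.eval C w)

variable {C}

theorem PreNet.DependsOn.label_eq {N : PreNet d (Term d)} {S : Set ℕ} (hN : N.DependsOn C S)
    {v w : ℕ → A} (hvw : Set.EqOn v w S) :
    (fun x => (N.label x).eval C v) = fun x => (N.label x).eval C w := by
  have := hN v w hvw
  simpa only [PreNet.map, PreNet.mk.injEq, heq_eq_eq, true_and] using this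

theorem PreNet.DependsOn.accept_eq {N : PreNet d (Term d)} {S : Set ℕ} (hN : N.DependsOn C S)
    {v w : ℕ → A} (hvw : Set.EqOn v w S) (m : Shape d N.size) (a : A) :
    C.accept (N.map (Term.eval C v)) m a = C.accept (N.map (Term.eval C w)) m a :=
  congrArg (fun L => C.accept ⟨N.size, L⟩ m a) (hN.label_eq hvw)

theorem PreNet.DependsOn.accept {N : PreNet d (Term d)} {S : Set ℕ} (hN : N.DependsOn C S)
    (m : Shape d N.size) (k : ℕ) :
    ((Term.alg d).accept N m (.var k)).DependsOn C (insert k S) := by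
  intro v w hvw
  rw [map_accept, map_accept, hN.accept_eq (hvw.mono (Set.subset_insert k S))]
  congr 1
  exact hvw (Set.mem_insert k S)

theorem PreNet.DependsOn.reject_eq {N : PreNet d (Term d)} {S : Set ℕ} (hN : N.DependsOn C S)
    {v w : ℕ → A} (hvw : Set.EqOn v w S) (m : Shape d N.size) (a : A) :
    C.reject (N.map (Term.eval C v)) m a = C.reject (N.map (Term.eval C w)) m a :=
  congrArg (fun L => C.reject ⟨N.size, L⟩ m a) (hN.label_eq hvw)

theorem PreNet.DependsOn.reject {N : PreNet d (Term d)} {S : Set ℕ} (hN : N.DependsOn C S)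
    (m : Shape d N.size) (k : ℕ) :
    ((Term.alg d).reject N m (.var k)).DependsOn C (insert k S) := by
  intro v w hvw
  rw [map_reject, map_reject, hN.reject_eq (hvw.mono (Set.subset_insert k S))]
  congr 1
  exact hvw (Set.mem_insert k S)

theorem dependsOn_init : ((Term.alg d).init (.var 0)).DependsOn C {0} := by
  intro v w hvw
  rw [map_init, map_init]
  exact congrArg C.init (hvw rfl)

/-- The formula `ψ_n^d(N)` is true if and only if `∃` wins the game of length `n` from `N`. -/
theorem realize_psi : ∀ {n k : ℕ} {N : PreNet d (Term d)} {S : Set ℕ}, N.DependsOn C S →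
    (∀ i ∈ S, i < k) → ∀ v : ℕ → A,
    ((psi n k N).Realize C v ↔ C.Wins n (N.map (Term.eval C v)))
  | 0, _, N, _, _, _, v => realize_cnet C N v
  | n + 1, k, N, S, hN, hS, v => by
    have hS' : ∀ i ∈ insert k S, i < k + 1 := by
      rintro i (rfl | hi)
      · exact Nat.lt_succ_self _
      · exact (hS i hi).trans (Nat.lt_succ_self _)
    have hS'' : ∀ i ∈ insert k S, i < k + 2 ^ n :=
      fun i hi => (hS' i hi).trans_le (Nat.add_le_add_left Nat.one_le_two_pow k)
    have hv : ∀ a, Set.EqOn (Function.update v k a) v S :=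
      fun a i hi => Function.update_of_ne (hS i hi).ne _ _
    simp only [psi, Fml.Realize, Fml.realize_conj, mem_shapes, true_imp_iff]
    have step : ∀ (a : A) (m : Shape d N.size),
        ((psi n (k + 1) ((Term.alg d).accept N m (.var k))).Realize C (Function.update v k a) ∨
          (psi n (k + 2 ^ n) ((Term.alg d).reject N m (.var k))).Realize C
            (Function.update v k a)) ↔
        (C.Wins n (C.accept (N.map (Term.eval C v)) m a) ∨
          C.Wins n (C.reject (N.map (Term.eval C v)) m a)) := by
      intro a m
      rw [realize_psi (hN.accept m k) hS', realize_psi (hN.reject m k) hS'', map_accept,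
        map_reject, hN.accept_eq (hv a), hN.reject_eq (hv a)]
      simp only [Term.eval, Function.update_self]
    simp only [step]
    exact forall_comm

/-- After the deletion of the quantifiers, the truth of `ψ_n^d(N)` depends only on the free
variables and on the bound ones, which are `var k, …, var (k + 2 ^ n - 2)`. -/
theorem matrix_psi_congr : ∀ {n k : ℕ} {N : PreNet d (Term d)} {S : Set ℕ},
    N.DependsOn C S → ∀ {v w : ℕ → A}, Set.EqOn v w S →
    Set.EqOn v w (Set.Ico k (k + 2 ^ n - 1)) →
    ((psi n k N).Matrix C v ↔ (psi n k N).Matrix C w)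
  | 0, _, N, _, hN, v, w, hvw, _ => by
    simp only [psi]
    rw [matrix_cnet, matrix_cnet, hN v w hvw]
  | n + 1, k, N, S, hN, v, w, hvw, hk => by
    have h2 : 1 ≤ 2 ^ n := Nat.one_le_two_pow
    simp only [psi, Fml.Matrix, Fml.matrix_conj, mem_shapes, true_imp_iff]
    have hins : Set.EqOn v w (insert k S) := by
      rintro i (rfl | hi)
      · exact hk ⟨le_rfl, by omega⟩
      · exact hvw hi
    refine forall_congr' fun m => or_congr ?_ ?_
    · exact matrix_psi_congr (hN.accept m k) hins
        (hk.mono (Set.Ico_subset_Ico (by omega) (by omega)))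
    · exact matrix_psi_congr (hN.reject m k) hins
        (hk.mono (Set.Ico_subset_Ico (by omega) (by omega)))

theorem matrix_psi_of_wins : ∀ {n k : ℕ} {N : PreNet d (Term d)} {v : ℕ → A},
    C.Wins n (N.map (Term.eval C v)) → (psi n k N).Matrix C v
  | 0, _, N, v, hw => (matrix_cnet C N v).2 hw
  | n + 1, k, N, v, hw => by
    simp only [psi, Fml.Matrix, Fml.matrix_conj, mem_shapes, true_imp_iff]
    intro m
    refine (hw m (v k)).imp (fun h => matrix_psi_of_wins ?_) fun h => matrix_psi_of_wins ?_
    · rw [map_accept]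
      exact h
    · rw [map_reject]
      exact h

/-- If `∃` does not win, then the bound variables of `ψ_n^d(N)` can be given values that describe
the moves of a winning strategy of `∀`. Since the bound variables of the two disjuncts are distinct,
the values for the two possible answers of `∃` do not interfere. -/
theorem wins_of_matrix_psi : ∀ {n k : ℕ} {N : PreNet d (Term d)} {S : Set ℕ}, N.DependsOn C S →
    (∀ i ∈ S, i < k) → ∀ {v : ℕ → A},
    (∀ w, Set.EqOn v w (Set.Iio k) → (psi n k N).Matrix C w) →
    C.Wins n (N.map (Term.eval C v))
  | 0, _, N, _, _, _, v, h => (matrix_cnet C N v).1 (h v fun _ _ => rfl)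
  | n + 1, k, N, S, hN, hS, v, h => by
    have h2 : 1 ≤ 2 ^ n := Nat.one_le_two_pow
    have hS' : ∀ i ∈ insert k S, i < k + 1 := by
      rintro i (rfl | hi)
      · exact Nat.lt_succ_self _
      · exact (hS i hi).trans (Nat.lt_succ_self _)
    have hS'' : ∀ i ∈ insert k S, i < k + 2 ^ n :=
      fun i hi => (hS' i hi).trans_le (Nat.add_le_add_left Nat.one_le_two_pow k)
    show ∀ (m : Shape d N.size) (a : A), _
    intro m a
    by_contra hcon
    rw [not_or] at hcon
    have hv : Set.EqOn (Function.update v k a) v S :=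
      fun i hi => Function.update_of_ne (hS i hi).ne _ _
    have hacc : ((Term.alg d).accept N m (.var k)).map (Term.eval C (Function.update v k a)) =
        C.accept (N.map (Term.eval C v)) m a := by
      rw [map_accept, hN.accept_eq hv]
      simp only [Term.eval, Function.update_self]
    have hrej : ((Term.alg d).reject N m (.var k)).map (Term.eval C (Function.update v k a)) =
        C.reject (N.map (Term.eval C v)) m a := by
      rw [map_reject, hN.reject_eq hv]
      simp only [Term.eval, Function.update_self]
    rw [← hacc, ← hrej] at hcon
    obtain ⟨w₁, hw₁, hn₁⟩ : ∃ w, Set.EqOn (Function.update v k a) w (Set.Iio (k + 1)) ∧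
        ¬ (psi n (k + 1) ((Term.alg d).accept N m (.var k))).Matrix C w := by
      by_contra hno
      push Not at hno
      exact hcon.1 (wins_of_matrix_psi (hN.accept m k) hS' hno)
    obtain ⟨w₂, hw₂, hn₂⟩ : ∃ w, Set.EqOn (Function.update v k a) w (Set.Iio (k + 2 ^ n)) ∧
        ¬ (psi n (k + 2 ^ n) ((Term.alg d).reject N m (.var k))).Matrix C w := by
      by_contra hno
      push Not at hno
      exact hcon.2 (wins_of_matrix_psi (hN.reject m k) hS'' hno)
    let w : ℕ → A := fun i => if i < k + 2 ^ n then w₁ i else w₂ i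
    have hw : Set.EqOn v w (Set.Iio k) := by
      intro i hi
      have hi' : i < k := hi
      simp only [w]
      rw [if_pos (by omega), ← hw₁ (show i < k + 1 by omega), Function.update_of_ne hi'.ne]
    have hm := h w hw
    simp only [psi, Fml.Matrix, Fml.matrix_conj, mem_shapes, true_imp_iff] at hm
    rcases hm m with hm | hm
    · refine hn₁ ((matrix_psi_congr (hN.accept m k) ?_ ?_).1 hm)
      · intro i hi
        exact if_pos (hS'' i hi)
      · rintro i ⟨-, hi⟩
        exact if_pos (by omega)
    · refine hn₂ ((matrix_psi_congr (hN.reject m k) ?_ ?_).1 hm)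
      · intro i hi
        simp only [w]
        rw [if_pos (hS'' i hi), ← hw₁ (hS' i hi), ← hw₂ (hS'' i hi)]
      · rintro i ⟨hi, -⟩
        exact if_neg (by omega)

theorem models_phi_iff (n : ℕ) :
    C.Models (phi d n) ↔ ∀ a : A, a ≠ C.zero → C.Wins n (C.init a) := by
  have key : ∀ (v : ℕ → A) (a : A), (psi n 1 ((Term.alg d).init (.var 0))).Realize C
      (Function.update v 0 a) ↔ C.Wins n (C.init a) := by
    intro v a
    rw [realize_psi dependsOn_init (by simp), map_init]
    simp [Term.eval]
  constructor
  · intro h a ha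
    exact (key (fun _ => a) a).1 (h (fun _ => a) a ha)
  · intro h v a ha
    exact (key v a).2 (h a ha)

/-- The quantifiers of `φ_n^d` can be deleted. -/
theorem matrix_phi_iff (n : ℕ) : (∀ v, (phi d n).Matrix C v) ↔ C.Models (phi d n) := by
  rw [models_phi_iff]
  constructor
  · intro h a ha
    have := wins_of_matrix_psi (C := C) (n := n) (k := 1) dependsOn_init (by simp)
      (v := fun _ => a) fun w hw => h w ?_
    · rwa [map_init] at this
    · have h0 : a = w 0 := hw (show 0 < 1 by omega)
      show ¬ (w 0 = C.zero)
      rwa [← h0]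
  · intro h v h0
    apply matrix_psi_of_wins
    rw [map_init]
    exact h _ h0

end Semantics

/-! ### Homomorphisms, set algebras, and strategies from representations -/

section Hom

variable {d : ℕ} {A : Type u} {B : Type v} {C : PAlg d A} {D : PAlg d B} {f : A → B}

theorem IsHom.map_eval (hf : IsHom C D f) (v : ℕ → A) (t : Term d) :
    f (t.eval C v) = t.eval D (f ∘ v) := by
  induction t with
  | var n => rfl
  | zero => exact hf.map_zero
  | one => exact hf.map_one
  | add s t hs ht => simp only [Term.eval, hf.map_add, hs, ht]
  | neg t ht => simp only [Term.eval, hf.map_neg, ht]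
  | cyl i t ht => simp only [Term.eval, hf.map_cyl, ht]
  | subst i j t ht => simp only [Term.eval, hf.map_subst, ht]
  | perm i j t ht => simp only [Term.eval, hf.map_perm, ht]
  | diag i j => exact hf.map_diag i j

theorem IsHom.sat_of_injective (hf : IsHom C D f) (hinj : Function.Injective f) {e : Equation d}
    (he : D.Sat e) : C.Sat e := fun v => hinj (by rw [hf.map_eval, hf.map_eval, he])

theorem IsHom.sat_of_surjective (hf : IsHom C D f) (hsurj : Function.Surjective f)
    {e : Equation d} (he : C.Sat e) : D.Sat e := fun v => by
  obtain ⟨w, rfl⟩ := hsurj.comp_left v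
  rw [← hf.map_eval, ← hf.map_eval, he]

theorem IsHom.comp {E : Type*} {F : PAlg d E} {g : B → E} (hg : IsHom D F g) (hf : IsHom C D f) :
    IsHom C F (g ∘ f) := by
  constructor <;> intros <;> simp [hf.map_zero, hf.map_one, hf.map_add, hf.map_neg, hf.map_cyl,
    hf.map_subst, hf.map_perm, hf.map_diag, hg.map_zero, hg.map_one, hg.map_add, hg.map_neg,
    hg.map_cyl, hg.map_subst, hg.map_perm, hg.map_diag]

theorem isHom_apply {ι : Type u} {B : ι → Type v} (D : ∀ a, PAlg d (B a)) (a : ι) :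
    IsHom (piAlg D) (D a) (fun x => x a) := by
  constructor <;> intros <;> rfl

theorem isHom_pi {ι : Type u} {B : ι → Type v} {D : ∀ a, PAlg d (B a)} {f : ∀ a, A → B a}
    (hf : ∀ a, IsHom C (D a) (f a)) : IsHom C (piAlg D) (fun x a => f a x) := by
  constructor <;> intros <;> funext a
  · exact (hf a).map_zero
  · exact (hf a).map_one
  · exact (hf a).map_add _ _
  · exact (hf a).map_neg _
  · exact (hf a).map_cyl _ _
  · exact (hf a).map_subst _ _ _
  · exact (hf a).map_perm _ _ _
  · exact (hf a).map_diag _ _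

theorem sat_piAlg {ι : Type u} {B : ι → Type v} {D : ∀ a, PAlg d (B a)} {e : Equation d}
    (he : ∀ a, (D a).Sat e) : (piAlg D).Sat e := fun v => by
  funext a
  rw [(isHom_apply D a).map_eval v, (isHom_apply D a).map_eval v, he]

end Hom

section FullSetAlg

variable {d : ℕ} {U : Type u}

theorem fullSetAlg_mul (X Y : Set (Fin d → U)) : (fullSetAlg d U).mul X Y = X ∩ Y := by
  simp [PAlg.mul, fullSetAlg, Set.compl_union]

theorem mem_fullSetAlg_perm {i j : Fin d} {X : Set (Fin d → U)} {s : Fin d → U} :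
    s ∈ (fullSetAlg d U).perm i j X ↔ s ∘ Equiv.swap i j ∈ X := by
  have hs : ∀ t : Fin d → U, (t ∘ Equiv.swap i j) ∘ Equiv.swap i j = t := fun t => by
    funext k
    simp
  constructor
  · rintro ⟨t, ht, rfl⟩
    rwa [hs]
  · intro h
    exact ⟨_, h, hs s⟩

theorem mem_fullSetAlg_cyl {i : Fin d} {X : Set (Fin d → U)} {s : Fin d → U} :
    s ∈ (fullSetAlg d U).cyl i X ↔ ∃ u, Function.update s i u ∈ X := by
  constructor
  · rintro ⟨t, ht, hst⟩
    refine ⟨t i, ?_⟩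
    convert ht
    funext k
    rcases eq_or_ne k i with rfl | hk
    · simp
    · rw [Function.update_of_ne hk, hst k hk]
  · rintro ⟨u, hu⟩
    exact ⟨_, hu, fun k hk => (Function.update_of_ne hk _ _).symm⟩

theorem update_comp_swap_self (i j : Fin d) (s : Fin d → U) :
    Function.update (s ∘ Equiv.swap i j) j (s j) = Function.update s i (s j) := by
  funext k
  rcases eq_or_ne k j with rfl | hk
  · simp [Function.update_apply]
  · rcases eq_or_ne k i with rfl | hki
    · simp [hk]
    · simp [hk, hki, Equiv.swap_apply_of_ne_of_ne hki hk]

/-- The full set algebras satisfy the equations of polyadic equality algebras. -/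
theorem fullSetAlg_isPEA : (fullSetAlg d U).IsPEA := by
  intro e he v
  change IsPEAEquation d e at he
  have eval_add : ∀ s t : Term d, (s + t).eval (fullSetAlg d U) v =
    s.eval (fullSetAlg d U) v ∪ t.eval (fullSetAlg d U) v := fun _ _ => rfl
  have eval_neg : ∀ s : Term d, (-s).eval (fullSetAlg d U) v =
    (s.eval (fullSetAlg d U) v)ᶜ := fun _ => rfl
  have eval_mul : ∀ s t : Term d, (s * t).eval (fullSetAlg d U) v =
    s.eval (fullSetAlg d U) v ∩ t.eval (fullSetAlg d U) v := fun _ _ => fullSetAlg_mul _ _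
  have eval_one : (1 : Term d).eval (fullSetAlg d U) v = Set.univ := rfl
  have eval_zero : (0 : Term d).eval (fullSetAlg d U) v = ∅ := rfl
  have eval_subst : ∀ (i j : Fin d) (t : Term d) (s : Fin d → U),
    s ∈ (t.subst i j).eval (fullSetAlg d U) v ↔
      Function.update s i (s j) ∈ t.eval (fullSetAlg d U) v := fun _ _ _ _ => Iff.rfl
  have eval_diag : ∀ (i j : Fin d) (s : Fin d → U),
    s ∈ (Term.diag i j).eval (fullSetAlg d U) v ↔ s i = s j := fun _ _ _ => Iff.rfl
  have eval_cyl : ∀ (i : Fin d) (t : Term d) (s : Fin d → U),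
    s ∈ (t.cyl i).eval (fullSetAlg d U) v ↔
      ∃ u, Function.update s i u ∈ t.eval (fullSetAlg d U) v :=
    fun _ _ _ => mem_fullSetAlg_cyl
  have eval_perm : ∀ (i j : Fin d) (t : Term d) (s : Fin d → U),
    s ∈ (t.perm i j).eval (fullSetAlg d U) v ↔
      s ∘ Equiv.swap i j ∈ t.eval (fullSetAlg d U) v := fun _ _ _ _ => mem_fullSetAlg_perm
  ext s
  cases he <;> simp only [eval_add, eval_neg, eval_mul, eval_one, eval_zero, eval_subst, eval_diag,
    eval_cyl, eval_perm, Set.mem_union, Set.mem_inter_iff, Set.mem_compl_iff]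
  case subst_self i => simp
  case perm_self i => simp
  case perm_comm i j => rw [Equiv.swap_comm]
  case le_cyl i =>
    refine or_iff_right_of_imp fun h => ⟨s i, ?_⟩
    rwa [Function.update_eq_self]
  case cyl_add i => exact exists_or
  case subst_cyl i j => simp
  case cyl_subst i j h =>
    simp only [Function.update_of_ne h.symm, Function.update_idem, exists_const_iff,
      and_iff_right_iff_imp]
    exact fun _ => ⟨s i⟩
  case subst_cyl_comm i j k hi hj =>
    refine exists_congr fun u => ?_
    rw [Function.update_of_ne hj.symm, Function.update_comm hi.symm]
  case perm_perm i j =>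
    have : (s ∘ Equiv.swap i j) ∘ Equiv.swap i j = s := by
      funext k
      simp
    rw [this]
  case perm_perm_comm i j k hij hik hjk =>
    have : (s ∘ Equiv.swap i j) ∘ Equiv.swap i k = (s ∘ Equiv.swap j k) ∘ Equiv.swap i j := by
      funext l
      simp only [Function.comp]
      congr 1
      simp only [Equiv.swap_apply_def]
      split_ifs <;> simp_all
    rw [this]
  case perm_subst i j =>
    rw [Function.comp_apply, Equiv.swap_apply_left, update_comp_swap_self]
  case subst_diag i j =>
    simp [Function.update_apply]
  case diag_le i j =>
    refine or_iff_right_of_imp fun h => ?_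
    rw [← h.2, Function.update_eq_self]
    exact h.1
  case add_compl => simp [em]
  case mul_compl => simp
  all_goals tauto

end FullSetAlg

section Strategy

variable {d : ℕ} {A : Type u} {U : Type v} {C : PAlg d A} {f : A → Set (Fin d → U)}

theorem IsHom.mem_mul (hf : IsHom C (fullSetAlg d U) f) {x y : A} {s : Fin d → U} :
    s ∈ f (C.mul x y) ↔ s ∈ f x ∧ s ∈ f y := by
  rw [hf.map_mul, fullSetAlg_mul]
  rfl

theorem IsHom.mem_neg (hf : IsHom C (fullSetAlg d U) f) {x : A} {s : Fin d → U} :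
    s ∈ f (C.neg x) ↔ s ∉ f x := by
  rw [hf.map_neg]
  rfl

theorem IsHom.ne_zero (hf : IsHom C (fullSetAlg d U) f) {x : A} {s : Fin d → U} (hs : s ∈ f x) :
    x ≠ C.zero := by
  rintro rfl
  rw [hf.map_zero] at hs
  exact hs

theorem IsHom.mem_diagProd (hf : IsHom C (fullSetAlg d U) f) {k : ℕ}
    (g : Fin k → U) (y : Fin d → Fin k) : g ∘ y ∈ f (C.diagProd y) := by
  have key : ∀ l : List (Fin d × Fin d), (∀ p ∈ l, y p.1 = y p.2) →
      g ∘ y ∈ f (C.listProd (l.map fun p => C.diag p.1 p.2)) := by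
    intro l hl
    induction l with
    | nil =>
      show g ∘ y ∈ f C.one
      rw [hf.map_one]
      exact Set.mem_univ _
    | cons p l ih =>
      refine hf.mem_mul.2 ⟨?_, ih fun q hq => hl q (List.mem_cons_of_mem _ hq)⟩
      rw [hf.map_diag]
      exact congrArg g (hl p List.mem_cons_self)
  exact key _ fun p hp => by simpa using (List.mem_filter.1 hp).2

variable [BooleanAlgebra A]

theorem IsHom.map_sup (h : C.Laws) (hf : IsHom C (fullSetAlg d U) f) (x y : A) :
    f (x ⊔ y) = f x ∪ f y := by
  rw [← h.add_eq, hf.map_add]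
  rfl

theorem IsHom.mono (h : C.Laws) (hf : IsHom C (fullSetAlg d U) f) {x y : A} (hxy : x ≤ y) :
    f x ⊆ f y := by
  rw [← sup_eq_right.2 hxy, hf.map_sup h]
  exact Set.subset_union_left

/-- A prenetwork whose nodes can be mapped into the base of a set algebra in accordance with the
labels, and which respects the diagonals, is a network. -/
theorem IsHom.isNetwork (h : C.Laws) (hf : IsHom C (fullSetAlg d U) f) {N : PreNet d A}
    (hN : N.Diagonal C) (g : Fin N.size → U) (hg : ∀ x, g ∘ x ∈ f (N.label x)) :
    C.IsNetwork N where
  diag := hN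
  cyl i x y hxy := by
    refine hf.ne_zero (s := g ∘ x) (hf.mem_mul.2 ⟨hg x, ?_⟩)
    rw [hf.map_cyl]
    exact ⟨_, hg y, fun k hk => congrArg g (hxy k hk)⟩
  perm i j x y hxy := by
    refine hf.ne_zero (s := g ∘ x) (hf.mem_mul.2 ⟨hg x, ?_⟩)
    rw [hf.map_perm]
    exact ⟨_, hg y, by rw [show x = y ∘ Equiv.swap i j from hxy]; rfl⟩
  cong i j k x y z hxy hxz hyz hz := by
    have hgz : g ∘ z ∈ f (C.diag j k) := hf.mono h (h.le_iff.1 hz) (hg z)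
    rw [hf.map_diag] at hgz
    have : g ∘ x = g ∘ y := by
      funext l
      rcases eq_or_ne l i with rfl | hl
      · have hgz' : g (z j) = g (z k) := hgz
        rw [Function.comp_apply, Function.comp_apply, hxz, hyz, hgz']
      · exact congrArg g (hxy l hl)
    exact hf.ne_zero (s := g ∘ x) (hf.mem_mul.2 ⟨hg x, this ▸ hg y⟩)

/-- A map of the nodes into the base of a set algebra tells `∃` how to answer: she accepts a move
if and only if the image of the tuple lies in the representation of the element. -/
theorem IsHom.wins (h : C.Laws) (hf : IsHom C (fullSetAlg d U) f) : ∀ {n : ℕ} {N : PreNet d A},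
    N.Diagonal C → ∀ g : Fin N.size → U, (∀ x, g ∘ x ∈ f (N.label x)) → C.Wins n N
  | 0, _, hN, g, hg => hf.isNetwork h hN g hg
  | n + 1, ⟨s, L⟩, hN, g, hg => by
    have hupd : ∀ (K : (Fin d → Fin s) → A), (∀ y, g ∘ y ∈ f (K y)) → ∀ (x : Fin d → Fin s) (b : A),
        g ∘ x ∈ f b → ∀ y, g ∘ y ∈ f (Function.update K x (C.mul (K x) b) y) := by
      intro K hK x b hb y
      rcases eq_or_ne y x with rfl | hy
      · rw [Function.update_self]
        exact hf.mem_mul.2 ⟨hK y, hb⟩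
      · rw [Function.update_of_ne hy]
        exact hK y
    intro m a
    cases m with
    | cyl i x =>
      by_cases hx : g ∘ x ∈ f (C.cyl i a)
      · left
        have hx' := hx
        rw [hf.map_cyl, mem_fullSetAlg_cyl] at hx'
        obtain ⟨u, hu⟩ := hx'
        let g' : Fin (s + 1) → U := Fin.snoc g u
        have hg' : ∀ y : Fin d → Fin s, (g' ∘ fun l => (y l).castSucc) = g ∘ y := by
          intro y
          funext l
          simp [g']
        refine hf.wins h (h.diagonal_accept hN _ a) g' fun (y : Fin d → Fin (s + 1)) => ?_
        simp only [PAlg.accept]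
        by_cases h1 : y = Function.update (fun l => (x l).castSucc) i (Fin.last s)
        · rw [if_pos h1, ← h1]
          refine hf.mem_mul.2 ⟨?_, hf.mem_diagProd g' y⟩
          convert hu
          rw [h1]
          funext l
          rcases eq_or_ne l i with rfl | hl
          · simp [g']
          · simp [g', hl]
        rw [if_neg h1]
        by_cases h2 : ∀ l, y l ≠ Fin.last s
        · rw [dif_pos h2]
          have hy : g' ∘ y = g ∘ fun l => (y l).castPred (h2 l) := by
            rw [← hg']
            congr 1
          rw [hy]
          split_ifs with h3
          · rw [h3]
            exact hf.mem_mul.2 ⟨hg x, hx⟩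
          · exact hg _
        · rw [dif_neg h2]
          exact hf.mem_diagProd g' y
      · right
        exact hf.wins h (h.diagonal_reject hN _ a) g (hupd L hg x _ (hf.mem_neg.2 hx))
    | choice x =>
      by_cases hx : g ∘ x ∈ f a
      · left
        exact hf.wins h (h.diagonal_accept hN _ a) g (hupd L hg x _ hx)
      · right
        exact hf.wins h (h.diagonal_reject hN _ a) g (hupd L hg x _ (hf.mem_neg.2 hx))
    | poly i j x =>
      by_cases hx : g ∘ x ∈ f (C.perm i j a)
      · left
        have hx' : g ∘ (x ∘ Equiv.swap i j) ∈ f a := by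
          rw [hf.map_perm, mem_fullSetAlg_perm] at hx
          exact hx
        exact hf.wins h (h.diagonal_accept hN _ a) g
          (hupd _ (hupd L hg x _ hx) (x ∘ Equiv.swap i j) _ hx')
      · right
        exact hf.wins h (h.diagonal_reject hN _ a) g (hupd L hg x _ (hf.mem_neg.2 hx))

theorem IsHom.wins_init (h : C.Laws) (hf : IsHom C (fullSetAlg d U) f) (n : ℕ) {a : A}
    {s : Fin d → U} (hs : s ∈ f a) : C.Wins n (C.init a) := by
  refine hf.wins h (h.diagonal_init a) s fun (x : Fin d → Fin d) => ?_
  simp only [PAlg.init]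
  split_ifs with hx
  · rw [hx]
    exact hs
  · exact hf.mem_diagProd s x

end Strategy

/-- In a subdirect product of set algebras, every non-zero element is non-empty in some
coordinate, and a tuple in it provides `∃` with a strategy. -/
theorem PAlg.Representable.wins_init {d : ℕ} {A : Type u} [BooleanAlgebra A] {C : PAlg d A}
    (hC : C.Representable) (h : C.Laws) (n : ℕ) {a : A} (ha : a ≠ C.zero) :
    C.Wins n (C.init a) := by
  obtain ⟨ι, U, f, hinj, hf⟩ := hC
  have hne : f a ≠ f C.zero := fun he => ha (hinj he)
  obtain ⟨b, hb⟩ := Function.ne_iff.1 hne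
  have hfb := (isHom_apply (fun b => fullSetAlg d (U b)) b).comp hf
  have hz : f C.zero b = ∅ := hfb.map_zero
  rw [hz] at hb
  obtain ⟨s, hs⟩ := Set.nonempty_iff_ne_empty.2 hb
  exact hfb.wins_init h n hs

theorem PAlg.Representable.isPEA {d : ℕ} {A : Type u} {C : PAlg d A} (hC : C.Representable) :
    C.IsPEA := by
  obtain ⟨ι, U, f, hinj, hf⟩ := hC
  exact fun e he => hf.sat_of_injective hinj (sat_piAlg fun a => fullSetAlg_isPEA e he)

/-! ### Representations from ultrafilter networks -/

/-- `P x a` says that the ultrafilter labelling the tuple `x` of elements of `U` contains `a`. The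
conditions make `P` a network in which every tuple is labelled by an ultrafilter and all
cylindrifications are witnessed; unequal elements of `U` may still be identified by a diagonal. -/
structure IsUltraNetwork {d : ℕ} {A : Type u} {U : Type v} [BooleanAlgebra A] (C : PAlg d A)
    (P : (Fin d → U) → A → Prop) : Prop where
  compl : ∀ x a, P x aᶜ ↔ ¬ P x a
  sup : ∀ x a b, P x (a ⊔ b) ↔ P x a ∨ P x b
  cyl_intro : ∀ i x u a, P (Function.update x i u) a → P x (C.cyl i a)
  cyl_elim : ∀ i x a, P x (C.cyl i a) → ∃ u, P (Function.update x i u) a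
  subst : ∀ i j, i ≠ j → ∀ x a, P (Function.update x i (x j)) a → P x (C.subst i j a)
  perm : ∀ i j x a, P (x ∘ Equiv.swap i j) a → P x (C.perm i j a)
  diag : ∀ i j x, x i = x j → P x (C.diag i j)
  cong : ∀ i j k x u z a, P z (C.diag j k) → x i = z j → u = z k → P x a →
    P (Function.update x i u) a

namespace IsUltraNetwork

variable {d : ℕ} {A : Type u} {U : Type v} [BooleanAlgebra A] {C : PAlg d A}
  {P : (Fin d → U) → A → Prop}

/-- Two elements are identified if some diagonal says that they are equal. -/
def Ident (C : PAlg d A) (P : (Fin d → U) → A → Prop) (u v : U) : Prop :=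
  ∃ (z : Fin d → U) (j k : Fin d), z j = u ∧ z k = v ∧ P z (C.diag j k)

theorem update_of_ident (hP : IsUltraNetwork C P) {x : Fin d → U} {i : Fin d} {u : U} {a : A}
    (hu : Ident C P (x i) u) (hx : P x a) : P (Function.update x i u) a := by
  obtain ⟨z, j, k, hj, hk, hz⟩ := hu
  exact hP.cong i j k x u z a hz hj.symm hk.symm hx

theorem ident_equivalence (hd : 2 ≤ d) (hP : IsUltraNetwork C P) : Equivalence (Ident C P) := by
  let i₀ : Fin d := ⟨0, by omega⟩
  let i₁ : Fin d := ⟨1, by omega⟩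
  have h01 : i₁ ≠ i₀ := by simp [i₀, i₁]
  have hsymm : ∀ {u v : U}, Ident C P u v → Ident C P v u := by
    intro u v huv
    have h1 := hP.update_of_ident (x := fun _ => u) (i := i₀) huv (hP.diag i₀ i₁ _ rfl)
    exact ⟨_, i₀, i₁, by simp, by simp [h01], h1⟩
  refine ⟨fun u => ⟨fun _ => u, i₀, i₀, rfl, rfl, hP.diag _ _ _ rfl⟩, hsymm, ?_⟩
  intro u v w huv hvw
  -- the tuple `(w, w, …)` lies on the diagonal, hence so do `(v, w, …)` and `(u, w, …)`
  have h1 := hP.update_of_ident (x := fun _ => w) (i := i₀) (hsymm hvw) (hP.diag i₀ i₁ _ rfl)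
  have h2 := hP.update_of_ident (i := i₀) (u := u) (by simpa using hsymm huv) h1
  exact ⟨_, i₀, i₁, by simp, by simp [h01], h2⟩

theorem of_ident (hP : IsUltraNetwork C P) {x y : Fin d → U} {a : A}
    (hxy : ∀ l, Ident C P (x l) (y l)) (hx : P x a) : P y a := by
  classical
  have key : ∀ T : Finset (Fin d), P (T.piecewise y x) a := by
    intro T
    induction T using Finset.induction_on with
    | empty => simpa using hx
    | insert i T hi ih =>
      rw [Finset.piecewise_insert]
      refine hP.update_of_ident ?_ ih
      rw [Finset.piecewise_eq_of_notMem _ _ _ hi]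
      exact hxy i
  simpa using key Finset.univ

theorem not_bot (hP : IsUltraNetwork C P) (x : Fin d → U) : ¬ P x ⊥ := by
  intro h
  have h1 : P x (⊥ ⊔ ⊥ᶜ) := (hP.sup x _ _).2 (Or.inl h)
  exact (hP.compl x _).1 (by rwa [bot_sup_eq] at h1) h

/-- The quotient of the set of nodes by identification is the base of a set algebra onto which the
algebra is mapped homomorphically. -/
theorem exists_isHom (hd : 2 ≤ d) (h : C.Laws) (hP : IsUltraNetwork C P) :
    ∃ (V : Type v) (f : A → Set (Fin d → V)), IsHom C (fullSetAlg d V) f ∧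
      ∀ x a, P x a → (f a).Nonempty := by
  let r : Setoid U := ⟨Ident C P, hP.ident_equivalence hd⟩
  have hr : ∀ u : U, Ident C P u (Quotient.mk r u).out :=
    fun u => r.symm (Quotient.mk_out (s := r) u)
  have hr' : ∀ u : U, Ident C P (Quotient.mk r u).out u := fun u => Quotient.mk_out (s := r) u
  let f : A → Set (Fin d → Quotient r) := fun a => {s | P (fun l => (s l).out) a}
  have hupd : ∀ (s : Fin d → Quotient r) (i : Fin d) (q : Quotient r),
      (fun l => (Function.update s i q l).out) = Function.update (fun l => (s l).out) i q.out := by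
    intro s i q
    funext l
    exact Function.apply_update (fun _ => Quotient.out) s i q l
  have hsubst : ∀ i j, i ≠ j → ∀ x a,
      P x (C.subst i j a) ↔ P (Function.update x i (x j)) a := by
    intro i j hij x a
    refine ⟨fun hx => ?_, hP.subst i j hij x a⟩
    by_contra hn
    have := hP.subst i j hij x _ ((hP.compl _ _).2 hn)
    rw [h.subst_compl] at this
    exact (hP.compl _ _).1 this hx
  have hperm : ∀ i j x a, P x (C.perm i j a) ↔ P (x ∘ Equiv.swap i j) a := by
    intro i j x a
    refine ⟨fun hx => ?_, hP.perm i j x a⟩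
    by_contra hn
    have := hP.perm i j x _ ((hP.compl _ _).2 hn)
    rw [h.perm_compl] at this
    exact (hP.compl _ _).1 this hx
  refine ⟨Quotient r, f, ⟨?_, ?_, ?_, ?_, ?_, ?_, ?_, ?_⟩, fun x a hx =>
    ⟨fun l => Quotient.mk r (x l), hP.of_ident (fun l => hr (x l)) hx⟩⟩
  · rw [h.zero_eq]
    exact Set.eq_empty_iff_forall_notMem.2 fun s => hP.not_bot _
  · rw [h.one_eq, ← compl_bot]
    exact Set.eq_univ_iff_forall.2 fun s => (hP.compl _ _).2 (hP.not_bot _)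
  · intro a b
    rw [h.add_eq]
    ext s
    exact hP.sup _ a b
  · intro a
    rw [h.neg_eq]
    ext s
    exact hP.compl _ a
  · intro i a
    ext s
    rw [mem_fullSetAlg_cyl]
    constructor
    · intro hs
      obtain ⟨u, hu⟩ := hP.cyl_elim i _ a hs
      refine ⟨Quotient.mk r u, ?_⟩
      show P _ a
      rw [hupd]
      have := hP.update_of_ident (i := i) (u := (Quotient.mk r u).out)
        (by simpa using hr u) hu
      simpa using this
    · rintro ⟨q, hq⟩
      have hq' : P _ a := hq
      rw [hupd] at hq'
      exact hP.cyl_intro i _ _ a hq'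
  · intro i j a
    rcases eq_or_ne i j with rfl | hij
    · rw [h.subst_self]
      ext s
      show _ ↔ Function.update s i (s i) ∈ f a
      rw [Function.update_eq_self]
    · ext s
      show P _ _ ↔ P _ _
      rw [hupd]
      exact hsubst i j hij _ a
  · intro i j a
    ext s
    rw [mem_fullSetAlg_perm]
    exact hperm i j _ a
  · intro i j
    ext s
    constructor
    · intro hs
      have : Quotient.mk r (s i).out = Quotient.mk r (s j).out :=
        Quotient.sound ⟨_, i, j, rfl, rfl, hs⟩
      rwa [Quotient.out_eq, Quotient.out_eq] at this
    · intro hs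
      exact hP.diag i j _ (congrArg Quotient.out hs)

end IsUltraNetwork

/-! ### Ultrafilter networks from winning strategies -/

/-- The nodes of the ultrafilter network: `d` initial ones, and a witness `wit x i a` for the
possible fact that the label of `x` contains `c_i a`. -/
inductive HenkinNode (d : ℕ) (A : Type u) : Type u
  | base (i : Fin d) : HenkinNode d A
  | wit (x : Fin d → HenkinNode d A) (i : Fin d) (a : A) : HenkinNode d A

namespace HenkinNode

variable {d : ℕ} {A : Type u}

/-- The number of stages at which a node has been introduced. -/
def rank : HenkinNode d A → ℕ
  | base _ => 0
  | wit x _ _ => (Finset.univ.sup fun l => (x l).rank) + 1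

theorem rank_lt_rank_wit (x : Fin d → HenkinNode d A) (i : Fin d) (a : A) (l : Fin d) :
    (x l).rank < (wit x i a).rank :=
  Nat.lt_succ_of_le (Finset.le_sup (f := fun l => (x l).rank) (Finset.mem_univ l))

end HenkinNode

open HenkinNode in
/-- A position `N` of a play from `I_a` that `∃` can still continue for `M` rounds, together with an
interpretation `g` of the nodes of the ultrafilter network in it, such that the witnesses in `W`
have been provided, and the label of `x` has been compared with `c` for all `(x, c) ∈ Q`. -/
structure Approximates {d : ℕ} {A : Type u} [BooleanAlgebra A] (C : PAlg d A) (a : A) (M : ℕ)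
    (W : Set (HenkinNode d A)) (Q : Set ((Fin d → HenkinNode d A) × A)) (N : PreNet d A)
    (g : HenkinNode d A → Fin N.size) : Prop where
  pos : 0 < N.size
  diagonal : N.Diagonal C
  wins : C.Wins M N
  base : N.label (fun i => g (base i)) ≤ a
  wit : ∀ x i b, wit x i b ∈ W → N.label (g ∘ x) ≤ (C.cyl i b)ᶜ ∨
    N.label (g ∘ Function.update x i (wit x i b)) ≤ b
  decided : ∀ q ∈ Q, N.label (g ∘ q.1) ≤ q.2 ∨ N.label (g ∘ q.1) ≤ q.2ᶜ

section Approximation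

variable {d : ℕ} {A : Type u} [BooleanAlgebra A] {C : PAlg d A} {a : A}

theorem Approximates.of_label_le {M M' : ℕ} {W : Set (HenkinNode d A)}
    {Q : Set ((Fin d → HenkinNode d A) × A)} {N N' : PreNet d A} {g : HenkinNode d A → Fin N.size}
    (hN : Approximates C a M W Q N g) (f : Fin N.size → Fin N'.size)
    (hf : ∀ y, N'.label (f ∘ y) ≤ N.label y) (hpos : 0 < N'.size) (hdiag : N'.Diagonal C)
    (hwins : C.Wins M' N') : Approximates C a M' W Q N' (f ∘ g) where
  pos := hpos
  diagonal := hdiag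
  wins := hwins
  base := (hf _).trans hN.base
  wit x i b hb := (hN.wit x i b hb).imp (hf _).trans (hf _).trans
  decided q hq := (hN.decided q hq).imp (hf _).trans (hf _).trans

theorem Approximates.accept (h : C.Laws) {M M' : ℕ} {W : Set (HenkinNode d A)}
    {Q : Set ((Fin d → HenkinNode d A) × A)} {N : PreNet d A} {g : HenkinNode d A → Fin N.size}
    (hN : Approximates C a M W Q N g) (m : Shape d N.size) (b : A)
    (hw : C.Wins M' (C.accept N m b)) :
    Approximates C a M' W Q (C.accept N m b) (C.acceptEmb N m b ∘ g) :=
  hN.of_label_le _ (h.accept_label_le N m b) (C.size_accept_pos hN.pos m b)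
    (h.diagonal_accept hN.diagonal m b) hw

theorem Approximates.reject (h : C.Laws) {M M' : ℕ} {W : Set (HenkinNode d A)}
    {Q : Set ((Fin d → HenkinNode d A) × A)} {N : PreNet d A} {g : HenkinNode d A → Fin N.size}
    (hN : Approximates C a M W Q N g) (m : Shape d N.size) (b : A)
    (hw : C.Wins M' (C.reject N m b)) :
    Approximates C a M' W Q (C.reject N m b) (C.rejectEmb N m b ∘ g) :=
  hN.of_label_le _ (h.reject_label_le N m b) (C.size_reject_pos hN.pos m b)
    (h.diagonal_reject hN.diagonal m b) hw

/-- Cylindrifier moves provide the witnesses. They are made in the order of the ranks, so that no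
node of a tuple is reinterpreted after the tuple has received its witness. -/
theorem exists_approximates_wit (hd : 0 < d) (h : C.Laws) (hw : ∀ n, C.Wins n (C.init a))
    (W : Finset (HenkinNode d A)) :
    ∀ M, ∃ N g, Approximates C a M (W : Set (HenkinNode d A)) ∅ N g := by
  classical
  induction W using Finset.induction_on_max_value (fun w : HenkinNode d A => w.rank) with
  | empty =>
    intro M
    refine ⟨C.init a, fun w => match w with
      | .base i => i
      | .wit _ _ _ => (⟨0, hd⟩ : Fin d), hd, h.diagonal_init a, hw M, ?_, by simp, by simp⟩
    exact (if_pos rfl).le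
  | insert w W hwW hmax ih =>
    intro M
    obtain ⟨N, g, hN⟩ := ih (M + 1)
    cases w with
    | base i =>
      obtain ⟨N, g, hN⟩ := ih M
      refine ⟨N, g, hN.pos, hN.diagonal, hN.wins, hN.base, fun x i b hb => ?_, hN.decided⟩
      exact hN.wit x i b (by simpa using hb)
    | wit x i b =>
      rcases hN.wins (.cyl i (g ∘ x)) b with hM | hM
      · have hN' := hN.accept h _ b hM
        let g' : HenkinNode d A → Fin (N.size + 1) :=
          Function.update (Fin.castSucc ∘ g) (.wit x i b) (Fin.last N.size)
        have hg' : ∀ y : Fin d → HenkinNode d A, (∀ l, y l ≠ .wit x i b) →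
            g' ∘ y = (Fin.castSucc ∘ g) ∘ y := by
          intro y hy
          funext l
          exact Function.update_of_ne (hy l) _ _
        have hx : ∀ l, x l ≠ .wit x i b := fun l hl => by
          have := HenkinNode.rank_lt_rank_wit x i b l
          rw [hl] at this
          exact this.false
        refine ⟨_, g', hN'.pos, hN'.diagonal, hN'.wins, ?_, ?_, by simp⟩
        · have h1 := hg' HenkinNode.base (by simp)
          exact (congrArg (C.accept N (.cyl i (g ∘ x)) b).label h1).trans_le hN'.base
        · intro x' i' b' hmem
          rw [Finset.coe_insert] at hmem
          rcases hmem with heq | hmem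
          · obtain ⟨rfl, rfl, rfl⟩ := HenkinNode.wit.inj heq
            right
            have h1 : g' ∘ Function.update x' i' (.wit x' i' b') =
                Function.update (fun l => (g (x' l)).castSucc) i' (Fin.last N.size) := by
              funext l
              rcases eq_or_ne l i' with rfl | hl
              · simp [g']
              · simp [g', hl, Function.update_of_ne (hx l)]
            refine ((congrArg (C.accept N (.cyl i' (g ∘ x')) b').label h1).trans
              (C.accept_cyl_label_new N i' (g ∘ x') b')).trans_le ?_
            rw [h.mul_eq]
            exact inf_le_left
          · have hr : ∀ l, x' l ≠ .wit x i b := fun l hl => by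
              have h1 := HenkinNode.rank_lt_rank_wit x' i' b' l
              rw [hl] at h1
              exact (h1.trans_le (hmax _ hmem)).false
            have hne : HenkinNode.wit x' i' b' ≠ .wit x i b := fun heq => hwW (heq ▸ hmem)
            have h1 := hg' x' hr
            have h2 := hg' (Function.update x' i' (.wit x' i' b')) fun l => by
              rcases eq_or_ne l i' with rfl | hl
              · simpa using hne
              · simpa [hl] using hr l
            exact (hN'.wit x' i' b' hmem).imp
              ((congrArg (C.accept N (.cyl i (g ∘ x)) b).label h1).trans_le)
              ((congrArg (C.accept N (.cyl i (g ∘ x)) b).label h2).trans_le)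
      · have hN' := hN.reject h _ b hM
        refine ⟨_, C.rejectEmb N (.cyl i (g ∘ x)) b ∘ g, hN'.pos, hN'.diagonal,
          hN'.wins, hN'.base, ?_, by simp⟩
        intro x' i' b' hmem
        rw [Finset.coe_insert] at hmem
        rcases hmem with heq | hmem
        · obtain ⟨rfl, rfl, rfl⟩ := HenkinNode.wit.inj heq
          left
          refine (Function.update_self (g ∘ x') _ N.label).trans_le ?_
          rw [h.mul_eq, h.neg_eq]
          exact inf_le_right
        · exact hN'.wit x' i' b' hmem

/-- Choice moves follow the cylindrifier moves. -/
theorem exists_approximates (hd : 0 < d) (h : C.Laws) (hw : ∀ n, C.Wins n (C.init a))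
    (W : Finset (HenkinNode d A)) (Q : Finset ((Fin d → HenkinNode d A) × A)) :
    ∀ M, ∃ N g, Approximates C a M (W : Set (HenkinNode d A))
      (Q : Set ((Fin d → HenkinNode d A) × A)) N g := by
  classical
  induction Q using Finset.induction_on with
  | empty => simpa using exists_approximates_wit hd h hw W
  | insert q Q hq ih =>
    intro M
    obtain ⟨N, g, hN⟩ := ih (M + 1)
    rcases hN.wins (.choice (g ∘ q.1)) q.2 with hM | hM
    · have hN' := hN.accept h _ _ hM
      refine ⟨_, _, hN'.pos, hN'.diagonal, hN'.wins, hN'.base, hN'.wit, ?_⟩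
      intro q' hq'
      rw [Finset.coe_insert] at hq'
      rcases hq' with rfl | hq'
      · left
        refine (Function.update_self (g ∘ q'.1) _ N.label).trans_le ?_
        rw [h.mul_eq]
        exact inf_le_right
      · exact hN'.decided q' hq'
    · have hN' := hN.reject h _ _ hM
      refine ⟨_, _, hN'.pos, hN'.diagonal, hN'.wins, hN'.base, hN'.wit, ?_⟩
      intro q' hq'
      rw [Finset.coe_insert] at hq'
      rcases hq' with rfl | hq'
      · right
        refine (Function.update_self (g ∘ q'.1) _ N.label).trans_le ?_
        rw [h.mul_eq, h.neg_eq]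
        exact inf_le_right
      · exact hN'.decided q' hq'

/-- A label `c` that decides `e` and is compatible with an element below `e` is itself below
`e`. -/
theorem le_of_inf_ne_bot {b c e : A} (hb : b ≤ e) (hc : c ≤ e ∨ c ≤ eᶜ) (h : c ⊓ b ≠ ⊥) :
    c ≤ e := by
  refine hc.resolve_right fun hc => h ?_
  rw [← le_bot_iff, ← compl_inf_self e]
  exact inf_le_inf hc hb

open Filter in
/-- The limit of finite approximations along an ultrafilter is an ultrafilter network. -/
theorem exists_isUltraNetwork (hd : 0 < d) (h : C.Laws) (hw : ∀ n, C.Wins n (C.init a)) :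
    ∃ P : (Fin d → HenkinNode d A) → A → Prop, IsUltraNetwork C P ∧ ∃ x, P x a := by
  classical
  let I := Finset (HenkinNode d A) × Finset ((Fin d → HenkinNode d A) × A)
  choose N g hN using fun p : I => exists_approximates hd h hw p.1 p.2 0
  let F : Ultrafilter I := Ultrafilter.of atTop
  let L : I → (Fin d → HenkinNode d A) → A := fun p x => (N p).label (g p ∘ x)
  have hF : (F : Filter I) ≤ atTop := Ultrafilter.of_le atTop
  have hnet : ∀ p, C.IsNetwork (N p) := fun p =>
    h.isNetwork_of_wins (hN p).pos (hN p).diagonal (hN p).wins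
  have hdec : ∀ x b, ∀ᶠ p in (F : Filter I), L p x ≤ b ∨ L p x ≤ bᶜ := by
    intro x b
    filter_upwards [hF (eventually_ge_atTop ((∅, {(x, b)}) : I))] with p hp
    exact (hN p).decided (x, b) (hp.2 (Finset.mem_singleton_self _))
  have hwit : ∀ x i b, ∀ᶠ p in (F : Filter I), L p x ≤ (C.cyl i b)ᶜ ∨
      L p (Function.update x i (.wit x i b)) ≤ b := by
    intro x i b
    filter_upwards [hF (eventually_ge_atTop (({.wit x i b}, ∅) : I))] with p hp
    exact (hN p).wit x i b (hp.1 (Finset.mem_singleton_self _))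
  have hcyl : ∀ p i x u, L p x ⊓ C.cyl i (L p (Function.update x i u)) ≠ ⊥ := by
    intro p i x u
    rw [← h.mul_eq, ← h.zero_eq]
    refine (hnet p).cyl i _ _ fun l hl => ?_
    rw [Function.comp_apply, Function.comp_apply, Function.update_of_ne hl]
  have hne : ∀ p x, L p x ≠ ⊥ := by
    intro p x h0
    apply hcyl p ⟨0, hd⟩ x (x ⟨0, hd⟩)
    rw [h0, bot_inf_eq]
  have hcompl : ∀ p x b, L p x ≤ b → ¬ L p x ≤ bᶜ := by
    intro p x b h1 h2
    exact hne p x (le_bot_iff.1 ((le_inf h1 h2).trans (inf_compl_self b).le))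
  -- by `hdec`, every label decides `b` from some point on, so the elements that are above the label
  -- of `x` for almost all `p` form an ultrafilter of the algebra
  refine ⟨fun x b => ∀ᶠ p in (F : Filter I), L p x ≤ b, ⟨?_, ?_, ?_, ?_, ?_, ?_, ?_, ?_⟩,
    HenkinNode.base, Eventually.of_forall fun p => (hN p).base⟩
  · intro x b
    rw [← Ultrafilter.eventually_not]
    refine eventually_congr ?_
    filter_upwards [hdec x b] with p hp
    exact ⟨fun h2 h1 => hcompl p x b h1 h2, hp.resolve_left⟩
  · intro x b c
    rw [← Ultrafilter.eventually_or]
    refine eventually_congr ?_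
    filter_upwards [hdec x b, hdec x c] with p hb hc
    refine ⟨fun h1 => ?_, fun h1 => h1.elim le_sup_of_le_left le_sup_of_le_right⟩
    by_contra hcon
    rw [not_or] at hcon
    refine hcompl p x _ h1 ?_
    rw [compl_sup]
    exact le_inf (hb.resolve_left hcon.1) (hc.resolve_left hcon.2)
  · intro i x u b hb
    filter_upwards [hb, hdec x (C.cyl i b)] with p h1 h2
    exact le_of_inf_ne_bot (h.cyl_mono i h1) h2 (hcyl p i x u)
  · intro i x b hb
    refine ⟨.wit x i b, ?_⟩
    filter_upwards [hb, hwit x i b] with p h1 h2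
    exact h2.resolve_left (hcompl p x _ h1)
  · intro i j hij x b hb
    filter_upwards [hb, hdec x (C.subst i j b)] with p h1 h2
    refine le_of_inf_ne_bot (h.cyl_le_subst hij ?_ h1) h2 (hcyl p i x (x j))
    refine h.le_iff.1 ((hnet p).diag i j _ ?_)
    simp [hij.symm]
  · intro i j x b hb
    filter_upwards [hb, hdec x (C.perm i j b)] with p h1 h2
    refine le_of_inf_ne_bot (h.perm_mono i j h1) h2 ?_
    rw [← h.mul_eq, ← h.zero_eq]
    refine (hnet p).perm i j _ _ ?_
    funext l
    simp
  · intro i j x hx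
    exact Eventually.of_forall fun p => h.le_iff.1 ((hnet p).diag i j _ (congrArg (g p) hx))
  · intro i j k x u z b hz hxz huz hb
    filter_upwards [hz, hb, hdec (Function.update x i u) b] with p h1 h2 h3
    refine le_of_inf_ne_bot h2 h3 ?_
    rw [inf_comm, ← h.mul_eq, ← h.zero_eq]
    refine (hnet p).cong i j k _ _ (g p ∘ z) (fun l hl => ?_) (congrArg (g p) hxz) ?_
      (h.le_iff.2 h1)
    · rw [Function.comp_apply, Function.comp_apply, Function.update_of_ne hl]
    · rw [Function.comp_apply, Function.update_self, huz]
      rfl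

end Approximation

/-- If every non-zero element is mapped to a non-empty set by some homomorphism into a full set
algebra, then the product of these homomorphisms is a representation. -/
theorem representable_of_separating {d : ℕ} {A : Type u} [BooleanAlgebra A] {C : PAlg d A}
    (h : C.Laws) (hsep : ∀ a : A, a ≠ C.zero → ∃ (V : Type u) (f : A → Set (Fin d → V)),
      IsHom C (fullSetAlg d V) f ∧ (f a).Nonempty) : C.Representable := by
  choose V f hf hne using fun a : {a : A // a ≠ C.zero} => hsep a.1 a.2
  refine ⟨{a : A // a ≠ C.zero}, V, fun x a => f a x, ?_, isHom_pi hf⟩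
  have key : ∀ x y : A, (fun a => f a x) = (fun a => f a y) → x ≤ y := by
    intro x y hxy
    by_contra hle
    have hxy' : C.mul x (C.neg y) ≠ C.zero := by
      rw [h.mul_eq, h.neg_eq, h.zero_eq, ne_eq, ← disjoint_iff, disjoint_compl_right_iff]
      exact hle
    obtain ⟨s, hs⟩ := hne ⟨_, hxy'⟩
    rw [(hf _).mem_mul, (hf _).mem_neg] at hs
    have := congrFun hxy ⟨_, hxy'⟩
    exact hs.2 ((Set.ext_iff.1 this s).1 hs.1)
  exact fun x y hxy => le_antisymm (key x y hxy) (key y x hxy.symm)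

theorem PAlg.Laws.representable_of_wins {d : ℕ} {A : Type u} [BooleanAlgebra A] {C : PAlg d A}
    (hd : 2 ≤ d) (h : C.Laws) (hw : ∀ n a, a ≠ C.zero → C.Wins n (C.init a)) :
    C.Representable := by
  refine representable_of_separating h fun a ha => ?_
  obtain ⟨P, hP, x, hx⟩ := exists_isUltraNetwork (by omega) h fun n => hw n a ha
  obtain ⟨V, f, hf, hne⟩ := hP.exists_isHom hd h
  exact ⟨V, f, hf, hne x a hx⟩

/-! ### Discriminator terms -/

section Discriminator

variable {d : ℕ} {A : Type u} {C : PAlg d A}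

open Classical in
theorem eval_toTerm [BooleanAlgebra A] (h : C.Laws) (hd : 3 ≤ d)
    (hc : ∀ x, x ≠ C.zero → C.cylAll x = C.one) (v : ℕ → A) (φ : Fml d) :
    φ.toTerm.eval C v = if φ.Matrix C v then ⊤ else ⊥ := by
  induction φ with
  | eq s t =>
    show C.neg (((Term.alg d).cylAll _).eval C v) = _
    rw [(isHom_eval C v).map_cylAll]
    show C.neg (C.cylAll (C.add (C.mul (s.eval C v) (C.neg (t.eval C v)))
      (C.mul (C.neg (s.eval C v)) (t.eval C v)))) = ite (s.eval C v = t.eval C v) _ _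
    split_ifs with hst
    · rw [hst, h.mul_eq, h.mul_eq, h.neg_eq, h.neg_eq, h.add_eq, inf_compl_self, compl_inf_self,
        sup_bot_eq, PAlg.Laws.cylAll_of_closed (h.closed_bot hd), compl_bot]
    · rw [hc, h.neg_eq, h.one_eq, compl_top]
      intro h0
      rw [h.zero_eq, h.add_eq, h.mul_eq, h.mul_eq, h.neg_eq, h.neg_eq, sup_eq_bot_iff,
        ← disjoint_iff, ← disjoint_iff, disjoint_compl_right_iff, disjoint_compl_left_iff] at h0
      exact hst (le_antisymm h0.1 h0.2)
  | not φ ih =>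
    show C.neg _ = @ite _ (¬ _) (propDecidable _) _ _
    rw [ih, h.neg_eq]
    by_cases h1 : φ.Matrix C v <;> simp [h1]
  | and φ ψ ih₁ ih₂ =>
    show C.mul _ _ = @ite _ (_ ∧ _) (propDecidable _) _ _
    rw [ih₁, ih₂, h.mul_eq]
    by_cases h1 : φ.Matrix C v <;> by_cases h2 : ψ.Matrix C v <;> simp [h1, h2]
  | or φ ψ ih₁ ih₂ =>
    show C.add _ _ = @ite _ (_ ∨ _) (propDecidable _) _ _
    rw [ih₁, ih₂, h.add_eq]
    by_cases h1 : φ.Matrix C v <;> by_cases h2 : ψ.Matrix C v <;> simp [h1, h2]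
  | imp φ ψ ih₁ ih₂ =>
    show C.add (C.neg _) _ = @ite _ (_ → _) (propDecidable _) _ _
    rw [ih₁, ih₂, h.add_eq, h.neg_eq]
    by_cases h1 : φ.Matrix C v <;> by_cases h2 : ψ.Matrix C v <;> simp [h1, h2]
  | all _ φ ih => exact ih

/-- Where `c_0 ⋯ c_{d-1}` is a discriminator, the equation `ε_n^d` says the same as the universal
sentence `φ_n^d`. -/
theorem sat_eps_iff [Nontrivial A] (hC : C.IsPEA) (hd : 3 ≤ d)
    (hc : ∀ x, x ≠ C.zero → C.cylAll x = C.one) (n : ℕ) :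
    C.Sat (eps d n) ↔ C.Models (phi d n) := by
  obtain ⟨_, h⟩ := hC.exists_laws
  rw [← matrix_phi_iff]
  refine forall_congr' fun v => ?_
  show (phi d n).toTerm.eval C v = C.one ↔ _
  rw [eval_toTerm h hd hc, h.one_eq]
  split_ifs with hm
  · exact iff_of_true rfl hm
  · exact iff_of_false bot_ne_top hm

end Discriminator

/-! ### Quotients -/

section Quotient

variable {d : ℕ} {A : Type u}

/-- The quotient of an algebra by a congruence. -/
def PAlg.quot (C : PAlg d A) (r : Setoid A) (hr : C.IsCongruence r) : PAlg d (Quotient r) where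
  zero := Quotient.mk r C.zero
  one := Quotient.mk r C.one
  add := Quotient.map₂ C.add fun _ _ h₁ _ _ h₂ => hr.add _ _ _ _ h₁ h₂
  neg := Quotient.map C.neg fun _ _ h => hr.neg _ _ h
  cyl i := Quotient.map (C.cyl i) fun _ _ h => hr.cyl i _ _ h
  subst i j := Quotient.map (C.subst i j) fun _ _ h => hr.subst i j _ _ h
  perm i j := Quotient.map (C.perm i j) fun _ _ h => hr.perm i j _ _ h
  diag i j := Quotient.mk r (C.diag i j)

theorem PAlg.isHom_quot (C : PAlg d A) (r : Setoid A) (hr : C.IsCongruence r) :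
    IsHom C (C.quot r hr) (Quotient.mk r) := by
  constructor <;> intros <;> rfl

variable [BooleanAlgebra A] {C : PAlg d A}

/-- `x` and `y` agree below some element of the filter `F`. -/
def filterSetoid (F : Set A) (htop : ⊤ ∈ F) (hinf : ∀ a ∈ F, ∀ b ∈ F, a ⊓ b ∈ F) : Setoid A where
  r x y := ∃ b ∈ F, x ⊓ b = y ⊓ b
  iseqv := by
    refine ⟨fun x => ⟨⊤, htop, rfl⟩, fun ⟨b, hb, h⟩ => ⟨b, hb, h.symm⟩, ?_⟩
    rintro x y z ⟨b, hb, h₁⟩ ⟨c, hc, h₂⟩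
    refine ⟨b ⊓ c, hinf b hb c hc, ?_⟩
    rw [← inf_assoc, h₁, inf_right_comm, h₂, inf_right_comm, inf_assoc]

/-- Filters of closed elements yield congruences. -/
theorem PAlg.Laws.isCongruence_filterSetoid (h : C.Laws) (hd : 3 ≤ d) (F : Set A) (htop : ⊤ ∈ F)
    (hinf : ∀ a ∈ F, ∀ b ∈ F, a ⊓ b ∈ F) (hF : ∀ b ∈ F, C.Closed b) :
    C.IsCongruence (filterSetoid F htop hinf) where
  add := by
    rintro x x' y y' ⟨b, hb, h₁⟩ ⟨c, hc, h₂⟩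
    refine ⟨b ⊓ c, hinf b hb c hc, ?_⟩
    rw [h.add_eq, h.add_eq, inf_sup_right, inf_sup_right, ← inf_assoc, h₁, inf_comm b c,
      ← inf_assoc y, h₂, inf_assoc, inf_assoc, inf_comm b c]
  neg := by
    rintro x x' ⟨b, hb, h₁⟩
    refine ⟨b, hb, ?_⟩
    rw [h.neg_eq, h.neg_eq, inf_comm, ← sdiff_eq, inf_comm, ← sdiff_eq,
      ← sdiff_inf_self_right x b, ← sdiff_inf_self_right x' b, h₁]
  cyl := by
    rintro i x x' ⟨b, hb, h₁⟩
    refine ⟨b, hb, ?_⟩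
    rw [← h.cyl_inf_of_cyl_eq hd x (hF b hb i), h₁, h.cyl_inf_of_cyl_eq hd x' (hF b hb i)]
  subst := by
    rintro i j x x' ⟨b, hb, h₁⟩
    refine ⟨b, hb, ?_⟩
    have := congrArg (C.subst i j) h₁
    rwa [h.subst_inf, h.subst_inf, h.subst_of_closed (hF b hb)] at this
  perm := by
    rintro i j x x' ⟨b, hb, h₁⟩
    refine ⟨b, hb, ?_⟩
    have := congrArg (C.perm i j) h₁
    rwa [h.perm_inf, h.perm_inf, h.perm_of_closed (hF b hb)] at this

/-- In a simple algebra, every non-zero element has the cylindrification `1`: the elements above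
the complement of its cylindrification would otherwise yield a proper congruence. -/
theorem PAlg.Laws.cylAll_eq_one (h : C.Laws) (hd : 3 ≤ d) (hs : C.IsSimple) {x : A}
    (hx : x ≠ C.zero) : C.cylAll x = C.one := by
  have hcl : C.Closed (C.cylAll x)ᶜ := h.closed_compl hd (h.closed_cylAll hd x)
  let F : Set A := {b | C.Closed b ∧ (C.cylAll x)ᶜ ≤ b}
  have htop : ⊤ ∈ F := ⟨compl_bot (α := A) ▸ h.closed_compl hd (h.closed_bot hd), le_top⟩
  have hinf : ∀ a ∈ F, ∀ b ∈ F, a ⊓ b ∈ F := fun a ha b hb =>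
    ⟨h.closed_inf hd ha.1 hb.1, le_inf ha.2 hb.2⟩
  rcases hs.2 _ (h.isCongruence_filterSetoid hd F htop hinf fun b hb => hb.1) with hr | hr
  · have hx0 : filterSetoid F htop hinf x ⊥ := by
      refine ⟨_, ⟨hcl, le_rfl⟩, ?_⟩
      rw [bot_inf_eq, ← disjoint_iff, disjoint_compl_right_iff]
      exact h.le_cylAll x
    rw [hr] at hx0
    exact absurd (h.zero_eq ▸ hx0) hx
  · have h01 : filterSetoid F htop hinf ⊤ ⊥ := by
      rw [hr]
      trivial
    obtain ⟨b, hb, hb0⟩ := h01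
    rw [top_inf_eq, bot_inf_eq] at hb0
    have := hb.2
    rw [hb0, le_bot_iff, compl_eq_bot] at this
    rw [this, h.one_eq]

end Quotient

/-! ### The equational axioms -/

section Axioms

variable {d : ℕ}

theorem mem_foldr_cyl {U : Type u} (X : Set (Fin d → U)) (l : List (Fin d)) (s : Fin d → U) :
    s ∈ l.foldr (fullSetAlg d U).cyl X ↔ ∃ t ∈ X, ∀ k, k ∉ l → s k = t k := by
  induction l generalizing s with
  | nil =>
    refine ⟨fun hs => ⟨s, hs, fun _ _ => rfl⟩, ?_⟩
    rintro ⟨t, ht, hst⟩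
    rwa [List.foldr_nil, show s = t from funext fun k => hst k (by simp)]
  | cons i l ih =>
    rw [List.foldr_cons, mem_fullSetAlg_cyl]
    constructor
    · rintro ⟨u, hu⟩
      obtain ⟨t, ht, hst⟩ := (ih _).1 hu
      refine ⟨t, ht, fun k hk => ?_⟩
      rw [List.mem_cons, not_or] at hk
      rw [← hst k hk.2, Function.update_of_ne hk.1]
    · rintro ⟨t, ht, hst⟩
      refine ⟨t i, (ih _).2 ⟨t, ht, fun k hk => ?_⟩⟩
      rcases eq_or_ne k i with rfl | hki
      · rw [Function.update_self]
      · rw [Function.update_of_ne hki]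
        exact hst k (by simp [hki, hk])

/-- On full set algebras `c_0 ⋯ c_{d-1}` is a discriminator, and `∃` wins all games. -/
theorem fullSetAlg_sat_eps (hd : 3 ≤ d) (U : Type u) (n : ℕ) :
    (fullSetAlg d U).Sat (eps d n) := by
  rcases subsingleton_or_nontrivial (Set (Fin d → U)) with hsub | hnon
  · exact fun v => Subsingleton.elim _ _
  obtain ⟨_, h⟩ := (fullSetAlg_isPEA (d := d) (U := U)).exists_laws
  rw [sat_eps_iff fullSetAlg_isPEA hd, models_phi_iff]
  · intro X hX
    obtain ⟨s, hs⟩ := Set.nonempty_iff_ne_empty.2 hX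
    have hid : IsHom (fullSetAlg d U) (fullSetAlg d U) id := by constructor <;> intros <;> rfl
    exact hid.wins_init h n hs
  · intro X hX
    obtain ⟨t, ht⟩ := Set.nonempty_iff_ne_empty.2 hX
    exact Set.eq_univ_iff_forall.2 fun s =>
      (mem_foldr_cyl X _ s).2 ⟨t, ht, fun k hk => absurd (List.mem_finRange k) hk⟩

theorem PAlg.Representable.sat_eps {A : Type u} {C : PAlg d A} (hd : 3 ≤ d)
    (hC : C.Representable) (n : ℕ) : C.Sat (eps d n) := by
  obtain ⟨ι, U, f, hinj, hf⟩ := hC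
  exact hf.sat_of_injective hinj (sat_piAlg fun a => fullSetAlg_sat_eps hd (U a) n)

/-- Every non-zero element of a polyadic equality algebra is non-zero in a quotient in which
`c_0 ⋯ c_{d-1}` is a discriminator. The quotient is taken by the closed elements of an ultrafilter;
here an ultrafilter is the complement of a prime ideal. -/
theorem PAlg.Laws.exists_discriminator_quotient {A : Type u} [BooleanAlgebra A] {C : PAlg d A}
    (h : C.Laws) (hd : 3 ≤ d) {a : A} (ha : a ≠ C.zero) :
    ∃ (r : Setoid A) (hr : C.IsCongruence r), Quotient.mk r a ≠ (C.quot r hr).zero ∧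
      ∀ q, q ≠ (C.quot r hr).zero → (C.quot r hr).cylAll q = (C.quot r hr).one := by
  have hdisj : Disjoint (Order.PFilter.principal a : Set A) ((⊥ : Order.Ideal A) : Set A) := by
    rw [Set.disjoint_left]
    intro x hx hx'
    have h1 : a ≤ x := hx
    have h2 : x ≤ ⊥ := hx'
    exact ha (h.zero_eq ▸ le_bot_iff.1 (h1.trans h2))
  obtain ⟨J, hJ, -, hJa⟩ := DistribLattice.prime_ideal_of_disjoint_filter_ideal hdisj
  have haJ : a ∉ J := fun haJ => Set.disjoint_left.1 hJa (show a ≤ a from le_rfl) haJ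
  have hinfJ : ∀ {x y : A}, x ∉ J → y ∉ J → x ⊓ y ∉ J := fun hx hy hxy =>
    (hJ.mem_or_mem hxy).elim hx hy
  let F : Set A := {b | C.Closed b ∧ b ∉ J}
  have htop : ⊤ ∈ F := ⟨compl_bot (α := A) ▸ h.closed_compl hd (h.closed_bot hd),
    fun ht => haJ (J.lower le_top ht)⟩
  have hinf : ∀ a ∈ F, ∀ b ∈ F, a ⊓ b ∈ F := fun a ha b hb =>
    ⟨h.closed_inf hd ha.1 hb.1, hinfJ ha.2 hb.2⟩
  have hr := h.isCongruence_filterSetoid hd F htop hinf fun b hb => hb.1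
  refine ⟨filterSetoid F htop hinf, hr, fun h0 => ?_, fun q hq => ?_⟩
  · obtain ⟨b, hb, hab⟩ := Quotient.exact h0
    rw [h.zero_eq, bot_inf_eq] at hab
    exact hinfJ haJ hb.2 (hab ▸ J.bot_mem)
  · obtain ⟨x, rfl⟩ := Quotient.exists_rep q
    rw [← (C.isHom_quot _ hr).map_cylAll]
    by_cases hx : C.cylAll x ∈ J
    · have hx0 : filterSetoid F htop hinf x C.zero := by
        refine ⟨(C.cylAll x)ᶜ, ⟨h.closed_compl hd (h.closed_cylAll hd x), fun hx' => ?_⟩, ?_⟩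
        · refine haJ (J.lower le_top ?_)
          rw [← sup_compl_eq_top (x := C.cylAll x)]
          exact J.sup_mem hx hx'
        · rw [h.zero_eq, bot_inf_eq, ← disjoint_iff, disjoint_compl_right_iff]
          exact h.le_cylAll x
      exact absurd (Quotient.sound hx0) hq
    · refine Quotient.sound ⟨C.cylAll x, ⟨h.closed_cylAll hd x, hx⟩, ?_⟩
      rw [h.one_eq, inf_idem, top_inf_eq]

/-- The equations `ε_n^d` hold in the quotients of the algebra as well, and say there that `∃` wins
all games; so these quotients have enough homomorphisms into full set algebras. -/
theorem representable_of_sat {A : Type u} {C : PAlg d A} (hd : 3 ≤ d) (hC : C.IsPEA)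
    (he : ∀ n, C.Sat (eps d n)) : C.Representable := by
  obtain ⟨_, h⟩ := hC.exists_laws
  refine representable_of_separating h fun a ha => ?_
  obtain ⟨r, hr, har, hc⟩ := h.exists_discriminator_quotient hd ha
  have hmk := C.isHom_quot r hr
  have hQ : (C.quot r hr).IsPEA := fun e he =>
    hmk.sat_of_surjective Quotient.mk_surjective (hC e he)
  obtain ⟨_, hQl⟩ := hQ.exists_laws
  have : Nontrivial (Quotient r) := ⟨_, _, har⟩
  have hw : ∀ n b, b ≠ (C.quot r hr).zero → (C.quot r hr).Wins n ((C.quot r hr).init b) :=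
    fun n => (models_phi_iff n).1 <| (sat_eps_iff hQ hd hc n).1 <|
      hmk.sat_of_surjective Quotient.mk_surjective (he n)
  obtain ⟨P, hP, x, hx⟩ := exists_isUltraNetwork (by omega) hQl fun n => hw n _ har
  obtain ⟨V, f, hf, hne⟩ := hP.exists_isHom (by omega) hQl
  exact ⟨V, f ∘ Quotient.mk r, hf.comp hmk, hne x _ hx⟩

end Axioms

/-! ### The equations as elements of an algebra -/

namespace PAlg

variable {d : ℕ} {A : Type u} (C : PAlg d A)

/-- The value of the term into which `Fml.toTerm` converts the equation `x = y`. -/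
def eqTerm (x y : A) : A := C.neg (C.cylAll (C.add (C.mul x (C.neg y)) (C.mul (C.neg x) y)))

/-- The value of the term into which `Fml.toTerm` converts `Fml.conj`. -/
def conjTerm {α : Type} (l : List α) (f : α → A) : A :=
  l.foldr (fun x b => C.mul (f x) b) (C.eqTerm C.one C.one)

/-- The value of the term into which `Fml.toTerm` converts the condition that `N` is a network. -/
def cnetTerm (N : PreNet d A) : A :=
  let T := tuples d N.size
  let D := List.finRange d
  C.mul (C.conjTerm T fun x => C.conjTerm D fun i => C.conjTerm D fun j =>
      if x i = x j then C.eqTerm (C.add (N.label x) (C.diag i j)) (C.diag i j)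
      else C.eqTerm C.one C.one) <|
  C.mul (C.conjTerm T fun x => C.conjTerm T fun y => C.conjTerm D fun i =>
      if AgreeOff i x y then C.neg (C.eqTerm (C.mul (N.label x) (C.cyl i (N.label y))) C.zero)
      else C.eqTerm C.one C.one) <|
  C.mul (C.conjTerm T fun x => C.conjTerm T fun y => C.conjTerm D fun i => C.conjTerm D fun j =>
      if AgreeSwap i j x y then
        C.neg (C.eqTerm (C.mul (N.label x) (C.perm i j (N.label y))) C.zero)
      else C.eqTerm C.one C.one) <|
  C.conjTerm T fun x => C.conjTerm T fun y => C.conjTerm T fun z => C.conjTerm D fun i =>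
    C.conjTerm D fun j => C.conjTerm D fun k =>
      if AgreeOff i x y ∧ x i = z j ∧ y i = z k then
        C.add (C.neg (C.eqTerm (C.add (N.label z) (C.diag j k)) (C.diag j k)))
          (C.neg (C.eqTerm (C.mul (N.label x) (N.label y)) C.zero))
      else C.eqTerm C.one C.one

/-- The value of the term into which `Fml.toTerm` converts `psi n k N`, when `e i` is the value of
the variable `var i`. -/
def psiTerm (e : ℕ → A) : ℕ → ℕ → PreNet d A → A
  | 0, _, N => C.cnetTerm N
  | n + 1, k, N => C.conjTerm (shapes d N.size) fun m =>
      C.add (psiTerm e n (k + 1) (C.accept N m (e k)))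
        (psiTerm e n (k + 2 ^ n) (C.reject N m (e k)))

end PAlg

section Hom

variable {d : ℕ} {A : Type u} {C : PAlg d A} {f : Term d → A}

theorem IsHom.map_toTerm_eq (hf : IsHom (Term.alg d) C f) (s t : Term d) :
    f (Fml.eq s t).toTerm = C.eqTerm (f s) (f t) := by
  refine (hf.map_neg _).trans (congrArg C.neg ((hf.map_cylAll _).trans (congrArg C.cylAll ?_)))
  refine (hf.map_add _ _).trans (congrArg₂ C.add ?_ ?_)
  · exact (hf.map_mul _ _).trans (congrArg (C.mul _) (hf.map_neg _))
  · exact (hf.map_mul _ _).trans (congrArg (fun b => C.mul b _) (hf.map_neg _))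

theorem IsHom.map_toTerm_tru (hf : IsHom (Term.alg d) C f) :
    f (Fml.tru : Fml d).toTerm = C.eqTerm C.one C.one :=
  (hf.map_toTerm_eq _ _).trans (congrArg₂ C.eqTerm hf.map_one hf.map_one)

theorem IsHom.map_toTerm_le (hf : IsHom (Term.alg d) C f) (s t : Term d) :
    f (Fml.le s t).toTerm = C.eqTerm (C.add (f s) (f t)) (f t) :=
  (hf.map_toTerm_eq _ _).trans (congrArg (fun b => C.eqTerm b _) (hf.map_add _ _))

theorem IsHom.map_toTerm_ne0 (hf : IsHom (Term.alg d) C f) (t : Term d) :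
    f (Fml.ne0 t).toTerm = C.neg (C.eqTerm (f t) C.zero) :=
  (hf.map_neg _).trans
    (congrArg C.neg ((hf.map_toTerm_eq _ _).trans (congrArg (C.eqTerm _) hf.map_zero)))

theorem IsHom.map_toTerm_and (hf : IsHom (Term.alg d) C f) (φ ψ : Fml d) :
    f (Fml.and φ ψ).toTerm = C.mul (f φ.toTerm) (f ψ.toTerm) := hf.map_mul _ _

theorem IsHom.map_toTerm_or (hf : IsHom (Term.alg d) C f) (φ ψ : Fml d) :
    f (Fml.or φ ψ).toTerm = C.add (f φ.toTerm) (f ψ.toTerm) := hf.map_add _ _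

theorem IsHom.map_toTerm_imp (hf : IsHom (Term.alg d) C f) (φ ψ : Fml d) :
    f (Fml.imp φ ψ).toTerm = C.add (C.neg (f φ.toTerm)) (f ψ.toTerm) :=
  (hf.map_add _ _).trans (congrArg (fun b => C.add b _) (hf.map_neg _))

theorem IsHom.map_toTerm_conj (hf : IsHom (Term.alg d) C f) {α : Type} (l : List α)
    (φ : α → Fml d) : f (Fml.conj l φ).toTerm = C.conjTerm l fun x => f (φ x).toTerm := by
  induction l with
  | nil => exact hf.map_toTerm_tru
  | cons x l ih => exact (hf.map_toTerm_and _ _).trans (congrArg (C.mul _) ih)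

theorem IsHom.map_toTerm_ite (hf : IsHom (Term.alg d) C f) {p : Prop} [Decidable p] (φ : Fml d) :
    f (if p then φ else Fml.tru).toTerm = if p then f φ.toTerm else C.eqTerm C.one C.one := by
  split_ifs
  · rfl
  · exact hf.map_toTerm_tru

theorem IsHom.map_toTerm_cnet (hf : IsHom (Term.alg d) C f) (N : PreNet d (Term d)) :
    f (cnet N).toTerm = C.cnetTerm (N.map f) := by
  have hmul : ∀ s t : Term d, f (s * t) = C.mul (f s) (f t) := hf.map_mul
  have hcyl : ∀ i t, f (.cyl i t) = C.cyl i (f t) := hf.map_cyl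
  have hperm : ∀ i j t, f (.perm i j t) = C.perm i j (f t) := hf.map_perm
  have hdiag : ∀ i j, f (.diag i j) = C.diag i j := hf.map_diag
  simp only [cnet, PAlg.cnetTerm, hf.map_toTerm_and, hf.map_toTerm_conj, hf.map_toTerm_ite,
    hf.map_toTerm_le, hf.map_toTerm_ne0, hf.map_toTerm_imp, hmul, hcyl, hperm, hdiag]

theorem IsHom.map_toTerm_psi (hf : IsHom (Term.alg d) C f) : ∀ (n k : ℕ) (N : PreNet d (Term d)),
    f (psi n k N).toTerm = C.psiTerm (fun i => f (.var i)) n k (N.map f)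
  | 0, _, N => hf.map_toTerm_cnet N
  | n + 1, k, N => by
    refine (hf.map_toTerm_conj _ _).trans (congrArg (C.conjTerm _) (funext fun m => ?_))
    rw [hf.map_toTerm_or, hf.map_toTerm_psi n, hf.map_toTerm_psi n, hf.map_accept, hf.map_reject]

end Hom

/-! ### Primitive recursiveness of the codes of the equations -/

/-- The operations on the Gödel numbers of terms. -/
def codeAlg (d : ℕ) : PAlg d ℕ where
  zero := Nat.pair 2 0
  one := Nat.pair 3 0
  add a b := Nat.pair 4 (Nat.pair a b)
  neg a := Nat.pair 5 a
  cyl i a := Nat.pair 6 (Nat.pair i a)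
  subst i j a := Nat.pair 7 (Nat.pair i (Nat.pair j a))
  perm i j a := Nat.pair 8 (Nat.pair i (Nat.pair j a))
  diag i j := Nat.pair 9 (Nat.pair i j)

theorem isHom_code (d : ℕ) : IsHom (Term.alg d) (codeAlg d) Term.code := by
  constructor <;> intros <;> rfl

/-- All tuples of numbers below `s`, in the order of `tuples d s`. -/
def natTuples (d s : ℕ) : List (Fin d → ℕ) :=
  (List.range (s ^ d)).map fun m i => m / s ^ (i : ℕ) % s

theorem natTuples_eq (d s : ℕ) : natTuples d s = (tuples d s).map fun x i => (x i : ℕ) := by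
  rw [natTuples, tuples, List.map_map, ← List.map_coe_finRange_eq_range, List.map_map]
  rfl

/-- A prenetwork labelled by numbers is encoded by the number of its nodes and the list of the
labelled tuples. -/
abbrev NetCode (d : ℕ) : Type := ℕ × List ((Fin d → ℕ) × ℕ)

namespace NetCode

variable {d : ℕ}

/-- The label of a tuple. -/
def label (E : NetCode d) (y : Fin d → ℕ) : ℕ := (E.2.lookup y).getD 0

/-- The prenetwork with a given code. -/
abbrev decode (E : NetCode d) : PreNet d ℕ := ⟨E.1, fun x => E.label fun i => x i⟩

/-- The code of the prenetwork with `s` nodes and the labels `f`. -/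
def mk (s : ℕ) (f : (Fin d → ℕ) → ℕ) : NetCode d := (s, (natTuples d s).map fun y => (y, f y))

/-- Prenetworks are changed on the level of codes by tabulating the new labels. -/
theorem decode_mk {s : ℕ} {f : (Fin d → ℕ) → ℕ} {L : (Fin d → Fin s) → ℕ}
    (h : ∀ x, f (fun i => x i) = L x) : (mk s f).decode = ⟨s, L⟩ := by
  refine congrArg (PreNet.mk s) (funext fun x => ?_)
  have hx : (fun i => (x i : ℕ)) ∈ natTuples d s := by
    rw [natTuples_eq]
    exact List.mem_map.2 ⟨x, mem_tuples x, rfl⟩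
  show (List.lookup _ ((natTuples d s).map fun y => (y, f y))).getD 0 = _
  rw [List.lookup_graph f hx]
  exact h x

end NetCode

section Primrec

variable {d : ℕ} {α β : Type*} [Primcodable α] [Primcodable β]

theorem primrec_tuple_apply {X : α → Fin d → ℕ} (hX : Primrec X) (i : Fin d) :
    Primrec fun a => X a i := Primrec.fin_app.comp hX (Primrec.const i)

theorem primrec_tuple {X : α → Fin d → ℕ} (h : ∀ i, Primrec fun a => X a i) : Primrec X :=
  Primrec.fin_curry.2 (Primrec.fin_curry₁ (f := fun i a => X a i) |>.2 h).swap

theorem primrec_tuple_update {X : α → Fin d → ℕ} {f : α → ℕ} (hX : Primrec X) (hf : Primrec f)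
    (i : Fin d) : Primrec fun a => Function.update (X a) i (f a) := by
  refine primrec_tuple fun j => ?_
  rcases eq_or_ne j i with rfl | hj
  · simpa using hf
  · simpa [hj] using primrec_tuple_apply hX j

theorem primrec_tuple_comp {X : α → Fin d → ℕ} (hX : Primrec X) (σ : Fin d → Fin d) :
    Primrec fun a => X a ∘ σ := primrec_tuple fun j => primrec_tuple_apply hX (σ j)

theorem primrec_add {f g : α → ℕ} (hf : Primrec f) (hg : Primrec g) :
    Primrec fun a => (codeAlg d).add (f a) (g a) :=
  Primrec₂.natPair.comp (Primrec.const 4) (Primrec₂.natPair.comp hf hg)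

theorem primrec_neg {f : α → ℕ} (hf : Primrec f) : Primrec fun a => (codeAlg d).neg (f a) :=
  Primrec₂.natPair.comp (Primrec.const 5) hf

theorem primrec_cyl {f : α → ℕ} (hf : Primrec f) (i : Fin d) :
    Primrec fun a => (codeAlg d).cyl i (f a) :=
  Primrec₂.natPair.comp (Primrec.const 6) (Primrec₂.natPair.comp (Primrec.const _) hf)

theorem primrec_perm {f : α → ℕ} (hf : Primrec f) (i j : Fin d) :
    Primrec fun a => (codeAlg d).perm i j (f a) :=
  Primrec₂.natPair.comp (Primrec.const 8) (Primrec₂.natPair.comp (Primrec.const _)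
    (Primrec₂.natPair.comp (Primrec.const _) hf))

theorem primrec_mul {f g : α → ℕ} (hf : Primrec f) (hg : Primrec g) :
    Primrec fun a => (codeAlg d).mul (f a) (g a) :=
  primrec_neg (primrec_add (primrec_neg hf) (primrec_neg hg))

/-- Recursion over a list that does not depend on the argument is composition. -/
theorem primrec_foldr_const {κ σ : Type*} [Primcodable σ] (l : List κ) {f : α → σ}
    {g : κ → α → σ → σ} (hf : Primrec f)
    (hg : ∀ i (h : α → σ), Primrec h → Primrec fun a => g i a (h a)) :
    Primrec fun a => l.foldr (fun i b => g i a b) (f a) := by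
  induction l with
  | nil => exact hf
  | cons i l ih => exact hg i _ ih

theorem primrec_cylAll {f : α → ℕ} (hf : Primrec f) :
    Primrec fun a => (codeAlg d).cylAll (f a) :=
  primrec_foldr_const (List.finRange d) (g := fun i _ b => (codeAlg d).cyl i b) hf
    fun i _ h => primrec_cyl h i

theorem primrec_eqTerm {f g : α → ℕ} (hf : Primrec f) (hg : Primrec g) :
    Primrec fun a => (codeAlg d).eqTerm (f a) (g a) :=
  primrec_neg (primrec_cylAll (primrec_add (primrec_mul hf (primrec_neg hg))
    (primrec_mul (primrec_neg hf) hg)))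

theorem primrec_conjTerm_const {κ : Type} (l : List κ) {g : α → κ → ℕ}
    (hg : ∀ i, Primrec fun a => g a i) : Primrec fun a => (codeAlg d).conjTerm l (g a) :=
  primrec_foldr_const l (g := fun i a b => (codeAlg d).mul (g a i) b) (Primrec.const _)
    fun i _ h => primrec_mul (hg i) h

theorem primrec_conjTerm {β : Type} [Primcodable β] {l : α → List β} {g : α → β → ℕ}
    (hl : Primrec l) (hg : Primrec fun p : α × β => g p.1 p.2) :
    Primrec fun a => (codeAlg d).conjTerm (l a) (g a) :=
  Primrec.list_foldr hl (Primrec.const _)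
    (primrec_mul (hg.comp (Primrec.pair Primrec.fst (Primrec.fst.comp Primrec.snd)))
      (Primrec.snd.comp Primrec.snd)).to₂

theorem primrec_natTuples {s : α → ℕ} (hs : Primrec s) : Primrec fun a => natTuples d (s a) := by
  have hpow : Primrec₂ fun m n : ℕ => m ^ n := Primrec₂.unpaired'.1 Nat.Primrec.pow
  refine Primrec.list_map (Primrec.list_range.comp (hpow.comp hs (Primrec.const d))) ?_
  refine primrec_tuple fun i => ?_
  have hs' : Primrec fun p : α × ℕ => s p.1 := hs.comp Primrec.fst
  exact Primrec.nat_mod.comp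
    (Primrec.nat_div.comp Primrec.snd (hpow.comp hs' (Primrec.const _))) hs'

theorem primrec_label {E : α → NetCode d} {y : α → Fin d → ℕ} (hE : Primrec E) (hy : Primrec y) :
    Primrec fun a => (E a).label (y a) :=
  Primrec.option_getD.comp (Primrec.listLookup.comp hy (Primrec.snd.comp hE)) (Primrec.const 0)

theorem primrec_netCode_mk {s : α → ℕ} {f : α → (Fin d → ℕ) → ℕ} (hs : Primrec s)
    (hf : Primrec fun p : α × (Fin d → ℕ) => f p.1 p.2) :
    Primrec fun a => NetCode.mk (s a) (f a) :=
  Primrec.pair hs (Primrec.list_map (primrec_natTuples hs) (Primrec.pair Primrec.snd hf).to₂)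

end Primrec

/-! ### The codes of the network conditions -/

section Cnet

variable {d : ℕ}

theorem conjTerm_natTuples {A : Type u} (C : PAlg d A) {s : ℕ} {f : (Fin d → Fin s) → A}
    {g : (Fin d → ℕ) → A} (h : ∀ x, g (fun i => x i) = f x) :
    C.conjTerm (natTuples d s) g = C.conjTerm (tuples d s) f := by
  rw [natTuples_eq, PAlg.conjTerm, PAlg.conjTerm, List.foldr_map]
  simp only [h]

/-- Tuples agree off `i` if and only if they become equal when their entries at `i` are
overwritten. -/
theorem agreeOff_iff {s : ℕ} {i : Fin d} {x y : Fin d → Fin s} :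
    Function.update (fun l => (x l : ℕ)) i 0 = Function.update (fun l => (y l : ℕ)) i 0 ↔
      AgreeOff i x y := by
  constructor
  · intro h l hl
    have := congrFun h l
    rw [Function.update_of_ne hl, Function.update_of_ne hl] at this
    exact Fin.ext this
  · intro h
    funext l
    rcases eq_or_ne l i with rfl | hl
    · simp
    · rw [Function.update_of_ne hl, Function.update_of_ne hl, h l hl]

theorem natTuple_injective {s : ℕ} :
    Function.Injective fun (x : Fin d → Fin s) (i : Fin d) => (x i : ℕ) :=
  fun _ _ h => funext fun i => Fin.ext (congrFun h i)

theorem agreeSwap_iff {s : ℕ} {i j : Fin d} {x y : Fin d → Fin s} :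
    (fun l => (x l : ℕ)) = (fun l => (y l : ℕ)) ∘ Equiv.swap i j ↔ AgreeSwap i j x y :=
  natTuple_injective.eq_iff (a := x) (b := y ∘ Equiv.swap i j)

theorem primrec_cnetTerm : Primrec fun E : NetCode d => (codeAlg d).cnetTerm E.decode := by
  let C := codeAlg d
  let D := List.finRange d
  have hT : ∀ {α : Type} [Primcodable α] {E : α → NetCode d}, Primrec E →
      Primrec fun a => natTuples d (E a).1 := fun hE => primrec_natTuples (Primrec.fst.comp hE)
  have htru : ∀ {α : Type} [Primcodable α], Primrec fun _ : α => C.eqTerm C.one C.one :=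
    fun {α} _ => Primrec.const _
  have h1 : Primrec fun E : NetCode d => C.conjTerm (natTuples d E.1) fun x =>
      C.conjTerm D fun i => C.conjTerm D fun j => if x i = x j then
        C.eqTerm (C.add (E.label x) (C.diag i j)) (C.diag i j) else C.eqTerm C.one C.one := by
    refine primrec_conjTerm (hT .id) (primrec_conjTerm_const _ fun i =>
      primrec_conjTerm_const _ fun j => Primrec.ite ?_ ?_ htru)
    · exact Primrec.eq.comp (primrec_tuple_apply .snd i) (primrec_tuple_apply .snd j)
    · exact primrec_eqTerm (primrec_add (primrec_label .fst .snd) (.const _)) (.const _)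
  have h2 : Primrec fun E : NetCode d => C.conjTerm (natTuples d E.1) fun x =>
      C.conjTerm (natTuples d E.1) fun y => C.conjTerm D fun i =>
        if Function.update x i 0 = Function.update y i 0 then
          C.neg (C.eqTerm (C.mul (E.label x) (C.cyl i (E.label y))) C.zero)
        else C.eqTerm C.one C.one := by
    refine primrec_conjTerm (hT .id) (primrec_conjTerm (hT .fst)
      (primrec_conjTerm_const _ fun i => Primrec.ite ?_ ?_ htru))
    · exact Primrec.eq.comp (primrec_tuple_update (Primrec.snd.comp .fst) (.const 0) i)
        (primrec_tuple_update .snd (.const 0) i)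
    · exact primrec_neg (primrec_eqTerm (primrec_mul
        (primrec_label (Primrec.fst.comp .fst) (Primrec.snd.comp .fst))
        (primrec_cyl (primrec_label (Primrec.fst.comp .fst) .snd) i)) (.const _))
  have h3 : Primrec fun E : NetCode d => C.conjTerm (natTuples d E.1) fun x =>
      C.conjTerm (natTuples d E.1) fun y => C.conjTerm D fun i => C.conjTerm D fun j =>
        if x = y ∘ Equiv.swap i j then
          C.neg (C.eqTerm (C.mul (E.label x) (C.perm i j (E.label y))) C.zero)
        else C.eqTerm C.one C.one := by
    refine primrec_conjTerm (hT .id) (primrec_conjTerm (hT .fst)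
      (primrec_conjTerm_const _ fun i => primrec_conjTerm_const _ fun j =>
        Primrec.ite ?_ ?_ htru))
    · exact Primrec.eq.comp (Primrec.snd.comp .fst) (primrec_tuple_comp .snd _)
    · exact primrec_neg (primrec_eqTerm (primrec_mul
        (primrec_label (Primrec.fst.comp .fst) (Primrec.snd.comp .fst))
        (primrec_perm (primrec_label (Primrec.fst.comp .fst) .snd) i j)) (.const _))
  have h4 : Primrec fun E : NetCode d => C.conjTerm (natTuples d E.1) fun x =>
      C.conjTerm (natTuples d E.1) fun y => C.conjTerm (natTuples d E.1) fun z =>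
        C.conjTerm D fun i => C.conjTerm D fun j => C.conjTerm D fun k =>
        if Function.update x i 0 = Function.update y i 0 ∧ x i = z j ∧ y i = z k then
          C.add (C.neg (C.eqTerm (C.add (E.label z) (C.diag j k)) (C.diag j k)))
            (C.neg (C.eqTerm (C.mul (E.label x) (E.label y)) C.zero))
        else C.eqTerm C.one C.one := by
    have hE : Primrec fun p : ((NetCode d × (Fin d → ℕ)) × (Fin d → ℕ)) × (Fin d → ℕ) =>
      p.1.1.1 := Primrec.fst.comp (Primrec.fst.comp .fst)
    have hx : Primrec fun p : ((NetCode d × (Fin d → ℕ)) × (Fin d → ℕ)) × (Fin d → ℕ) =>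
      p.1.1.2 := Primrec.snd.comp (Primrec.fst.comp .fst)
    have hy : Primrec fun p : ((NetCode d × (Fin d → ℕ)) × (Fin d → ℕ)) × (Fin d → ℕ) =>
      p.1.2 := Primrec.snd.comp .fst
    have hz : Primrec fun p : ((NetCode d × (Fin d → ℕ)) × (Fin d → ℕ)) × (Fin d → ℕ) =>
      p.2 := .snd
    refine primrec_conjTerm (hT .id) (primrec_conjTerm (hT .fst) (primrec_conjTerm
      (hT (Primrec.fst.comp .fst)) (primrec_conjTerm_const _ fun i =>
        primrec_conjTerm_const _ fun j => primrec_conjTerm_const _ fun k =>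
        Primrec.ite (PrimrecPred.and ?_ (PrimrecPred.and ?_ ?_)) ?_ htru)))
    · exact Primrec.eq.comp (primrec_tuple_update hx (.const 0) i)
        (primrec_tuple_update hy (.const 0) i)
    · exact Primrec.eq.comp (primrec_tuple_apply hx i) (primrec_tuple_apply hz j)
    · exact Primrec.eq.comp (primrec_tuple_apply hy i) (primrec_tuple_apply hz k)
    · exact primrec_add
        (primrec_neg (primrec_eqTerm (primrec_add (primrec_label hE hz) (.const _)) (.const _)))
        (primrec_neg (primrec_eqTerm (primrec_mul (primrec_label hE hx) (primrec_label hE hy))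
          (.const _)))
  refine (primrec_mul (d := d) h1 (primrec_mul (d := d) h2
    (primrec_mul (d := d) h3 h4))).of_eq fun E => ?_
  have hite : ∀ {p q : Prop} {hp : Decidable p} {hq : Decidable q} {a b : ℕ}, (p ↔ q) →
      @ite ℕ p hp a b = @ite ℕ q hq a b := fun h => if_congr h rfl rfl
  refine congrArg₂ C.mul ?_ (congrArg₂ C.mul ?_ (congrArg₂ C.mul ?_ ?_))
  · refine conjTerm_natTuples C fun x => congrArg (C.conjTerm D) (funext fun i =>
      congrArg (C.conjTerm D) (funext fun j => ?_))
    exact hite Fin.val_inj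
  · refine conjTerm_natTuples C fun x => conjTerm_natTuples C fun y =>
      congrArg (C.conjTerm D) (funext fun i => ?_)
    exact hite agreeOff_iff
  · refine conjTerm_natTuples C fun x => conjTerm_natTuples C fun y =>
      congrArg (C.conjTerm D) (funext fun i => congrArg (C.conjTerm D) (funext fun j => ?_))
    exact hite agreeSwap_iff
  · refine conjTerm_natTuples C fun x => conjTerm_natTuples C fun y =>
      conjTerm_natTuples C fun z =>
      congrArg (C.conjTerm D) (funext fun i => congrArg (C.conjTerm D) (funext fun j =>
        congrArg (C.conjTerm D) (funext fun k => ?_)))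
    exact hite (and_congr agreeOff_iff (and_congr Fin.val_inj Fin.val_inj))

end Cnet

/-! ### The codes of the positions of the game -/

/-- A move of `∀`, apart from the tuple and the element that he picks. -/
inductive MoveKind (d : ℕ) : Type
  | cyl (i : Fin d) : MoveKind d
  | choice : MoveKind d
  | poly (i j : Fin d) : MoveKind d

namespace MoveKind

variable {d : ℕ}

/-- The move of a given kind at a given tuple. -/
def shape {k : ℕ} : MoveKind d → (Fin d → Fin k) → Shape d k
  | cyl i, x => .cyl i x
  | choice, x => .choice x
  | poly i j, x => .poly i j x

/-- All kinds of moves, in the order in which they appear in `shapes`. -/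
def all (d : ℕ) : List (MoveKind d) :=
  (List.finRange d).map cyl ++ [choice] ++
    (List.finRange d).flatMap fun i => (List.finRange d).map (poly i)

theorem shapes_eq (d k : ℕ) :
    shapes d k = (tuples d k).flatMap fun x => (all d).map fun κ => κ.shape x := by
  simp only [shapes, all, List.map_append, List.map_flatMap, List.map_map, List.map_cons,
    List.map_nil, Function.comp_def, shape]

end MoveKind

namespace NetCode

variable {d : ℕ}

/-- The code of the product of the diagonal constants that belong to a tuple. -/
def diagProd (w : Fin d → ℕ) : ℕ :=
  (List.finRange d ×ˢ List.finRange d).foldr (fun p b => if w p.1 = w p.2 then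
    (codeAlg d).mul ((codeAlg d).diag p.1 p.2) b else b) (codeAlg d).one

theorem diagProd_eq {s : ℕ} (x : Fin d → Fin s) :
    diagProd (fun i => (x i : ℕ)) = (codeAlg d).diagProd x := by
  rw [diagProd, PAlg.diagProd, PAlg.listProd, List.foldr_map, List.foldr_filter]
  simp only [Fin.val_inj, decide_eq_true_eq]

/-- The code of the prenetwork that results from accepting a move. -/
def accept (E : NetCode d) : MoveKind d → (Fin d → ℕ) → ℕ → NetCode d
  | .cyl i, y, v => mk (E.1 + 1) fun w =>
      if w = Function.update y i E.1 then (codeAlg d).mul v (diagProd w)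
      else if ∀ l, w l ≠ E.1 then
        if w = y then (codeAlg d).mul (E.label y) ((codeAlg d).cyl i v) else E.label w
      else diagProd w
  | .choice, y, v => mk E.1 fun w => if w = y then (codeAlg d).mul (E.label y) v else E.label w
  | .poly i j, y, v => mk E.1 fun w =>
      if w = y ∘ Equiv.swap i j then
        (codeAlg d).mul (if y ∘ Equiv.swap i j = y then
          (codeAlg d).mul (E.label y) ((codeAlg d).perm i j v)
          else E.label (y ∘ Equiv.swap i j)) v
      else if w = y then (codeAlg d).mul (E.label y) ((codeAlg d).perm i j v) else E.label w

/-- The code of the prenetwork that results from rejecting a move. -/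
def reject (E : NetCode d) (κ : MoveKind d) (y : Fin d → ℕ) (v : ℕ) : NetCode d :=
  mk E.1 fun w => if w = y then
    (codeAlg d).mul (E.label y) ((codeAlg d).neg
      (match κ with
        | .cyl i => (codeAlg d).cyl i v
        | .choice => v
        | .poly i j => (codeAlg d).perm i j v))
    else E.label w

theorem decode_accept (E : NetCode d) (κ : MoveKind d) (x : Fin d → Fin E.decode.size) (v : ℕ) :
    (E.accept κ (fun i => x i) v).decode = (codeAlg d).accept E.decode (κ.shape x) v := by
  cases κ with
  | cyl i =>
    refine decode_mk fun w => ?_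
    have hz : Function.update (fun l => (x l : ℕ)) i E.1 = fun l =>
        (Function.update (fun l => (x l).castSucc) i (Fin.last E.decode.size) l : ℕ) := by
      funext l
      rcases eq_or_ne l i with rfl | hl
      · simp [decode]
      · simp [hl]
    rw [hz]
    have hl : (∀ l, (w l : ℕ) ≠ E.1) ↔ ∀ l, w l ≠ Fin.last E.decode.size :=
      forall_congr' fun l => not_congr (Fin.val_inj (b := Fin.last E.1))
    by_cases h1 : w = Function.update (fun l => (x l).castSucc) i (Fin.last E.decode.size)
    · rw [if_pos (congrArg (fun (w : Fin d → Fin (E.1 + 1)) l => (w l : ℕ)) h1), if_pos h1, ← h1]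
      exact congrArg _ (diagProd_eq w)
    rw [if_neg fun h => h1 (natTuple_injective h), if_neg h1]
    by_cases h2 : ∀ l, w l ≠ Fin.last E.decode.size
    · rw [if_pos (hl.2 h2), dif_pos h2]
      by_cases h3 : (fun l => (w l).castPred (h2 l)) = x
      · rw [if_pos h3, if_pos (by rw [← h3]; rfl)]
      · rw [if_neg h3, if_neg fun h : (fun l => (w l : ℕ)) = fun l => (x l : ℕ) =>
          h3 (natTuple_injective (a₁ := fun l => (w l).castPred (h2 l)) h)]
        rfl
    · rw [if_neg fun h => h2 (hl.1 h), dif_neg h2]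
      exact diagProd_eq w
  | choice =>
    refine decode_mk fun w => ?_
    by_cases h : w = x
    · subst h
      rw [if_pos rfl, Function.update_self]
    · rw [if_neg fun h' => h (natTuple_injective h'), Function.update_of_ne h]
  | poly i j =>
    refine decode_mk fun w => ?_
    have hp : ∀ {w' : Fin d → Fin E.1}, ((fun l => (w' l : ℕ)) =
        (fun l => (x l : ℕ)) ∘ Equiv.swap i j) ↔ w' = x ∘ Equiv.swap i j :=
      fun {w'} => natTuple_injective.eq_iff (a := w') (b := x ∘ Equiv.swap i j)
    have hL : ∀ w' : Fin d → Fin E.1, (if (fun l => (w' l : ℕ)) = (fun l => (x l : ℕ)) then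
        (codeAlg d).mul (E.label fun l => x l) ((codeAlg d).perm i j v)
        else E.label fun l => w' l) = Function.update E.decode.label x
          ((codeAlg d).mul (E.decode.label x) ((codeAlg d).perm i j v)) w' := by
      intro w'
      by_cases h : w' = x
      · subst h
        rw [if_pos rfl, Function.update_self]
      · rw [if_neg fun h' => h (natTuple_injective h'), Function.update_of_ne h]
    by_cases h : w = x ∘ Equiv.swap i j
    · rw [if_pos (hp.2 h), h, Function.update_self]
      exact congrArg (fun b => (codeAlg d).mul b v) (hL (x ∘ Equiv.swap i j))
    · rw [if_neg fun h' => h (hp.1 h'), Function.update_of_ne h]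
      exact hL w

theorem decode_reject (E : NetCode d) (κ : MoveKind d) (x : Fin d → Fin E.decode.size) (v : ℕ) :
    (E.reject κ (fun i => x i) v).decode = (codeAlg d).reject E.decode (κ.shape x) v := by
  cases κ <;>
  · refine decode_mk fun w => ?_
    by_cases h : w = x
    · subst h
      rw [if_pos rfl, Function.update_self]
    · rw [if_neg fun h' => h (natTuple_injective h'), Function.update_of_ne h]

end NetCode

section Primrec

variable {d : ℕ} {α : Type*} [Primcodable α]

theorem primrec_diagProd {w : α → Fin d → ℕ} (hw : Primrec w) :
    Primrec fun a => NetCode.diagProd (w a) :=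
  primrec_foldr_const (List.finRange d ×ˢ List.finRange d) (g := fun p a b =>
      if w a p.1 = w a p.2 then (codeAlg d).mul ((codeAlg d).diag p.1 p.2) b else b)
    (Primrec.const _) fun p _ h =>
      Primrec.ite (Primrec.eq.comp (primrec_tuple_apply hw p.1) (primrec_tuple_apply hw p.2))
        (primrec_mul (Primrec.const _) h) h

theorem primrecPred_forall_ne {w : α → Fin d → ℕ} {f : α → ℕ} (hw : Primrec w) (hf : Primrec f) :
    PrimrecPred fun a => ∀ l, w a l ≠ f a := by
  have key : ∀ L : List (Fin d), PrimrecPred fun a => ∀ l ∈ L, w a l ≠ f a := by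
    intro L
    induction L with
    | nil => exact (Primrec.eq.comp (Primrec.const 0) (Primrec.const 0)).of_eq fun a => by simp
    | cons l L ih =>
      exact ((Primrec.eq.comp (primrec_tuple_apply hw l) hf).not.and ih).of_eq fun a => by simp
  exact (key (List.finRange d)).of_eq fun a => by simp

theorem primrec_accept {E : α → NetCode d} {y : α → Fin d → ℕ} {v : α → ℕ} (hE : Primrec E)
    (hy : Primrec y) (hv : Primrec v) (κ : MoveKind d) :
    Primrec fun a => (E a).accept κ (y a) (v a) := by
  have hE' : Primrec fun p : α × (Fin d → ℕ) => E p.1 := hE.comp .fst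
  have hy' : Primrec fun p : α × (Fin d → ℕ) => y p.1 := hy.comp .fst
  have hv' : Primrec fun p : α × (Fin d → ℕ) => v p.1 := hv.comp .fst
  have hs' : Primrec fun p : α × (Fin d → ℕ) => (E p.1).1 := Primrec.fst.comp hE'
  cases κ with
  | cyl i =>
    refine primrec_netCode_mk (Primrec.succ.comp (Primrec.fst.comp hE)) (Primrec.ite
      (Primrec.eq.comp .snd (primrec_tuple_update hy' hs' i))
      (primrec_mul hv' (primrec_diagProd .snd))
      (Primrec.ite (primrecPred_forall_ne .snd hs') (Primrec.ite (Primrec.eq.comp .snd hy')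
        (primrec_mul (primrec_label hE' hy') (primrec_cyl hv' i)) (primrec_label hE' .snd))
        (primrec_diagProd .snd)))
  | choice =>
    exact primrec_netCode_mk (Primrec.fst.comp hE) (Primrec.ite (Primrec.eq.comp .snd hy')
      (primrec_mul (primrec_label hE' hy') hv') (primrec_label hE' .snd))
  | poly i j =>
    have hp := primrec_tuple_comp hy' (Equiv.swap i j)
    have hq := primrec_mul (d := d) (primrec_label hE' hy') (primrec_perm hv' i j)
    exact primrec_netCode_mk (Primrec.fst.comp hE) (Primrec.ite (Primrec.eq.comp .snd hp)
      (primrec_mul (Primrec.ite (Primrec.eq.comp hp hy') hq (primrec_label hE' hp)) hv')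
      (Primrec.ite (Primrec.eq.comp .snd hy') hq (primrec_label hE' .snd)))

theorem primrec_reject {E : α → NetCode d} {y : α → Fin d → ℕ} {v : α → ℕ} (hE : Primrec E)
    (hy : Primrec y) (hv : Primrec v) (κ : MoveKind d) :
    Primrec fun a => (E a).reject κ (y a) (v a) := by
  have hE' : Primrec fun p : α × (Fin d → ℕ) => E p.1 := hE.comp .fst
  have hy' : Primrec fun p : α × (Fin d → ℕ) => y p.1 := hy.comp .fst
  have hv' : Primrec fun p : α × (Fin d → ℕ) => v p.1 := hv.comp .fst
  refine primrec_netCode_mk (Primrec.fst.comp hE) (Primrec.ite (Primrec.eq.comp .snd hy')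
    (primrec_mul (primrec_label hE' hy') (primrec_neg ?_)) (primrec_label hE' .snd))
  cases κ with
  | cyl i => exact primrec_cyl hv' i
  | choice => exact hv'
  | poly i j => exact primrec_perm hv' i j

theorem primrec_flatMap_const {κ σ : Type*} [Primcodable σ] (l : List κ) {g : α → κ → List σ}
    (hg : ∀ i, Primrec fun a => g a i) : Primrec fun a => l.flatMap (g a) := by
  refine (primrec_foldr_const l (g := fun i a b => g a i ++ b) (Primrec.const [])
    fun i _ h => Primrec.list_append.comp (hg i) h).of_eq fun a => ?_
  induction l with
  | nil => rfl
  | cons i l ih => exact congrArg (g a i ++ ·) ih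

end Primrec

section Psi

variable {d : ℕ}

/-- The positions that are reached from a position of the game by one move of each shape: the
position after acceptance, followed by the one after rejection. A position consists of the number
of remaining rounds, the first variable that has not been used, and the code of a prenetwork. -/
def successors (b : (ℕ × ℕ) × NetCode d) : List ((ℕ × ℕ) × NetCode d) :=
  if b.1.1 = 0 then [] else
    (natTuples d b.2.1).flatMap fun y => (MoveKind.all d).flatMap fun κ =>
      [((b.1.1 - 1, b.1.2 + 1), b.2.accept κ y (Nat.pair 1 b.1.2)),
        ((b.1.1 - 1, b.1.2 + 2 ^ (b.1.1 - 1)), b.2.reject κ y (Nat.pair 1 b.1.2))]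

theorem primrec_successors : Primrec (successors : (ℕ × ℕ) × NetCode d → _) := by
  have hpow : Primrec₂ fun m n : ℕ => m ^ n := Primrec₂.unpaired'.1 Nat.Primrec.pow
  refine Primrec.ite (Primrec.eq.comp (Primrec.fst.comp .fst) (.const 0)) (.const []) ?_
  refine Primrec.list_flatMap (primrec_natTuples (Primrec.fst.comp .snd)) ?_
  refine primrec_flatMap_const _ fun κ => ?_
  have hn : Primrec fun p : ((ℕ × ℕ) × NetCode d) × (Fin d → ℕ) => p.1.1.1 - 1 :=
    Primrec.nat_sub.comp (Primrec.fst.comp (Primrec.fst.comp .fst)) (.const 1)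
  have hk : Primrec fun p : ((ℕ × ℕ) × NetCode d) × (Fin d → ℕ) => p.1.1.2 :=
    Primrec.snd.comp (Primrec.fst.comp .fst)
  have hE : Primrec fun p : ((ℕ × ℕ) × NetCode d) × (Fin d → ℕ) => p.1.2 :=
    Primrec.snd.comp .fst
  have hv : Primrec fun p : ((ℕ × ℕ) × NetCode d) × (Fin d → ℕ) => Nat.pair 1 p.1.1.2 :=
    Primrec₂.natPair.comp (.const 1) hk
  refine Primrec.list_cons.comp ?_ (Primrec.list_cons.comp ?_ (.const []))
  · exact Primrec.pair (Primrec.pair hn (Primrec.succ.comp hk)) (primrec_accept hE .snd hv κ)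
  · exact Primrec.pair (Primrec.pair hn (Primrec.nat_add.comp hk (hpow.comp (.const 2) hn)))
      (primrec_reject hE .snd hv κ)

/-- One step of the computation of the code of a conjunction of disjunctions from the list of the
codes of the disjuncts. The first component holds the second disjunct of a disjunction whose
first disjunct is still to come. -/
def conjDisjStep (d v : ℕ) (s : Option ℕ × ℕ) : Option ℕ × ℕ :=
  s.1.casesOn (some v, s.2) fun w => (none, (codeAlg d).mul ((codeAlg d).add v w) s.2)

/-- Since the list is folded from the right, the second disjunct of a disjunction comes before the
first one. -/
theorem foldr_conjDisjStep {β : Type} (l : List β) (f g : β → ℕ) :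
    (l.flatMap fun m => [f m, g m]).foldr (conjDisjStep d)
        (none, (codeAlg d).eqTerm (codeAlg d).one (codeAlg d).one) =
      (none, (codeAlg d).conjTerm l fun m => (codeAlg d).add (f m) (g m)) := by
  induction l with
  | nil => rfl
  | cons m l ih =>
    rw [List.flatMap_cons, List.foldr_append, ih]
    rfl

theorem primrec_conjDisjStep : Primrec₂ (conjDisjStep d) := by
  refine Primrec.option_casesOn (Primrec.fst.comp .snd)
    (Primrec.pair (Primrec.option_some.comp .fst) (Primrec.snd.comp .snd)) ?_
  exact (Primrec.pair (.const none) (primrec_mul (primrec_add (Primrec.fst.comp .fst) .snd)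
    (Primrec.snd.comp (Primrec.snd.comp .fst)))).to₂

/-- The code of `psi n k N`, as a function of `n`, `k` and the code of `N`. -/
def psiCode (b : (ℕ × ℕ) × NetCode d) : ℕ :=
  (codeAlg d).psiTerm (Nat.pair 1) b.1.1 b.1.2 b.2.decode

/-- The tree of the positions of the game has finite depth, and the list of the successors of a
position is primitive recursive. -/
theorem primrec_psiCode : Primrec (psiCode : (ℕ × ℕ) × NetCode d → ℕ) := by
  refine Primrec.nat_omega_rec' _ (m := fun b => b.1.1) (l := successors)
    (g := fun b vs => some (if b.1.1 = 0 then (codeAlg d).cnetTerm b.2.decode else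
      (vs.foldr (conjDisjStep d) (none, (codeAlg d).eqTerm (codeAlg d).one (codeAlg d).one)).2))
    (Primrec.fst.comp .fst) primrec_successors ?_ ?_ ?_
  · refine Primrec.option_some.comp (Primrec.ite
      (Primrec.eq.comp (Primrec.fst.comp (Primrec.fst.comp .fst)) (.const 0))
      (primrec_cnetTerm.comp (Primrec.snd.comp .fst)) (Primrec.snd.comp ?_))
    exact Primrec.list_foldr .snd (.const _) (primrec_conjDisjStep.comp
      (Primrec.fst.comp .snd) (Primrec.snd.comp .snd)).to₂
  · intro b b' hb'
    unfold successors at hb'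
    split_ifs at hb' with h
    · simp at hb'
    · simp only [List.mem_flatMap, List.mem_cons, List.not_mem_nil, or_false] at hb'
      obtain ⟨y, -, κ, -, rfl | rfl⟩ := hb'
      · exact Nat.sub_one_lt h
      · exact Nat.sub_one_lt h
  · rintro ⟨⟨n, k⟩, E⟩
    refine congrArg some ?_
    cases n with
    | zero => rfl
    | succ n =>
      rw [if_neg (Nat.succ_ne_zero n)]
      have hl : (successors ((n + 1, k), E)).map psiCode = (shapes d E.decode.size).flatMap fun m =>
          [(codeAlg d).psiTerm (Nat.pair 1) n (k + 1)
            ((codeAlg d).accept E.decode m (Nat.pair 1 k)),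
          (codeAlg d).psiTerm (Nat.pair 1) n (k + 2 ^ n)
            ((codeAlg d).reject E.decode m (Nat.pair 1 k))] := by
        rw [successors, if_neg (Nat.succ_ne_zero n), MoveKind.shapes_eq, natTuples_eq,
          List.map_flatMap, List.flatMap_map, List.flatMap_assoc]
        refine List.flatMap_congr fun x _ => ?_
        rw [List.map_flatMap, List.flatMap_map]
        refine List.flatMap_congr fun κ _ => ?_
        rw [← NetCode.decode_accept, ← NetCode.decode_reject]
        rfl
      rw [hl, foldr_conjDisjStep]
      rfl

end Psi

/-! ### Recursiveness of the sets of equations -/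

section Eps

variable {d : ℕ}

theorem NetCode.exists_decode_eq (N : PreNet d ℕ) : ∃ E : NetCode d, E.decode = N := by
  have h : ∀ x : Fin d → Fin N.size, Function.extend
      (fun (x : Fin d → Fin N.size) i => (x i : ℕ)) N.label 0 (fun i => x i) = N.label x :=
    fun x => natTuple_injective.extend_apply _ _ x
  exact ⟨NetCode.mk N.size _, NetCode.decode_mk h⟩

theorem code_eps (n : ℕ) : (eps d n).code = Nat.pair
    ((codeAlg d).add
      ((codeAlg d).neg ((codeAlg d).neg ((codeAlg d).eqTerm (Nat.pair 1 0) (codeAlg d).zero)))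
      ((codeAlg d).psiTerm (Nat.pair 1) n 1 ((codeAlg d).init (Nat.pair 1 0))))
    (codeAlg d).one := by
  have h := isHom_code d
  refine congrArg (Nat.pair · (codeAlg d).one) ((h.map_toTerm_imp _ _).trans
    (congrArg₂ (codeAlg d).add (congrArg (codeAlg d).neg (h.map_toTerm_ne0 _))
      ((h.map_toTerm_psi n 1 _).trans (congrArg ((codeAlg d).psiTerm _ n 1) ?_))))
  exact h.map_init _

theorem primrec_code_eps (d : ℕ) : Primrec fun n => (eps d n).code := by
  obtain ⟨E, hE⟩ := NetCode.exists_decode_eq ((codeAlg d).init (Nat.pair 1 0))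
  have h : Primrec fun n : ℕ => psiCode ((n, 1), E) :=
    primrec_psiCode.comp (Primrec.pair (Primrec.pair .id (.const 1)) (.const E))
  simp only [psiCode, hE] at h
  simp only [code_eps]
  exact Primrec₂.natPair.comp (primrec_add (.const _) h) (.const _)

theorem le_codeAlg_mul_left (a b : ℕ) : a ≤ (codeAlg d).mul a b :=
  (Nat.right_le_pair _ _).trans ((Nat.left_le_pair _ _).trans
    ((Nat.right_le_pair _ _).trans (Nat.right_le_pair _ _)))

theorem le_codeAlg_mul_right (a b : ℕ) : b ≤ (codeAlg d).mul a b :=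
  (Nat.right_le_pair _ _).trans ((Nat.right_le_pair _ _).trans
    ((Nat.right_le_pair _ _).trans (Nat.right_le_pair _ _)))

theorem le_codeAlg_conjTerm {α : Type} {l : List α} {x : α} (hx : x ∈ l) (f : α → ℕ) :
    f x ≤ (codeAlg d).conjTerm l f := by
  induction l with
  | nil => cases hx
  | cons y l ih =>
    rcases List.mem_cons.1 hx with rfl | hx
    · exact le_codeAlg_mul_left _ _
    · exact (ih hx).trans (le_codeAlg_mul_right _ _)

theorem lt_codeAlg_add_left (a b : ℕ) : a < (codeAlg d).add a b := by
  have h1 := Nat.left_le_pair a b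
  have h2 := Nat.add_le_pair 4 (Nat.pair a b)
  show a < Nat.pair 4 (Nat.pair a b)
  omega

theorem le_codeAlg_psiTerm (e : ℕ → ℕ) :
    ∀ (n k : ℕ) (N : PreNet d ℕ), 0 < N.size → n ≤ (codeAlg d).psiTerm e n k N
  | 0, _, _, _ => Nat.zero_le _
  | n + 1, k, N, hN => by
    let m : Shape d N.size := .choice fun _ => ⟨0, hN⟩
    have ih := le_codeAlg_psiTerm e n (k + 1) ((codeAlg d).accept N m (e k)) hN
    refine (Nat.succ_le_of_lt (ih.trans_lt (lt_codeAlg_add_left _ _))).trans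
      (le_codeAlg_conjTerm (mem_shapes m) fun m => (codeAlg d).add
        ((codeAlg d).psiTerm e n (k + 1) ((codeAlg d).accept N m (e k)))
        ((codeAlg d).psiTerm e n (k + 2 ^ n) ((codeAlg d).reject N m (e k))))

theorem le_code_eps (hd : 0 < d) (n : ℕ) : n ≤ (eps d n).code := by
  rw [code_eps]
  exact (le_codeAlg_psiTerm _ n 1 ((codeAlg d).init (Nat.pair 1 0)) hd).trans
    ((Nat.right_le_pair _ _).trans ((Nat.right_le_pair _ _).trans (Nat.left_le_pair _ _)))

/-- Since `n` is at most the Gödel number of `eps d n`, membership in the range of `eps d` can be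
decided by a bounded search. -/
theorem primrecPred_code_eps (hd : 0 < d) :
    PrimrecPred fun m : ℕ => ∃ e ∈ Set.range (eps d), e.code = m := by
  have hR : PrimrecRel fun n m : ℕ => (eps d n).code = m :=
    Primrec.eq.comp ((primrec_code_eps d).comp .fst) .snd
  refine (hR.exists_lt.comp Primrec.succ Primrec.id).of_eq fun m => ?_
  constructor
  · rintro ⟨n, -, h⟩
    exact ⟨_, ⟨n, rfl⟩, h⟩
  · rintro ⟨_, ⟨n, rfl⟩, rfl⟩
    exact ⟨n, Nat.lt_succ_of_le (le_code_eps hd n), rfl⟩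

open Term in
/-- The equations of `peaEquations d` that involve given indices. -/
def peaEquationList (i j k : Fin d) : List (Equation d) :=
  [⟨var 0 + var 1, var 1 + var 0⟩,
    ⟨var 0 + var 1 + var 2, var 0 + (var 1 + var 2)⟩,
    ⟨- -var 0, var 0⟩,
    ⟨var 0 + var 0 * var 1, var 0⟩,
    ⟨var 0 * (var 1 + var 2), var 0 * var 1 + var 0 * var 2⟩,
    ⟨var 0 + -var 0, 1⟩,
    ⟨var 0 * -var 0, 0⟩,
    ⟨subst i i (var 0), var 0⟩,
    ⟨perm i i (var 0), var 0⟩,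
    ⟨perm i j (var 0), perm j i (var 0)⟩,
    ⟨var 0 + cyl i (var 0), cyl i (var 0)⟩,
    ⟨cyl i (var 0 + var 1), cyl i (var 0) + cyl i (var 1)⟩,
    ⟨subst i j (cyl i (var 0)), cyl i (var 0)⟩,
    ⟨cyl i (subst i j (var 0)), subst i j (var 0)⟩,
    ⟨subst i j (cyl k (var 0)), cyl k (subst i j (var 0))⟩,
    ⟨subst i j (var 0 + var 1), subst i j (var 0) + subst i j (var 1)⟩,
    ⟨subst i j (-var 0), -subst i j (var 0)⟩,
    ⟨perm i j (var 0 + var 1), perm i j (var 0) + perm i j (var 1)⟩,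
    ⟨perm i j (-var 0), -perm i j (var 0)⟩,
    ⟨perm i j (perm i j (var 0)), var 0⟩,
    ⟨perm i j (perm i k (var 0)), perm j k (perm i j (var 0))⟩,
    ⟨perm i j (subst j i (var 0)), subst i j (var 0)⟩,
    ⟨subst i j (diag i j), 1⟩,
    ⟨var 0 * diag i j + subst i j (var 0), subst i j (var 0)⟩]

theorem IsPEAEquation.exists_mem (hd : 0 < d) {e : Equation d} (he : IsPEAEquation d e) :
    ∃ i j k, e ∈ peaEquationList i j k := by
  let o : Fin d := ⟨0, hd⟩
  cases he with
  | add_comm => exact ⟨o, o, o, List.mem_of_getElem? (i := 0) rfl⟩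
  | add_assoc => exact ⟨o, o, o, List.mem_of_getElem? (i := 1) rfl⟩
  | neg_neg => exact ⟨o, o, o, List.mem_of_getElem? (i := 2) rfl⟩
  | absorb => exact ⟨o, o, o, List.mem_of_getElem? (i := 3) rfl⟩
  | distrib => exact ⟨o, o, o, List.mem_of_getElem? (i := 4) rfl⟩
  | add_compl => exact ⟨o, o, o, List.mem_of_getElem? (i := 5) rfl⟩
  | mul_compl => exact ⟨o, o, o, List.mem_of_getElem? (i := 6) rfl⟩
  | subst_self i => exact ⟨i, o, o, List.mem_of_getElem? (i := 7) rfl⟩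
  | perm_self i => exact ⟨i, o, o, List.mem_of_getElem? (i := 8) rfl⟩
  | perm_comm i j => exact ⟨i, j, o, List.mem_of_getElem? (i := 9) rfl⟩
  | le_cyl i => exact ⟨i, o, o, List.mem_of_getElem? (i := 10) rfl⟩
  | cyl_add i => exact ⟨i, o, o, List.mem_of_getElem? (i := 11) rfl⟩
  | subst_cyl i j => exact ⟨i, j, o, List.mem_of_getElem? (i := 12) rfl⟩
  | cyl_subst i j => exact ⟨i, j, o, List.mem_of_getElem? (i := 13) rfl⟩
  | subst_cyl_comm i j k => exact ⟨i, j, k, List.mem_of_getElem? (i := 14) rfl⟩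
  | subst_add i j => exact ⟨i, j, o, List.mem_of_getElem? (i := 15) rfl⟩
  | subst_neg i j => exact ⟨i, j, o, List.mem_of_getElem? (i := 16) rfl⟩
  | perm_add i j => exact ⟨i, j, o, List.mem_of_getElem? (i := 17) rfl⟩
  | perm_neg i j => exact ⟨i, j, o, List.mem_of_getElem? (i := 18) rfl⟩
  | perm_perm i j => exact ⟨i, j, o, List.mem_of_getElem? (i := 19) rfl⟩
  | perm_perm_comm i j k => exact ⟨i, j, k, List.mem_of_getElem? (i := 20) rfl⟩
  | perm_subst i j => exact ⟨i, j, o, List.mem_of_getElem? (i := 21) rfl⟩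
  | subst_diag i j => exact ⟨i, j, o, List.mem_of_getElem? (i := 22) rfl⟩
  | diag_le i j => exact ⟨i, j, o, List.mem_of_getElem? (i := 23) rfl⟩

theorem finite_peaEquations (hd : 0 < d) : (peaEquations d).Finite := by
  have h : (⋃ (i) (j) (k), {e | e ∈ peaEquationList (d := d) i j k}).Finite :=
    Set.finite_iUnion fun i => Set.finite_iUnion fun j => Set.finite_iUnion fun k =>
      List.finite_toSet _
  refine h.subset fun e he => ?_
  obtain ⟨i, j, k, hm⟩ := IsPEAEquation.exists_mem hd he
  exact Set.mem_iUnion.2 ⟨i, Set.mem_iUnion.2 ⟨j, Set.mem_iUnion.2 ⟨k, hm⟩⟩⟩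

theorem primrecPred_code_of_finite {S : Set (Equation d)} (hS : S.Finite) :
    PrimrecPred fun m : ℕ => ∃ e ∈ S, e.code = m := by
  induction S, hS using Set.Finite.induction_on with
  | empty =>
    exact (Primrec.eq.comp (Primrec.const 0) (Primrec.const 1)).of_eq fun m => by simp
  | @insert a S _ _ ih =>
    exact ((Primrec.eq.comp (Primrec.const a.code) Primrec.id).or ih).of_eq fun m => by simp

theorem isRecursive_range_eps (hd : 0 < d) : IsRecursive (Set.range (eps d)) :=
  (primrecPred_code_eps hd).computablePred

theorem isRecursive_peaEquations_union_range_eps (hd : 0 < d) :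
    IsRecursive (peaEquations d ∪ Set.range (eps d)) :=
  ((primrecPred_code_of_finite (finite_peaEquations hd)).or
    (primrecPred_code_eps hd)).computablePred.of_eq fun m => by
      simp only [Set.mem_union, or_and_right, exists_or]

end Eps

end Polyadic

theorem mainTheorem3 (d : ℕ) (hd : 3 ≤ d) :
    -- `RPEA_d` is axiomatized by the equations of `PEA_d` and the equations `ε_n^d`
    (∀ (A : Type u) (C : Polyadic.PAlg d A), C.Representable ↔
      ∀ e ∈ Polyadic.peaEquations d ∪ Set.range (Polyadic.eps d), C.Sat e) ∧
    -- the sequence and the set of these equations are recursive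
    Computable (fun n : ℕ => (Polyadic.eps d n).code) ∧
    Polyadic.IsRecursive (Set.range (Polyadic.eps d)) ∧
    Polyadic.IsRecursive (Polyadic.peaEquations d ∪ Set.range (Polyadic.eps d)) ∧
    -- the game characterization of representability
    (∀ (A : Type u) (C : Polyadic.PAlg d A), C.IsPEA →
      (C.Representable ↔ ∀ (n : ℕ) (a : A), a ≠ C.zero → C.ExistsWins n (C.init a))) ∧
    -- the universal sentences express the existence of winning strategies
    (∀ (A : Type u) (C : Polyadic.PAlg d A), C.IsPEA → ∀ n : ℕ,
      (C.Models (Polyadic.phi d n) ↔ ∀ a : A, a ≠ C.zero → C.ExistsWins n (C.init a))) ∧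
    -- the discriminator term converts them into equations on simple algebras
    (∀ (A : Type u) (C : Polyadic.PAlg d A), C.IsPEA → C.IsSimple →
      (∀ x : A, x ≠ C.zero → C.cylAll x = C.one) ∧
      ∀ n : ℕ, C.Sat (Polyadic.eps d n) ↔ C.Models (Polyadic.phi d n)) := by
  have hd0 : 0 < d := by omega
  refine ⟨fun A C => ⟨fun hC e he => ?_, fun h => ?_⟩, (Polyadic.primrec_code_eps d).to_comp,
    Polyadic.isRecursive_range_eps hd0, Polyadic.isRecursive_peaEquations_union_range_eps hd0,
    fun A C hC => ?_, fun A C hC n => ?_, fun A C hC hs => ?_⟩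
  · rcases he with he | ⟨n, rfl⟩
    · exact hC.isPEA e he
    · exact hC.sat_eps hd n
  · exact Polyadic.representable_of_sat hd (fun e he => h e (Or.inl he))
      fun n => h _ (Or.inr ⟨n, rfl⟩)
  · obtain ⟨_, h⟩ := hC.exists_laws
    refine ⟨fun hr n a ha => (h.existsWins_init_iff hd0 n a).2 (hr.wins_init h n ha),
      fun hw => h.representable_of_wins (by omega) fun n a ha =>
        (h.existsWins_init_iff hd0 n a).1 (hw n a ha)⟩
  · obtain ⟨_, h⟩ := hC.exists_laws
    rw [Polyadic.models_phi_iff n]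
    exact forall₂_congr fun a _ => (h.existsWins_init_iff hd0 n a).symm
  · obtain ⟨_, h⟩ := hC.exists_laws
    have hc := fun x hx => h.cylAll_eq_one (by omega) hs (x := x) hx
    have := hs.1
    exact ⟨hc, Polyadic.sat_eps_iff hC hd hc⟩
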